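/- Fix $\alpha\in(1/2,1)$. Let $\mathbf T_\infty$ be the Galton–Watson plane tree with offspring law $\mu(k)=\alpha^k(1-\alpha)$, $k\ge 0$, of mean $m=\alpha/(1-\alpha)>1$, conditioned to be infinite. Its causal triangulation is obtained by joining, at each height $r\ge 1$, the consecutive vertices of that height (from left to right) by horizontal edges into a cycle, and then, in every face between two consecutive heights, joining each vertex of the bottom side except the rightmost one to the top-right vertex of the face. Thus, besides the edges to its children, each vertex other than the root has one further edge to the next height, leading to the vertex that follows cyclically its last child or, if it has no child, the last child of the first vertex with children met when moving cyclically to its left (multiple edges may occur). Non-horizontal edges are directed away from the root and horizontal edges are ignored. Given the tree, each directed edge is open with probability $p\in[0,1]$ and closed otherwise, independently; $\mathbb P_p$ denotes the annealed law (averaged over the tree and the percolation). Let $\mathcal C$ be the set of vertices that can be reached from the root by directed open paths, $|\mathcal C|$ its number of vertices, $\Theta(p)=\mathbb P_p(|\mathcal C|=\infty)$, and $$p_c=\frac{\eta}{1+\eta},\qquad \eta=\frac1{m+1}\sum_{n\ge0}\frac{m-1}{m^{n+1}-1}.$$ Then there are constants $c,c',C>0$, depending only on $\alpha$, such that: (i)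 $\mathbb P_{p_c}(|\mathcal C|\ge n)\ge c\,n^{-1/2}$ for all $n\ge1$, and $\mathbb P_{p_c}(|\mathcal C|\ge n)\le c'\log(n)\,n^{-1/2}$ for all $n\ge2$; (ii) $C^{-1}(p-p_c)\le\Theta(p)\le C(p-p_c)$ for every $p\in(p_c,1]$. -/

import Mathlib

namespace SCT

open MeasureTheory ProbabilityTheory unitInterval

/-- Locally finite rooted plane trees, in breadth-first coding. The vertex `(r, i)` is the `i`-th
vertex from the left (counted from `0`) of generation `r`, the root is `(0, 0)`, and `t (r, i)` is
the number of children of `(r, i)`. Only the values at the vertices of the tree matter, that is at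
the `(r, i)` with `i < width t r`. -/
abbrev PlaneTree : Type := ℕ × ℕ → ℕ

/-- The number of vertices of generation `r`. -/
def width (t : PlaneTree) : ℕ → ℕ
  | 0 => 1
  | r + 1 => ∑ i ∈ Finset.range (width t r), t (r, i)

/-- The number of children of the vertices of generation `r` on the left of `(r, i)`. The children
of `(r, i)` are the `(r + 1, firstChild t r i + j)` with `j < t (r, i)`. -/
def firstChild (t : PlaneTree) (r i : ℕ) : ℕ :=
  ∑ j ∈ Finset.range i, t (r, j)

/-- The tree is infinite. -/
def Survives (t : PlaneTree) : Prop :=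
  ∀ r, 0 < width t r

/-- The number of edges of the causal triangulation of `t` from the vertex `v` to the next
generation: one to each child of `v` and, unless `v` is the root, one edge added in the
triangulation. -/
def upDegree (t : PlaneTree) (v : ℕ × ℕ) : ℕ :=
  if v.1 = 0 then t v else t v + 1

/-- The upper endpoint of the `j`-th upward edge of `v` in the causal triangulation of `t`. For
`j < t v` it is the `j`-th child of `v`. For `j = t v` it is the vertex that follows, in the cyclic
order of the next generation, the last child of `v` or, if `v` has no child, that of the nearest
vertex with children on the left of `v` (also cyclically). This is the top-right vertex of the face (bounded by two consecutive tree edges and by the two horizontal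
cycles) which has `v` on its bottom side but not as the rightmost vertex. The bottom side of the
face around the root is a single vertex, so that no edge is added there. -/
def upNeighbour (t : PlaneTree) (v : ℕ × ℕ) (j : ℕ) : ℕ × ℕ :=
  (v.1 + 1, (firstChild t v.1 v.2 + j) % width t (v.1 + 1))

/-- There is an open edge directed from `v` to `w`. The state of the `j`-th upward edge of `v` is
`ω (v, j)`, with `true` for open. Horizontal edges play no role. -/
def OpenEdge (t : PlaneTree) (ω : (ℕ × ℕ) × ℕ → Bool) (v w : ℕ × ℕ) : Prop :=
  ∃ j < upDegree t v, ω (v, j) = true ∧ w = upNeighbour t v j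

/-- The directed percolation cluster of the root: the vertices that an open directed path from
the root reaches. -/
def cluster (t : PlaneTree) (ω : (ℕ × ℕ) × ℕ → Bool) : Set (ℕ × ℕ) :=
  {v | Relation.ReflTransGen (OpenEdge t ω) (0, 0) v}

/-- The law of a Galton-Watson tree whose offspring distribution gives mass `α ^ k * (1 - α)`
to each `k` (for `α < 1`). -/
noncomputable def galtonWatson (α : I) : Measure PlaneTree :=
  Measure.infinitePi fun _ => geometricMeasure (σ α)

/-- The law of the Galton-Watson tree conditioned to survive. -/
noncomputable def survivingTree (α : I) : Measure PlaneTree :=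
  cond (galtonWatson α) {t | Survives t}

/-- Independent edge states, each open with probability `p`. -/
noncomputable def percolation (p : I) : Measure ((ℕ × ℕ) × ℕ → Bool) :=
  Measure.infinitePi fun _ => bernoulliMeasure true false p

/-- The annealed law: the tree is a surviving Galton-Watson tree and, given the tree, the edges
of its causal triangulation are open independently with probability `p`. -/
noncomputable def annealed (α p : I) : Measure (PlaneTree × ((ℕ × ℕ) × ℕ → Bool)) :=
  (survivingTree α).prod (percolation p)

/-- The annealed probability that the cluster of the root has at least `n` vertices. -/
noncomputable def clusterTail (α p : I) (n : ℕ) : ℝ :=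
  (annealed α p).real {x | (n : ℕ∞) ≤ (cluster x.1 x.2).encard}

/-- The annealed probability that the cluster of the root is infinite. -/
noncomputable def percolationProb (α p : I) : ℝ :=
  (annealed α p).real {x | (cluster x.1 x.2).Infinite}

/-- The mean of the offspring distribution. -/
noncomputable def offspringMean (α : I) : ℝ := (α : ℝ) / (1 - α)

/-- The ratio `p_c / (1 - p_c)`. -/
noncomputable def criticalOdds (α : I) : ℝ :=
  1 / (offspringMean α + 1) *
    ∑' n : ℕ, (offspringMean α - 1) / (offspringMean α ^ (n + 1) - 1)

theorem criticalOdds_nonneg (α : I) : 0 ≤ criticalOdds α := by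
  have hm : 0 ≤ offspringMean α := div_nonneg α.2.1 (sub_nonneg.2 α.2.2)
  refine mul_nonneg (by positivity) (tsum_nonneg fun n => ?_)
  rcases le_total 1 (offspringMean α) with h | h
  · exact div_nonneg (sub_nonneg.2 h) (sub_nonneg.2 (one_le_pow₀ h))
  · exact div_nonneg_of_nonpos (sub_nonpos.2 h) (sub_nonpos.2 (pow_le_one₀ hm h))

/-- The critical parameter `p_c`. -/
noncomputable def criticalParam (α : I) : I :=
  ⟨criticalOdds α / (1 + criticalOdds α), by
    have h := criticalOdds_nonneg α
    exact ⟨by positivity, (div_le_one (by positivity)).2 (by linarith)⟩⟩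

end SCT

/-! The percolation is first studied in a half-plane, where positions are not reduced modulo the
widths, every generation is infinite to the right, and `(r, i)` has `t (r, i) + 1` consecutive
upward edges. Read a layer of edges from left to right: from one edge to the next, either the top
endpoint or the bottom endpoint moves by one. Since the geometric law is memoryless, these choices
are independent coin tosses of parameter `α` (`map_edgeBit`), so the half-plane percolation is coded
by two arrays of independent bits (`measurePreserving_bits`).

Explore the half-plane cluster depth first, from the left. If the current edge is open, go up. If it
is closed, pass to the next edge of the same vertex or, if there is none, backtrack. Backtracking is
a cascade (`Casc`): the edges that end at an abandoned vertex are passed over, which abandons a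
geometric number of vertices one generation below, and so on until a vertex of the current path has
an edge left. This is a subcritical branching process of mean `1 / m`, whose survival probabilities
are `contProb`. Every step meets fresh randomness, so the height is a random walk with i.i.d. steps
`1 - J`, killed at height `0` (`bits_iUnion_runSet`), and its drift is `(1 + η) (p - p_c)`
(`drift_jumpLaw`).

The steps of this walk are at most `1`, so its maximum counts records, and by time reversal a record
at time `k` is as likely as staying positive up to time `k`. Moment bounds for the maximum and for
the walk restricted to staying positive show that survival for `n` steps has probability of order `n
^ (-1/2)` at `p_c`. Above `p_c` the survival probability decreases to a limit of the order of the
drift. Upward steps visit distinct vertices, and a finished exploration misses only skipped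
vertices, whose mean number per cascade is bounded; this turns survival times into cluster sizes
(`exists_le_bitTail`, `exists_bitTail_le`, `drift_le_bitTail`, `bits_infinite_le_of_gt`).

It remains to return to the cyclic map over a surviving tree. For upper bounds, cut a path of the
cluster at its last edge that winds around: the cluster is covered by the half-plane clusters of the
vertices `(r, 0)` over the generations `r` where winding occurs. The number of vertices on the right
of the cluster tends to grow like a supercritical branching process, so winding at generation `r`
has probability at most `l ^ r` with `l < 1` (`exists_treeLaw_wraps_le`), and it is independent of
what lies above. The sum over `r` costs a constant only; in particular the upper bound at `p_c`
holds without the logarithm. For lower bounds, with probability bounded below the part of the tree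
on the right of the half-plane cluster of `(1, 0)` never dies out; then this cluster never winds,
the tree survives, and the root reaches it through one open edge (`mul_bitTail_le`). -/

namespace SCT

open MeasureTheory ProbabilityTheory unitInterval
open scoped ENNReal

/-! ### Independence by splicing two copies of a product space -/

section Splice

variable {X Y : Type*} [MeasurableSpace X] [MeasurableSpace Y]

/-- If gluing two independent copies reproduces the law, and `A` looks only at the first copy while
`B` looks only at the second, then the preimage of `A ∩ B` is a rectangle. -/
theorem measure_inter_of_splice {P : Measure X} [IsProbabilityMeasure P] {S : X × X → X}
    (hS : MeasurePreserving S (P.prod P) P) {A B : Set X} (hA : MeasurableSet A)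
    (hB : MeasurableSet B) (hAS : ∀ x y, S (x, y) ∈ A ↔ x ∈ A) (hBS : ∀ x y, S (x, y) ∈ B ↔ y ∈ B) :
    P (A ∩ B) = P A * P B := by
  rw [← hS.measure_preimage (hA.inter hB).nullMeasurableSet, ← Measure.prod_prod]
  congr 1
  ext ⟨x, y⟩
  simp [hAS, hBS]

theorem measurePreserving_splice_prod {P : Measure X} [IsProbabilityMeasure P] {Q : Measure Y}
    [IsProbabilityMeasure Q] {S : X × X → X} {T : Y × Y → Y}
    (hS : MeasurePreserving S (P.prod P) P) (hT : MeasurePreserving T (Q.prod Q) Q) :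
    MeasurePreserving (fun z : (X × Y) × (X × Y) => (S (z.1.1, z.2.1), T (z.1.2, z.2.2)))
      ((P.prod Q).prod (P.prod Q)) (P.prod Q) := by
  have hSm := hS.measurable
  have hTm := hT.measurable
  have hm : Measurable fun z : (X × Y) × (X × Y) =>
      (S (z.1.1, z.2.1), T (z.1.2, z.2.2)) := by fun_prop
  refine ⟨hm, (Measure.prod_eq fun s t hs ht => ?_).symm⟩
  rw [Measure.map_apply hm (hs.prod ht), Measure.prod_apply (hm (hs.prod ht))]
  have hsec : ∀ x : X × Y, P.prod Q (Prod.mk x ⁻¹' ((fun z : (X × Y) × (X × Y) =>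
      (S (z.1.1, z.2.1), T (z.1.2, z.2.2))) ⁻¹' s ×ˢ t)) =
      P (Prod.mk x.1 ⁻¹' (S ⁻¹' s)) * Q (Prod.mk x.2 ⁻¹' (T ⁻¹' t)) := fun x => by
    rw [← Measure.prod_prod]
    rfl
  simp_rw [hsec]
  rw [lintegral_prod_mul (f := fun x => P (Prod.mk x ⁻¹' (S ⁻¹' s)))
    (g := fun x => Q (Prod.mk x ⁻¹' (T ⁻¹' t)))
    (measurable_measure_prodMk_left (hSm hs)).aemeasurable
    (measurable_measure_prodMk_left (hTm ht)).aemeasurable,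
    ← Measure.prod_apply (hSm hs), ← Measure.prod_apply (hTm ht),
    hS.measure_preimage hs.nullMeasurableSet, hT.measure_preimage ht.nullMeasurableSet]

end Splice

section InfinitePi

variable {ι : Type*} {E : ι → Type*}

open Classical in
/-- The point with the coordinates of `z.1` on `J` and those of `z.2` off `J`. -/
noncomputable def splice (J : Set ι) (z : (∀ i, E i) × (∀ i, E i)) : ∀ i, E i :=
  fun i => if i ∈ J then z.1 i else z.2 i

theorem splice_mem {J : Set ι} {x y : ∀ i, E i} {i : ι} (h : i ∈ J) : splice J (x, y) i = x i :=
  if_pos h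

theorem splice_notMem {J : Set ι} {x y : ∀ i, E i} {i : ι} (h : i ∉ J) :
    splice J (x, y) i = y i :=
  if_neg h

variable [∀ i, MeasurableSpace (E i)]

theorem measurable_splice (J : Set ι) : Measurable (splice (E := E) J) := by
  refine measurable_pi_iff.2 fun i => ?_
  by_cases h : i ∈ J
  · simp only [splice, if_pos h]
    fun_prop
  · simp only [splice, if_neg h]
    fun_prop

variable (μ : ∀ i, Measure (E i)) [∀ i, IsProbabilityMeasure (μ i)]

theorem measurePreserving_splice (J : Set ι) :
    MeasurePreserving (splice J) ((Measure.infinitePi μ).prod (Measure.infinitePi μ))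
      (Measure.infinitePi μ) := by
  classical
  refine ⟨measurable_splice J, Measure.eq_infinitePi μ fun s t ht => ?_⟩
  rw [Measure.map_apply (measurable_splice J) (.pi s.countable_toSet fun i _ => ht i)]
  have : splice J ⁻¹' Set.pi (s : Set ι) t =
      Set.pi (s.filter (· ∈ J) : Finset ι) t ×ˢ Set.pi (s.filter (· ∉ J) : Finset ι) t := by
    ext ⟨x, y⟩
    simp only [Set.mem_preimage, Set.mem_pi, Set.mem_prod, Finset.coe_filter, Set.mem_ofPred_eq,
      Finset.mem_coe, and_imp]
    constructor
    · intro h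
      exact ⟨fun i hi hJ => splice_mem (x := x) (y := y) hJ ▸ h i hi,
        fun i hi hJ => splice_notMem (x := x) (y := y) hJ ▸ h i hi⟩
    · rintro ⟨h1, h2⟩ i hi
      by_cases hJ : i ∈ J
      · rw [splice_mem hJ]
        exact h1 i hi hJ
      · rw [splice_notMem hJ]
        exact h2 i hi hJ
  rw [this, Measure.prod_prod, Measure.infinitePi_pi μ fun i _ => ht i,
    Measure.infinitePi_pi μ fun i _ => ht i, Finset.prod_filter_mul_prod_filter_not]

variable {μ}

omit [∀ i, MeasurableSpace (E i)] in
theorem dependsOn_splice_iff {J : Set ι} {A : Set (∀ i, E i)} (hA : DependsOn (· ∈ A) J)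
    (x y : ∀ i, E i) : splice J (x, y) ∈ A ↔ x ∈ A :=
  iff_of_eq (hA fun _ hi => splice_mem hi)

omit [∀ i, MeasurableSpace (E i)] in
theorem dependsOn_compl_splice_iff {J : Set ι} {A : Set (∀ i, E i)} (hA : DependsOn (· ∈ A) Jᶜ)
    (x y : ∀ i, E i) : splice J (x, y) ∈ A ↔ y ∈ A :=
  iff_of_eq (hA fun _ hi => splice_notMem hi)

theorem infinitePi_inter_of_dependsOn {J : Set ι} {A B : Set (∀ i, E i)} (hA : MeasurableSet A)
    (hB : MeasurableSet B) (hAJ : DependsOn (· ∈ A) J) (hBJ : DependsOn (· ∈ B) Jᶜ) :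
    Measure.infinitePi μ (A ∩ B) = Measure.infinitePi μ A * Measure.infinitePi μ B :=
  measure_inter_of_splice (measurePreserving_splice μ J) hA hB (dependsOn_splice_iff hAJ)
    (dependsOn_compl_splice_iff hBJ)

theorem indepFun_of_dependsOn {F G : Type*} [MeasurableSpace F] [MeasurableSpace G]
    {f : (∀ i, E i) → F} {g : (∀ i, E i) → G} (hf : Measurable f) (hg : Measurable g)
    {J : Set ι} (hfJ : DependsOn f J) (hgJ : DependsOn g Jᶜ) :
    IndepFun f g (Measure.infinitePi μ) := by
  rw [indepFun_iff_measure_inter_preimage_eq_mul]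
  intro s t hs ht
  refine infinitePi_inter_of_dependsOn (J := J) (hf hs) (hg ht) ?_ ?_
  · intro x y h
    simp [hfJ h]
  · intro x y h
    simp [hgJ h]

theorem measurePreserving_reindex {κ : Type*} {F : Type*} [MeasurableSpace F] (Q : Measure F)
    [IsProbabilityMeasure Q] {e : κ → ι} (he : Function.Injective e) :
    MeasurePreserving (fun (x : ι → F) k => x (e k)) (Measure.infinitePi fun _ => Q)
      (Measure.infinitePi fun _ => Q) :=
  ⟨by fun_prop, Measure.map_infinitePi_infinitePi_of_inj (P := fun _ => Q) he⟩

variable {κ : Type*} {F : κ → Type*} [∀ i, MeasurableSpace (F i)] {ν : ∀ i, Measure (F i)}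
  [∀ i, IsProbabilityMeasure (ν i)]

variable (μ ν) in
theorem measurePreserving_splice₂ (J : Set ι) (K : Set κ) :
    MeasurePreserving (fun z : ((∀ i, E i) × (∀ k, F k)) × ((∀ i, E i) × (∀ k, F k)) =>
      (splice J (z.1.1, z.2.1), splice K (z.1.2, z.2.2)))
      (((Measure.infinitePi μ).prod (Measure.infinitePi ν)).prod
        ((Measure.infinitePi μ).prod (Measure.infinitePi ν)))
      ((Measure.infinitePi μ).prod (Measure.infinitePi ν)) :=
  measurePreserving_splice_prod (measurePreserving_splice μ J) (measurePreserving_splice ν K)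

/-- `A` only depends on the coordinates in `J` of the first component and in `K` of the second. -/
def DependsOn₂ (A : Set ((∀ i, E i) × (∀ k, F k))) (J : Set ι) (K : Set κ) : Prop :=
  ∀ x x' : (∀ i, E i) × (∀ k, F k), (∀ i ∈ J, x.1 i = x'.1 i) → (∀ k ∈ K, x.2 k = x'.2 k) →
    x ∈ A → x' ∈ A

theorem prod_infinitePi_inter {J : Set ι} {K : Set κ} {A B : Set ((∀ i, E i) × (∀ k, F k))}
    (hA : MeasurableSet A) (hB : MeasurableSet B) (hAJ : DependsOn₂ A J K)
    (hBJ : DependsOn₂ B Jᶜ Kᶜ) :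
    ((Measure.infinitePi μ).prod (Measure.infinitePi ν)) (A ∩ B) =
      ((Measure.infinitePi μ).prod (Measure.infinitePi ν)) A *
        ((Measure.infinitePi μ).prod (Measure.infinitePi ν)) B := by
  refine measure_inter_of_splice (measurePreserving_splice₂ μ ν J K) hA hB
    (fun x y => ⟨?_, ?_⟩) fun x y => ⟨?_, ?_⟩
  · exact hAJ _ _ (fun i hi => splice_mem hi) fun k hk => splice_mem hk
  · exact hAJ _ _ (fun i hi => (splice_mem hi).symm) fun k hk => (splice_mem hk).symm
  · exact hBJ _ _ (fun i hi => splice_notMem hi) fun k hk => splice_notMem hk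
  · exact hBJ _ _ (fun i hi => (splice_notMem hi).symm) fun k hk => (splice_notMem hk).symm

end InfinitePi

/-! ### Random walks with steps at most one: records, positivity, number of upward steps -/

section Walk

/-- The walk with steps `1 - ω i`. -/
def walk (ω : ℕ → ℕ) (n : ℕ) : ℤ := n - ∑ i ∈ Finset.range n, (ω i : ℤ)

theorem walk_zero (ω : ℕ → ℕ) : walk ω 0 = 0 := by simp [walk]

theorem walk_succ (ω : ℕ → ℕ) (n : ℕ) : walk ω (n + 1) = walk ω n + (1 - ω n) := by
  simp only [walk, Finset.sum_range_succ]
  push_cast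
  ring

theorem walk_congr {ω ω' : ℕ → ℕ} {n : ℕ} (h : ∀ i < n, ω i = ω' i) : walk ω n = walk ω' n := by
  simp only [walk]
  congr 1
  exact Finset.sum_congr rfl fun i hi => by rw [h i (Finset.mem_range.1 hi)]

theorem dependsOn_walk (n : ℕ) : DependsOn (walk · n) (Set.Iio n) :=
  fun _ _ h => walk_congr fun i hi => h i hi

theorem measurable_walk (n : ℕ) : Measurable (walk · n) := by
  unfold walk
  refine measurable_const.sub (Finset.measurable_fun_sum _ fun i _ => ?_)
  exact (measurable_from_top (f := fun n : ℕ => (n : ℤ))).comp (measurable_pi_apply i)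

/-- The walk stays positive at times `1, …, n`. -/
def stayPos (n : ℕ) : Set (ℕ → ℕ) := {ω | ∀ k, 1 ≤ k → k ≤ n → 1 ≤ walk ω k}

/-- The walk stays nonnegative up to time `n`. -/
def stayNonneg (n : ℕ) : Set (ℕ → ℕ) := {ω | ∀ k ≤ n, 0 ≤ walk ω k}

/-- The time `k` is a strict record time of the walk. -/
def recordAt (k : ℕ) : Set (ℕ → ℕ) := {ω | ∀ j < k, walk ω j < walk ω k}

/-- The running maximum of the walk. -/
def runMax (ω : ℕ → ℕ) : ℕ → ℤ
  | 0 => 0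
  | n + 1 => max (runMax ω n) (walk ω (n + 1))

theorem measurableSet_stayPos (n : ℕ) : MeasurableSet (stayPos n) := by
  have : stayPos n = ⋂ k, ⋂ (_ : 1 ≤ k), ⋂ (_ : k ≤ n), (walk · k) ⁻¹' Set.Ici 1 := by
    ext; simp [stayPos]
  rw [this]
  exact .iInter fun k => .iInter fun _ => .iInter fun _ => measurable_walk k measurableSet_Ici

theorem measurableSet_stayNonneg (n : ℕ) : MeasurableSet (stayNonneg n) := by
  have : stayNonneg n = ⋂ k, ⋂ (_ : k ≤ n), (walk · k) ⁻¹' Set.Ici 0 := by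
    ext; simp [stayNonneg]
  rw [this]
  exact .iInter fun k => .iInter fun _ => measurable_walk k measurableSet_Ici

theorem measurableSet_recordAt (n : ℕ) : MeasurableSet (recordAt n) := by
  have : recordAt n = ⋂ k, ⋂ (_ : k < n), {ω | walk ω k < walk ω n} := by
    ext; simp [recordAt]
  rw [this]
  exact .iInter fun k => .iInter fun _ =>
    measurableSet_lt (measurable_walk k) (measurable_walk n)

theorem measurable_runMax (n : ℕ) : Measurable (runMax · n) := by
  induction n with
  | zero => exact measurable_const
  | succ n ih => exact ih.max (measurable_walk _)

theorem dependsOn_runMax (n : ℕ) : DependsOn (runMax · n) (Set.Iio n) := by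
  intro ω ω' h
  induction n with
  | zero => rfl
  | succ n ih =>
    simp only [runMax]
    have h1 : runMax ω n = runMax ω' n := ih fun i hi => h i (Nat.lt_succ_of_lt hi)
    have h2 : walk ω (n + 1) = walk ω' (n + 1) := dependsOn_walk (n + 1) h
    rw [h1, h2]

theorem dependsOn_stayPos (n : ℕ) : DependsOn (· ∈ stayPos n) (Set.Iio n) := by
  intro ω ω' h
  simp only [stayPos, Set.mem_ofPred_eq]
  refine propext (forall_congr' fun k => forall_congr' fun _ => forall_congr' fun hk => ?_)
  rw [walk_congr fun i hi => h i (hi.trans_le hk)]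

theorem stayPos_antitone : Antitone stayPos :=
  fun _ _ h _ hω k hk hkn => hω k hk (hkn.trans h)

theorem runMax_nonneg (ω : ℕ → ℕ) (n : ℕ) : 0 ≤ runMax ω n := by
  induction n with
  | zero => exact le_rfl
  | succ n ih => exact le_max_of_le_left ih

theorem walk_le_runMax (ω : ℕ → ℕ) {j n : ℕ} (h : j ≤ n) : walk ω j ≤ runMax ω n := by
  induction n with
  | zero => simp [Nat.le_zero.1 h, walk_zero, runMax]
  | succ n ih =>
    rcases h.eq_or_lt with rfl | h
    · exact le_max_right _ _
    · exact le_max_of_le_left (ih (Nat.le_of_lt_succ h))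

theorem exists_walk_eq_runMax (ω : ℕ → ℕ) (n : ℕ) : ∃ j ≤ n, runMax ω n = walk ω j := by
  induction n with
  | zero => exact ⟨0, le_rfl, by simp [walk_zero, runMax]⟩
  | succ n ih =>
    obtain ⟨j, hj, h⟩ := ih
    rcases max_choice (runMax ω n) (walk ω (n + 1)) with h' | h'
    · exact ⟨j, by omega, by rw [runMax, h', h]⟩
    · exact ⟨n + 1, le_rfl, by rw [runMax, h']⟩

theorem mem_recordAt_succ_iff (ω : ℕ → ℕ) (n : ℕ) :
    ω ∈ recordAt (n + 1) ↔ runMax ω n < walk ω (n + 1) := by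
  constructor
  · intro h
    obtain ⟨j, hj, hm⟩ := exists_walk_eq_runMax ω n
    exact hm ▸ h j (by omega)
  · intro h j hj
    exact (walk_le_runMax ω (by omega)).trans_lt h

/-- As the steps are at most `1`, a record is set only from the current maximum and exceeds it by
exactly `1`. Hence the maximum counts the records. -/
theorem runMax_succ_of_mem {ω : ℕ → ℕ} {n : ℕ} (h : ω ∈ recordAt (n + 1)) :
    ω n = 0 ∧ walk ω n = runMax ω n ∧ walk ω (n + 1) = runMax ω n + 1 ∧
      runMax ω (n + 1) = runMax ω n + 1 := by
  rw [mem_recordAt_succ_iff] at h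
  have h1 := walk_le_runMax ω (le_refl n)
  have h2 := walk_succ ω n
  refine ⟨by omega, by omega, by omega, ?_⟩
  rw [runMax]
  omega

theorem runMax_succ_of_notMem {ω : ℕ → ℕ} {n : ℕ} (h : ω ∉ recordAt (n + 1)) :
    runMax ω (n + 1) = runMax ω n := by
  rw [mem_recordAt_succ_iff] at h
  rw [runMax]
  omega

theorem runMax_le (ω : ℕ → ℕ) (n : ℕ) : runMax ω n ≤ n := by
  induction n with
  | zero => exact le_rfl
  | succ n ih =>
    by_cases h : ω ∈ recordAt (n + 1)
    · rw [(runMax_succ_of_mem h).2.2.2]; push_cast; omega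
    · rw [runMax_succ_of_notMem h]; push_cast; omega

/-- Reversal of the first `k` coordinates. -/
def revIndex (k i : ℕ) : ℕ := if i < k then k - 1 - i else i

theorem revIndex_injective (k : ℕ) : Function.Injective (revIndex k) := by
  intro i j h
  unfold revIndex at h
  split_ifs at h <;> omega

theorem walk_rev (ω : ℕ → ℕ) (k l : ℕ) (h : l ≤ k) :
    walk (fun i => ω (revIndex k i)) l = walk ω k - walk ω (k - l) := by
  induction l with
  | zero => simp [walk_zero]
  | succ l ih =>
    rw [walk_succ, ih (by omega)]
    have h1 : revIndex k l = k - (l + 1) := by rw [revIndex, if_pos (by omega)]; omega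
    have h2 : k - l = k - (l + 1) + 1 := by omega
    rw [h1, h2, walk_succ]
    ring

/-- Duality: reversing the first `k` steps turns the walk into the increments `walk ω k - walk ω (k
- l)`, which are all positive exactly at a record time. Reversal preserves the i.i.d. law. -/
theorem rev_mem_stayPos_iff (ω : ℕ → ℕ) (k : ℕ) :
    (fun i => ω (revIndex k i)) ∈ stayPos k ↔ ω ∈ recordAt k := by
  constructor
  · intro h j hj
    have := h (k - j) (by omega) (by omega)
    rw [walk_rev ω k _ (by omega), show k - (k - j) = j by omega] at this
    omega
  · intro h l hl hlk
    have := h (k - l) (by omega)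
    rw [walk_rev ω k l hlk]
    omega

variable (ρ : Measure ℕ) [IsProbabilityMeasure ρ]

/-- The law of an i.i.d. sequence of law `ρ`. -/
noncomputable abbrev stepLaw : Measure (ℕ → ℕ) := Measure.infinitePi fun _ : ℕ => ρ

theorem measure_recordAt (k : ℕ) : (stepLaw ρ).real (recordAt k) = (stepLaw ρ).real (stayPos k) := by
  rw [measureReal_def, measureReal_def,
    ← (measurePreserving_reindex ρ (revIndex_injective k)).measure_preimage
      (measurableSet_stayPos k).nullMeasurableSet]
  congr 2
  ext ω
  exact (rev_mem_stayPos_iff ω k).symm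

variable {ρ}

theorem indepFun_step {n : ℕ} {f : (ℕ → ℕ) → ℝ} (hf : Measurable f)
    (hd : DependsOn f (Set.Iio n)) (g : ℕ → ℝ) :
    IndepFun f (fun ω => g (ω n)) (stepLaw ρ) :=
  indepFun_of_dependsOn (J := Set.Iio n) hf (measurable_from_top.comp (measurable_pi_apply n)) hd
    fun _ _ h => by simp [h n (by simp)]

theorem integral_eval (n : ℕ) (g : ℕ → ℝ) : ∫ ω, g (ω n) ∂stepLaw ρ = ∫ j, g j ∂ρ := by
  conv_rhs => rw [← Measure.infinitePi_map_eval (fun _ : ℕ => ρ) n]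
  rw [integral_map (measurable_pi_apply n).aemeasurable
    measurable_from_top.aestronglyMeasurable]

theorem integrable_eval {n : ℕ} {g : ℕ → ℝ} (hg : Integrable g ρ) :
    Integrable (fun ω => g (ω n)) (stepLaw ρ) :=
  ((measurePreserving_eval_infinitePi (fun _ : ℕ => ρ) n).integrable_comp
    measurable_from_top.aestronglyMeasurable).2 hg

/-- The step number `n` is independent of the coordinates before `n`; this replaces conditional
expectations in the martingale arguments below. -/
theorem integral_mul_step {n : ℕ} {f : (ℕ → ℕ) → ℝ} (hf : Measurable f)
    (hd : DependsOn f (Set.Iio n)) (g : ℕ → ℝ) :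
    ∫ ω, f ω * g (ω n) ∂stepLaw ρ = (∫ ω, f ω ∂stepLaw ρ) * ∫ j, g j ∂ρ := by
  rw [(indepFun_step hf hd g).integral_fun_mul_eq_mul_integral hf.aestronglyMeasurable
    (measurable_from_top.comp (measurable_pi_apply n)).aestronglyMeasurable, integral_eval]

theorem integrable_mul_step {n : ℕ} {f : (ℕ → ℕ) → ℝ} (hf : Measurable f)
    (hd : DependsOn f (Set.Iio n)) (hi : Integrable f (stepLaw ρ)) {g : ℕ → ℝ}
    (hg : Integrable g ρ) : Integrable (fun ω => f ω * g (ω n)) (stepLaw ρ) :=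
  (indepFun_step hf hd g).integrable_mul hi (integrable_eval hg)

/-- The mean of the steps. -/
noncomputable def drift (ρ : Measure ℕ) : ℝ := ∫ j : ℕ, (1 - (j : ℝ)) ∂ρ

/-- The second moment of the steps. -/
noncomputable def stepSq (ρ : Measure ℕ) : ℝ := ∫ j : ℕ, (1 - (j : ℝ)) ^ 2 ∂ρ

omit [IsProbabilityMeasure ρ] in
theorem stepSq_nonneg : 0 ≤ stepSq ρ := integral_nonneg fun _ => sq_nonneg _

theorem measurable_walkReal (n : ℕ) : Measurable fun ω => (walk ω n : ℝ) :=
  measurable_from_top.comp (measurable_walk n)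

theorem dependsOn_walkReal (n : ℕ) : DependsOn (fun ω => (walk ω n : ℝ)) (Set.Iio n) :=
  fun _ _ h => congrArg Int.cast (dependsOn_walk n h)

theorem measurable_runMaxReal (n : ℕ) : Measurable fun ω => (runMax ω n : ℝ) :=
  measurable_from_top.comp (measurable_runMax n)

theorem dependsOn_runMaxReal (n : ℕ) : DependsOn (fun ω => (runMax ω n : ℝ)) (Set.Iio n) :=
  fun _ _ h => congrArg Int.cast (dependsOn_runMax n h)

theorem walkReal_succ (ω : ℕ → ℕ) (n : ℕ) :
    (walk ω (n + 1) : ℝ) = walk ω n + (1 - (ω n : ℝ)) := by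
  rw [walk_succ]
  push_cast
  ring

variable (hρ : Integrable (fun j : ℕ => (1 - (j : ℝ)) ^ 2) ρ)
include hρ

theorem integrable_step : Integrable (fun j : ℕ => 1 - (j : ℝ)) ρ := by
  refine (hρ.add (integrable_const 1)).mono' measurable_from_top.aestronglyMeasurable
    (.of_forall fun j => ?_)
  rw [Real.norm_eq_abs, Pi.add_apply]
  nlinarith [sq_abs (1 - (j : ℝ)), sq_nonneg (|1 - (j : ℝ)| - 1)]

theorem integrable_walk (n : ℕ) : Integrable (fun ω => (walk ω n : ℝ)) (stepLaw ρ) := by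
  induction n with
  | zero => simp [walk_zero]
  | succ n ih =>
    simp only [walkReal_succ]
    exact ih.add (integrable_eval (integrable_step hρ))

theorem integrable_walk_sq (n : ℕ) : Integrable (fun ω => (walk ω n : ℝ) ^ 2) (stepLaw ρ) := by
  induction n with
  | zero => simp [walk_zero]
  | succ n ih =>
    have h := (ih.add ((integrable_mul_step (measurable_walkReal n) (dependsOn_walkReal n)
      (integrable_walk hρ n) (integrable_step hρ)).const_mul 2)).add (integrable_eval hρ (n := n))
    refine h.congr (.of_forall fun ω => ?_)
    simp only [Pi.add_apply, walkReal_succ]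
    ring

theorem integral_walk (n : ℕ) : ∫ ω, (walk ω n : ℝ) ∂stepLaw ρ = n * drift ρ := by
  induction n with
  | zero => simp [walk_zero]
  | succ n ih =>
    simp only [walkReal_succ]
    rw [integral_add (integrable_walk hρ n) (integrable_eval (integrable_step hρ)), ih,
      integral_eval n fun j => 1 - (j : ℝ), drift]
    push_cast
    ring

theorem integral_walk_sq_le (n : ℕ) :
    ∫ ω, (walk ω n : ℝ) ^ 2 ∂stepLaw ρ ≤ n * stepSq ρ + (n * drift ρ) ^ 2 := by
  induction n with
  | zero => simp [walk_zero]
  | succ n ih =>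
    have h2 := (integrable_mul_step (measurable_walkReal n) (dependsOn_walkReal n)
      (integrable_walk hρ n) (integrable_step hρ)).const_mul 2
    have : ∫ ω, (walk ω (n + 1) : ℝ) ^ 2 ∂stepLaw ρ =
        ∫ ω, (walk ω n : ℝ) ^ 2 + 2 * ((walk ω n : ℝ) * (1 - (ω n : ℝ))) + (1 - (ω n : ℝ)) ^ 2
          ∂stepLaw ρ := integral_congr_ae (.of_forall fun ω => by
        simp only [walkReal_succ]
        ring)
    rw [this, integral_add (f := fun ω => (walk ω n : ℝ) ^ 2 + 2 * ((walk ω n : ℝ) *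
      (1 - (ω n : ℝ)))) ((integrable_walk_sq hρ n).add h2) (integrable_eval hρ),
      integral_add (integrable_walk_sq hρ n) h2, integral_const_mul,
      integral_mul_step (measurable_walkReal n) (dependsOn_walkReal n) fun j => 1 - (j : ℝ),
      integral_eval n fun j => (1 - (j : ℝ)) ^ 2, integral_walk hρ n]
    change _ + 2 * (n * drift ρ * drift ρ) + stepSq ρ ≤ _
    push_cast
    nlinarith [sq_nonneg (drift ρ)]

omit hρ in
theorem integrable_runMax (n : ℕ) : Integrable (fun ω => (runMax ω n : ℝ)) (stepLaw ρ) := by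
  refine Integrable.of_bound (measurable_runMaxReal n).aestronglyMeasurable n
    (.of_forall fun ω => ?_)
  rw [Real.norm_eq_abs, abs_of_nonneg (by exact_mod_cast runMax_nonneg ω n)]
  exact_mod_cast runMax_le ω n

omit hρ in
theorem integrable_runMax_sq (n : ℕ) :
    Integrable (fun ω => (runMax ω n : ℝ) ^ 2) (stepLaw ρ) := by
  refine Integrable.of_bound ((measurable_runMaxReal n).pow_const 2).aestronglyMeasurable
    ((n : ℝ) ^ 2) (.of_forall fun ω => ?_)
  have h0 : (0 : ℝ) ≤ runMax ω n := by exact_mod_cast runMax_nonneg ω n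
  have h1 : (runMax ω n : ℝ) ≤ n := by exact_mod_cast runMax_le ω n
  rw [Real.norm_eq_abs, abs_of_nonneg (by positivity)]
  gcongr

theorem integrable_runMax_mul_walk (n : ℕ) :
    Integrable (fun ω => (runMax ω n : ℝ) * walk ω n) (stepLaw ρ) := by
  refine (integrable_walk hρ n).bdd_mul (c := (n : ℝ))
    (measurable_runMaxReal n).aestronglyMeasurable (.of_forall fun ω => ?_)
  rw [Real.norm_eq_abs, abs_of_nonneg (by exact_mod_cast runMax_nonneg ω n)]
  exact_mod_cast runMax_le ω n

omit hρ in
-- The maximum is the number of records, and a record at time `k` has the probability of staying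
-- positive up to time `k`.
theorem integral_runMax (n : ℕ) : ∫ ω, (runMax ω n : ℝ) ∂stepLaw ρ =
    ∑ k ∈ Finset.range n, (stepLaw ρ).real (stayPos (k + 1)) := by
  induction n with
  | zero => simp [runMax]
  | succ n ih =>
    rw [Finset.sum_range_succ, ← ih, ← measure_recordAt,
      ← integral_indicator_one (measurableSet_recordAt _),
      ← integral_add (g := (recordAt (n + 1)).indicator 1) (integrable_runMax n)
        ((integrable_const (1 : ℝ)).indicator (measurableSet_recordAt _))]
    refine integral_congr_ae (.of_forall fun ω => ?_)
    by_cases h : ω ∈ recordAt (n + 1)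
    · simp [h, (runMax_succ_of_mem h).2.2.2]
    · simp [h, runMax_succ_of_notMem h]

/-- With `M` the maximum and `S` the walk, `M ^ 2 - 2 * M * S` is a supermartingale. Off the record
times it changes by `-2 * M` times the step, whose mean is nonpositive; at a record `S` sits at `M`
and both grow by `1`, which only lowers the expression further. -/
theorem integral_runMax_sq_le_mul (hμ : 0 ≤ drift ρ) (n : ℕ) :
    ∫ ω, ((runMax ω n : ℝ) ^ 2 - 2 * ((runMax ω n : ℝ) * walk ω n)) ∂stepLaw ρ ≤ 0 := by
  have hint : ∀ n, Integrable (fun ω => (runMax ω n : ℝ) ^ 2 -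
      2 * ((runMax ω n : ℝ) * walk ω n)) (stepLaw ρ) := fun n =>
    (integrable_runMax_sq n).sub ((integrable_runMax_mul_walk hρ n).const_mul 2)
  induction n with
  | zero => simp [runMax]
  | succ n ih =>
    have h2 := (integrable_mul_step (measurable_runMaxReal n) (dependsOn_runMaxReal n)
      (integrable_runMax n) (integrable_step hρ)).const_mul 2
    have h3 : 0 ≤ ∫ ω, 2 * ((runMax ω n : ℝ) * (1 - (ω n : ℝ))) ∂stepLaw ρ := by
      rw [integral_const_mul,
        integral_mul_step (measurable_runMaxReal n) (dependsOn_runMaxReal n) fun j => 1 - (j : ℝ)]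
      have : 0 ≤ ∫ ω, (runMax ω n : ℝ) ∂stepLaw ρ :=
        integral_nonneg fun ω => Int.cast_nonneg (runMax_nonneg ω n)
      have hμ' : 0 ≤ ∫ j : ℕ, (1 - (j : ℝ)) ∂ρ := hμ
      positivity
    have h4 : ∫ ω, ((runMax ω (n + 1) : ℝ) ^ 2 - 2 * ((runMax ω (n + 1) : ℝ) * walk ω (n + 1)))
        ∂stepLaw ρ ≤ ∫ ω, ((runMax ω n : ℝ) ^ 2 - 2 * ((runMax ω n : ℝ) * walk ω n)) -
        2 * ((runMax ω n : ℝ) * (1 - (ω n : ℝ))) ∂stepLaw ρ :=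
        integral_mono (hint (n + 1)) ((hint n).sub h2) fun ω => by
      beta_reduce
      by_cases h : ω ∈ recordAt (n + 1)
      · obtain ⟨e1, e2, e3, e4⟩ := runMax_succ_of_mem h
        rw [e3, e4, e2, e1]
        push_cast
        nlinarith
      · rw [runMax_succ_of_notMem h, walkReal_succ]
        apply le_of_eq
        ring
    have h5 : ∫ ω, ((runMax ω n : ℝ) ^ 2 - 2 * ((runMax ω n : ℝ) * walk ω n)) -
        2 * ((runMax ω n : ℝ) * (1 - (ω n : ℝ))) ∂stepLaw ρ = _ := integral_sub (hint n) h2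
    linarith

theorem integral_runMax_sq_le (hμ : 0 ≤ drift ρ) (n : ℕ) :
    ∫ ω, (runMax ω n : ℝ) ^ 2 ∂stepLaw ρ ≤ 4 * (n * stepSq ρ + (n * drift ρ) ^ 2) := by
  have h1 := integral_runMax_sq_le_mul hρ hμ n
  have hint : Integrable (fun ω => (runMax ω n : ℝ) ^ 2 -
      2 * ((runMax ω n : ℝ) * walk ω n)) (stepLaw ρ) :=
    (integrable_runMax_sq n).sub ((integrable_runMax_mul_walk hρ n).const_mul 2)
  -- The pointwise inequality is `(M - 2 * S) ^ 2 ≥ 0`. As in Doob's maximal inequality, it replaces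
  -- the mixed term by second moments.
  have h2 : ∫ ω, 1 / 2 * (runMax ω n : ℝ) ^ 2 - 2 * (walk ω n : ℝ) ^ 2 ∂stepLaw ρ ≤
      ∫ ω, ((runMax ω n : ℝ) ^ 2 - 2 * ((runMax ω n : ℝ) * walk ω n)) ∂stepLaw ρ :=
    integral_mono (((integrable_runMax_sq (ρ := ρ) n).const_mul (1 / 2)).sub
    ((integrable_walk_sq hρ n).const_mul 2)) hint fun ω => by
      beta_reduce
      nlinarith [sq_nonneg ((runMax ω n : ℝ) - 2 * walk ω n)]
  have h3 : ∫ ω, 1 / 2 * (runMax ω n : ℝ) ^ 2 - 2 * (walk ω n : ℝ) ^ 2 ∂stepLaw ρ = _ :=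
    integral_sub ((integrable_runMax_sq (ρ := ρ) n).const_mul (1 / 2))
      ((integrable_walk_sq hρ n).const_mul 2)
  rw [integral_const_mul, integral_const_mul] at h3
  have h4 := integral_walk_sq_le hρ n
  linarith

theorem sq_integral_runMax_le (hμ : 0 ≤ drift ρ) (n : ℕ) :
    (∫ ω, (runMax ω n : ℝ) ∂stepLaw ρ) ^ 2 ≤ 4 * (n * stepSq ρ + (n * drift ρ) ^ 2) := by
  refine le_trans ?_ (integral_runMax_sq_le hρ hμ n)
  set c := ∫ ω, (runMax ω n : ℝ) ∂stepLaw ρ with hc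
  -- Jensen's inequality, from `(M - c) ^ 2 ≥ 0` with `c` the mean of `M`.
  have h : ∫ ω, 2 * c * (runMax ω n : ℝ) - c ^ 2 ∂stepLaw ρ ≤
      ∫ ω, (runMax ω n : ℝ) ^ 2 ∂stepLaw ρ :=
    integral_mono (((integrable_runMax (ρ := ρ) n).const_mul (2 * c)).sub
    (integrable_const (c ^ 2))) (integrable_runMax_sq (ρ := ρ) n) fun ω => by
      beta_reduce
      nlinarith [sq_nonneg ((runMax ω n : ℝ) - c)]
  have h3 : ∫ ω, 2 * c * (runMax ω n : ℝ) - c ^ 2 ∂stepLaw ρ = _ :=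
    integral_sub ((integrable_runMax (ρ := ρ) n).const_mul (2 * c)) (integrable_const (c ^ 2))
  rw [integral_const_mul, ← hc] at h3
  simp only [integral_const, probReal_univ, one_smul] at h3
  nlinarith

omit hρ in
theorem mul_stayPos_le (n : ℕ) :
    n * (stepLaw ρ).real (stayPos n) ≤ ∫ ω, (runMax ω n : ℝ) ∂stepLaw ρ := by
  rw [integral_runMax]
  calc n * (stepLaw ρ).real (stayPos n)
      = ∑ k ∈ Finset.range n, (stepLaw ρ).real (stayPos n) := by simp
    _ ≤ _ := Finset.sum_le_sum fun k hk =>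
        measureReal_mono (stayPos_antitone (Nat.succ_le_of_lt (Finset.mem_range.1 hk)))

/-- Upper bound for the probability that a walk with nonnegative drift stays positive. -/
theorem sq_stayPos_le (hμ : 0 ≤ drift ρ) {n : ℕ} (hn : 1 ≤ n) :
    (stepLaw ρ).real (stayPos n) ^ 2 ≤ 4 * (stepSq ρ / n + drift ρ ^ 2) := by
  have hn' : (0 : ℝ) < n := by exact_mod_cast hn
  have h1 := mul_stayPos_le (ρ := ρ) n
  have h2 := sq_integral_runMax_le hρ hμ n
  have h3 : (n * (stepLaw ρ).real (stayPos n)) ^ 2 ≤ (∫ ω, (runMax ω n : ℝ) ∂stepLaw ρ) ^ 2 := by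
    have : 0 ≤ (stepLaw ρ).real (stayPos n) := measureReal_nonneg
    gcongr
  have h4 : n ^ 2 * (stepLaw ρ).real (stayPos n) ^ 2 ≤
      n ^ 2 * (4 * (stepSq ρ / n + drift ρ ^ 2)) := by
    calc _ = (n * (stepLaw ρ).real (stayPos n)) ^ 2 := by ring
      _ ≤ _ := h3.trans h2
      _ = _ := by field_simp
  exact le_of_mul_le_mul_left h4 (by positivity)

/-- Lower bound for the probability that a walk stays positive. -/
theorem drift_le_stayPos (n : ℕ) : drift ρ ≤ (stepLaw ρ).real (stayPos n) := by
  set a := fun k => (stepLaw ρ).real (stayPos k) with ha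
  have ha1 : ∀ k, a k ≤ 1 := fun k => measureReal_le_one
  -- The mean of the walk at time `N` is at most that of its maximum, which is a sum of
  -- probabilities of staying positive. The first `n` of these are bounded by `1`, the others by `a
  -- n`; division by `N → ∞` leaves `drift ρ ≤ a n`.
  have key : ∀ N : ℕ, n ≤ N → N * drift ρ ≤ n + (N - n) * a n := fun N hN => by
    have h1 : N * drift ρ ≤ ∑ k ∈ Finset.range N, a (k + 1) := by
      rw [← integral_walk hρ, ← integral_runMax]
      exact integral_mono (integrable_walk hρ N) (integrable_runMax N) fun ω =>
        Int.cast_le.2 (walk_le_runMax ω le_rfl)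
    have h2 : ∑ k ∈ Finset.range N, a (k + 1) ≤
        ∑ k ∈ Finset.range n, 1 + ∑ k ∈ Finset.Ico n N, a n := by
      rw [Finset.range_eq_Ico, ← Finset.sum_Ico_consecutive _ (Nat.zero_le n) hN]
      refine add_le_add ?_ ?_
      · rw [← Finset.range_eq_Ico]
        exact_mod_cast Finset.sum_le_sum fun k _ => ha1 (k + 1)
      · exact Finset.sum_le_sum fun k hk =>
          measureReal_mono (stayPos_antitone (by have := (Finset.mem_Ico.1 hk).1; omega))
    simp only [Finset.sum_const, Finset.card_range, Nat.card_Ico, nsmul_eq_mul] at h2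
    rw [Nat.cast_sub hN] at h2
    linarith
  by_contra! hlt
  obtain ⟨N, hN⟩ := exists_nat_gt (n / (drift ρ - a n))
  have hd : 0 < drift ρ - a n := sub_pos.2 hlt
  rw [div_lt_iff₀ hd] at hN
  have h0 : 0 ≤ a n := measureReal_nonneg
  have hk := key (N + n) (by omega)
  push_cast at hk
  nlinarith [mul_nonneg (Nat.cast_nonneg (α := ℝ) n) hd.le,
    mul_nonneg (Nat.cast_nonneg (α := ℝ) n) h0]

omit hρ in
theorem measurable_indicator_stayPos (n : ℕ) {f : (ℕ → ℕ) → ℝ} (hf : Measurable f) :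
    Measurable ((stayPos n).indicator f) :=
  hf.indicator (measurableSet_stayPos n)

omit hρ in
theorem dependsOn_indicator_stayPos (n : ℕ) {f : (ℕ → ℕ) → ℝ} (hf : DependsOn f (Set.Iio n)) :
    DependsOn ((stayPos n).indicator f) (Set.Iio n) := by
  intro ω ω' h
  have h1 : (ω ∈ stayPos n) = (ω' ∈ stayPos n) := dependsOn_stayPos n h
  have h2 : f ω = f ω' := hf h
  by_cases hω : ω ∈ stayPos n
  · rw [Set.indicator_of_mem hω, Set.indicator_of_mem (h1.mp hω), h2]
  · rw [Set.indicator_of_notMem hω, Set.indicator_of_notMem fun h => hω (h1.mpr h)]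

/-- For a centred walk the integral is nondecreasing in time: the walk is nonpositive when it ceases
to stay positive, so discarding these paths can only increase the mean. At time `1` only the step
without downward jump contributes, with value `1`. -/
theorem le_integral_walk_stayPos (h0 : drift ρ = 0) (n : ℕ) :
    ρ.real {0} ≤ ∫ ω, (stayPos (n + 1)).indicator (fun ω => (walk ω (n + 1) : ℝ)) ω
      ∂stepLaw ρ := by
  induction n with
  | zero =>
    have : ρ.real {0} = ∫ ω, ((fun ω : ℕ → ℕ => ω 0) ⁻¹' {0}).indicator 1 ω ∂stepLaw ρ := by
      rw [integral_indicator_one (measurable_pi_apply 0 (measurableSet_singleton 0)),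
        measureReal_def, measureReal_def,
        (measurePreserving_eval_infinitePi (fun _ : ℕ => ρ) 0).measure_preimage
          (measurableSet_singleton 0).nullMeasurableSet]
    rw [this]
    refine integral_mono ((integrable_const (1 : ℝ)).indicator
      (measurable_pi_apply 0 (measurableSet_singleton 0)))
      ((integrable_walk hρ 1).indicator (measurableSet_stayPos 1)) fun ω => ?_
    by_cases h : ω 0 = 0
    · have hw : walk ω 1 = 1 := by rw [walk_succ, walk_zero, h]; norm_num
      have : ω ∈ stayPos 1 := fun k h1 h2 => by rw [le_antisymm h2 h1, hw]
      simp [this, h, hw]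
    · have h1 : ω ∉ (fun ω : ℕ → ℕ => ω 0) ⁻¹' {0} := h
      rw [Set.indicator_of_notMem h1]
      refine Set.indicator_nonneg (fun ω hω => ?_) ω
      exact Int.cast_nonneg (zero_le_one.trans (hω 1 le_rfl le_rfl))
  | succ n ih =>
    have hi := (integrable_walk hρ (n + 1)).indicator (measurableSet_stayPos (n + 1))
    have h2 := integrable_mul_step (n := n + 1)
      (measurable_indicator_stayPos (n + 1) measurable_const)
      (dependsOn_indicator_stayPos (n + 1) fun _ _ _ => rfl)
      ((integrable_const (1 : ℝ)).indicator (measurableSet_stayPos (n + 1))) (integrable_step hρ)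
    have h3 : ∫ ω, (stayPos (n + 1)).indicator (fun ω => (walk ω (n + 1) : ℝ)) ω +
        (stayPos (n + 1)).indicator (fun _ => (1 : ℝ)) ω * (1 - (ω (n + 1) : ℝ)) ∂stepLaw ρ ≤
        ∫ ω, (stayPos (n + 1 + 1)).indicator (fun ω => (walk ω (n + 1 + 1) : ℝ)) ω ∂stepLaw ρ := by
      refine integral_mono (hi.add h2)
        ((integrable_walk hρ (n + 1 + 1)).indicator (measurableSet_stayPos (n + 1 + 1)))
        fun ω => ?_
      by_cases hω : ω ∈ stayPos (n + 1 + 1)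
      · have hω' : ω ∈ stayPos (n + 1) := stayPos_antitone (Nat.le_succ _) hω
        simp only [Set.indicator_of_mem hω, Set.indicator_of_mem hω', walkReal_succ ω (n + 1),
          one_mul, le_refl]
      · rw [Set.indicator_of_notMem hω]
        by_cases hω' : ω ∈ stayPos (n + 1)
        · simp only [Set.indicator_of_mem hω', one_mul]
          rw [← walkReal_succ]
          by_contra! hpos
          refine hω fun k hk hkn => ?_
          rcases hkn.eq_or_lt with rfl | hlt
          · exact_mod_cast hpos
          · exact hω' k hk (by omega)
        · simp [Set.indicator_of_notMem hω']
    rw [integral_add hi h2, integral_mul_step (n := n + 1)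
      (measurable_indicator_stayPos (n + 1) measurable_const)
      (dependsOn_indicator_stayPos (n + 1) fun _ _ _ => rfl) fun j => 1 - (j : ℝ)] at h3
    change _ + _ * drift ρ ≤ _ at h3
    rw [h0, mul_zero, add_zero] at h3
    exact ih.trans h3

/-- Each step adds at most its second moment, and only on the paths that have stayed positive so
far; the cross term vanishes because the walk is centred. -/
theorem integral_walk_sq_stayPos_le (h0 : drift ρ = 0) (n : ℕ) :
    ∫ ω, (stayPos n).indicator (fun ω => (walk ω n : ℝ) ^ 2) ω ∂stepLaw ρ ≤
      stepSq ρ * ∑ k ∈ Finset.range n, (stepLaw ρ).real (stayPos k) := by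
  induction n with
  | zero => simp [walk_zero]
  | succ n ih =>
    have hi := (integrable_walk_sq hρ n).indicator (measurableSet_stayPos n)
    have h1 := (integrable_mul_step
      (measurable_indicator_stayPos n (measurable_walkReal n))
      (dependsOn_indicator_stayPos n (dependsOn_walkReal n))
      ((integrable_walk hρ n).indicator (measurableSet_stayPos n)) (integrable_step hρ)).const_mul 2
    have h2 := integrable_mul_step
      (measurable_indicator_stayPos n measurable_const)
      (dependsOn_indicator_stayPos n fun _ _ _ => rfl)
      ((integrable_const (1 : ℝ)).indicator (measurableSet_stayPos n)) hρ
    have h3 : ∫ ω, (stayPos (n + 1)).indicator (fun ω => (walk ω (n + 1) : ℝ) ^ 2) ω ∂stepLaw ρ ≤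
        ∫ ω, ((stayPos n).indicator (fun ω => (walk ω n : ℝ) ^ 2) ω +
        2 * ((stayPos n).indicator (fun ω => (walk ω n : ℝ)) ω * (1 - (ω n : ℝ)))) +
        (stayPos n).indicator (fun _ => (1 : ℝ)) ω * (1 - (ω n : ℝ)) ^ 2 ∂stepLaw ρ := by
      refine integral_mono ((integrable_walk_sq hρ (n + 1)).indicator
        (measurableSet_stayPos (n + 1))) ((hi.add h1).add h2) fun ω => ?_
      by_cases hω : ω ∈ stayPos n
      · simp only [Set.indicator_of_mem hω]
        refine (Set.indicator_le_self' (fun _ _ => sq_nonneg _) ω).trans (le_of_eq ?_)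
        rw [walkReal_succ]
        ring
      · have hω' : ω ∉ stayPos (n + 1) := fun h => hω (stayPos_antitone (by omega) h)
        simp [Set.indicator_of_notMem hω, Set.indicator_of_notMem hω']
    rw [integral_add (f := fun ω => (stayPos n).indicator (fun ω => (walk ω n : ℝ) ^ 2) ω +
        2 * ((stayPos n).indicator (fun ω => (walk ω n : ℝ)) ω * (1 - (ω n : ℝ)))) (hi.add h1) h2,
      integral_add hi h1, integral_const_mul,
      integral_mul_step
      (measurable_indicator_stayPos n (measurable_walkReal n))
      (dependsOn_indicator_stayPos n (dependsOn_walkReal n)) fun j => 1 - (j : ℝ),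
      integral_mul_step (measurable_indicator_stayPos n measurable_const)
      (dependsOn_indicator_stayPos n fun _ _ _ => rfl) fun j => (1 - (j : ℝ)) ^ 2,
      integral_indicator_const (1 : ℝ) (measurableSet_stayPos n), smul_eq_mul, mul_one] at h3
    change _ ≤ _ + 2 * (_ * drift ρ) + _ * stepSq ρ at h3
    rw [h0] at h3
    rw [Finset.sum_range_succ]
    linarith

/-- Lower bound for the probability that a centred walk stays positive. -/
theorem sq_le_stayPos_mul (h0 : drift ρ = 0) {n : ℕ} (hn : 1 ≤ n) :
    ρ.real {0} ^ 2 ≤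
      (stepLaw ρ).real (stayPos n) * (stepSq ρ * (1 + 2 * √(n * stepSq ρ))) := by
  obtain ⟨n, rfl⟩ : ∃ k, n = k + 1 := ⟨n - 1, by omega⟩
  have hK : 0 ≤ stepSq ρ := stepSq_nonneg
  set a := (stepLaw ρ).real (stayPos (n + 1)) with ha
  set v := ∫ ω, (stayPos (n + 1)).indicator (fun ω => (walk ω (n + 1) : ℝ)) ω ∂stepLaw ρ with hv
  set u := ∫ ω, (stayPos (n + 1)).indicator (fun ω => (walk ω (n + 1) : ℝ) ^ 2) ω ∂stepLaw ρ
    with hu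
  have hpv : ρ.real {0} ≤ v := le_integral_walk_stayPos hρ h0 n
  -- The Cauchy–Schwarz inequality `v ^ 2 ≤ a * u`, from the nonnegativity of the integral of `(S -
  -- x) ^ 2` over the event, for all `x`.
  have hdisc : discrim a (-(2 * v)) u ≤ 0 := by
    refine discrim_le_zero fun x => ?_
    have hi1 := (integrable_walk_sq hρ (n + 1)).indicator (measurableSet_stayPos (n + 1))
    have hi2 := ((integrable_walk hρ (n + 1)).indicator
      (measurableSet_stayPos (n + 1))).const_mul (2 * x)
    have hi3 := ((integrable_const (μ := stepLaw ρ) (1 : ℝ)).indicator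
      (measurableSet_stayPos (n + 1))).const_mul (x * x)
    have h1 : 0 ≤ ∫ ω, ((stayPos (n + 1)).indicator (fun ω => (walk ω (n + 1) : ℝ) ^ 2) ω -
        2 * x * (stayPos (n + 1)).indicator (fun ω => (walk ω (n + 1) : ℝ)) ω) +
        x * x * (stayPos (n + 1)).indicator (fun _ => (1 : ℝ)) ω ∂stepLaw ρ := by
      refine integral_nonneg fun ω => ?_
      by_cases hω : ω ∈ stayPos (n + 1)
      · simp only [Set.indicator_of_mem hω, Pi.zero_apply]
        nlinarith [sq_nonneg ((walk ω (n + 1) : ℝ) - x)]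
      · simp [Set.indicator_of_notMem hω]
    rw [integral_add (f := fun ω => (stayPos (n + 1)).indicator
        (fun ω => (walk ω (n + 1) : ℝ) ^ 2) ω -
        2 * x * (stayPos (n + 1)).indicator (fun ω => (walk ω (n + 1) : ℝ)) ω) (hi1.sub hi2) hi3,
      integral_sub hi1 hi2, integral_const_mul, integral_const_mul,
      integral_indicator_const (1 : ℝ) (measurableSet_stayPos (n + 1)), smul_eq_mul, mul_one,
      ← ha, ← hu, ← hv] at h1
    linarith
  have hvu : v ^ 2 ≤ a * u := by
    rw [discrim] at hdisc
    nlinarith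
  -- The sum is `1` at most from time `0` plus the mean of the maximum, which is already bounded.
  have hsum : ∑ k ∈ Finset.range (n + 1), (stepLaw ρ).real (stayPos k) ≤
      1 + 2 * √((n + 1 : ℕ) * stepSq ρ) := by
    have hM := sq_integral_runMax_le hρ h0.ge n
    rw [integral_runMax, h0] at hM
    rw [Finset.sum_range_succ', add_comm]
    refine add_le_add measureReal_le_one ?_
    refine abs_le_of_sq_le_sq' ?_ (by positivity) |>.2
    rw [mul_pow, Real.sq_sqrt (by positivity)]
    refine hM.trans ?_
    push_cast
    nlinarith
  have hu' : u ≤ stepSq ρ * (1 + 2 * √((n + 1 : ℕ) * stepSq ρ)) :=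
    (integral_walk_sq_stayPos_le hρ h0 (n + 1)).trans (mul_le_mul_of_nonneg_left hsum hK)
  calc ρ.real {0} ^ 2 ≤ v ^ 2 := by
        have : 0 ≤ ρ.real {0} := measureReal_nonneg
        gcongr
    _ ≤ a * u := hvu
    _ ≤ _ := mul_le_mul_of_nonneg_left hu' measureReal_nonneg

omit hρ in
theorem walk_tail (ω : ℕ → ℕ) (n : ℕ) : walk ω (n + 1) = 1 - ω 0 + walk (fun i => ω (i + 1)) n := by
  induction n with
  | zero => simp [walk_succ, walk_zero]
  | succ n ih =>
    rw [walk_succ, ih, walk_succ]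
    ring

omit hρ in
theorem mem_stayPos_succ_iff (ω : ℕ → ℕ) (n : ℕ) :
    ω ∈ stayPos (n + 1) ↔ ω 0 = 0 ∧ (fun i => ω (i + 1)) ∈ stayNonneg n := by
  constructor
  · intro h
    have h0 : ω 0 = 0 := by
      have := h 1 le_rfl (by omega)
      rw [walk_tail, walk_zero] at this
      omega
    refine ⟨h0, fun k hk => ?_⟩
    have := h (k + 1) (by omega) (by omega)
    rw [walk_tail, h0] at this
    omega
  · rintro ⟨h0, h⟩ k hk hkn
    obtain ⟨k, rfl⟩ : ∃ l, k = l + 1 := ⟨k - 1, by omega⟩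
    have := h k (by omega)
    rw [walk_tail, h0]
    omega

omit hρ in
-- A walk that stays positive starts with an upward step and then stays nonnegative relative to
-- height `1`. The exploration is governed by nonnegativity, the duality by positivity.
theorem measure_stayPos_succ (n : ℕ) : (stepLaw ρ).real (stayPos (n + 1)) =
    ρ.real {0} * (stepLaw ρ).real (stayNonneg n) := by
  have hsplit : stayPos (n + 1) = (fun ω : ℕ → ℕ => ω 0) ⁻¹' {0} ∩
      (fun (ω : ℕ → ℕ) i => ω (i + 1)) ⁻¹' stayNonneg n := by
    ext ω
    exact mem_stayPos_succ_iff ω n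
  have hinj : Function.Injective fun i : ℕ => i + 1 := fun _ _ h => Nat.succ.inj h
  simp only [measureReal_def]
  rw [hsplit, infinitePi_inter_of_dependsOn (J := {0})
    (measurable_pi_apply 0 (measurableSet_singleton 0))
    ((measurePreserving_reindex ρ hinj).measurable (measurableSet_stayNonneg n)),
    (measurePreserving_eval_infinitePi (fun _ : ℕ => ρ) 0).measure_preimage
      (measurableSet_singleton 0).nullMeasurableSet,
    (measurePreserving_reindex ρ hinj).measure_preimage
      (measurableSet_stayNonneg n).nullMeasurableSet, ENNReal.toReal_mul]
  · intro ω ω' h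
    simp [h 0 rfl]
  · intro ω ω' h
    have : (fun i => ω (i + 1)) = fun i => ω' (i + 1) := funext fun i => h (i + 1) (by simp)
    simp [Set.mem_preimage, this]

/-- The number of zeros among the first `n` coordinates. -/
def zeros (ω : ℕ → ℕ) (n : ℕ) : ℕ := ∑ i ∈ Finset.range n, if ω i = 0 then 1 else 0

omit hρ in
theorem zeros_le (ω : ℕ → ℕ) (n : ℕ) : zeros ω n ≤ n := by
  refine (Finset.sum_le_sum (g := fun _ => 1) fun i _ => ?_).trans (by simp)
  split_ifs <;> omega

omit hρ in
theorem measurable_zeros (n : ℕ) : Measurable fun ω => (zeros ω n : ℝ) := by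
  refine measurable_from_top.comp (Finset.measurable_fun_sum _ fun i _ => ?_)
  exact (measurable_from_top (f := fun n : ℕ => if n = 0 then 1 else 0)).comp
    (measurable_pi_apply i)

omit hρ in
theorem dependsOn_zeros (n : ℕ) : DependsOn (fun ω => (zeros ω n : ℝ)) (Set.Iio n) := by
  intro ω ω' h
  simp only [zeros]
  congr 1
  exact Finset.sum_congr rfl fun i hi => by rw [h i (Finset.mem_range.1 hi)]

omit hρ in
theorem zeros_succ (ω : ℕ → ℕ) (n : ℕ) :
    (zeros ω (n + 1) : ℝ) = zeros ω n + Set.indicator {0} 1 (ω n) := by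
  rw [zeros, Finset.sum_range_succ, ← zeros]
  by_cases h : ω n = 0 <;> simp [h]

omit hρ in
theorem integrable_zeros_pow (n k : ℕ) :
    Integrable (fun ω => (zeros ω n : ℝ) ^ k) (stepLaw ρ) := by
  refine Integrable.of_bound ((measurable_zeros n).pow_const k).aestronglyMeasurable
    ((n : ℝ) ^ k) (.of_forall fun ω => ?_)
  rw [Real.norm_eq_abs, abs_of_nonneg (by positivity)]
  have : (zeros ω n : ℝ) ≤ n := by exact_mod_cast zeros_le ω n
  gcongr

omit [IsProbabilityMeasure ρ] hρ in
theorem integral_indicator_zero : ∫ j, Set.indicator {0} (1 : ℕ → ℝ) j ∂ρ = ρ.real {0} :=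
  integral_indicator_one (measurableSet_singleton 0)

omit hρ in
theorem integrable_indicator_zero : Integrable (Set.indicator {0} (1 : ℕ → ℝ)) ρ :=
  (integrable_const (1 : ℝ)).indicator (measurableSet_singleton 0)

omit hρ in
theorem integral_zeros (n : ℕ) : ∫ ω, (zeros ω n : ℝ) ∂stepLaw ρ = n * ρ.real {0} := by
  induction n with
  | zero => simp [zeros]
  | succ n ih =>
    simp only [zeros_succ]
    have h1 := integrable_zeros_pow (ρ := ρ) n 1
    simp only [pow_one] at h1
    rw [integral_add h1 (integrable_eval integrable_indicator_zero), ih,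
      integral_eval n (Set.indicator {0} 1), integral_indicator_zero]
    push_cast
    ring

omit hρ in
theorem integral_zeros_sq_le (n : ℕ) :
    ∫ ω, (zeros ω n : ℝ) ^ 2 ∂stepLaw ρ ≤ n * ρ.real {0} + (n * ρ.real {0}) ^ 2 := by
  induction n with
  | zero => simp [zeros]
  | succ n ih =>
    have h1 := integrable_zeros_pow (ρ := ρ) n 1
    simp only [pow_one] at h1
    have h2 := (integrable_mul_step (measurable_zeros n) (dependsOn_zeros n) h1
      (integrable_indicator_zero (ρ := ρ))).const_mul 2
    have h3 := integrable_eval (n := n) (integrable_indicator_zero (ρ := ρ))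
    have : ∫ ω, (zeros ω (n + 1) : ℝ) ^ 2 ∂stepLaw ρ =
        ∫ ω, (zeros ω n : ℝ) ^ 2 + 2 * ((zeros ω n : ℝ) * Set.indicator {0} 1 (ω n)) +
          Set.indicator {0} 1 (ω n) ∂stepLaw ρ := integral_congr_ae (.of_forall fun ω => by
        simp only [zeros_succ]
        by_cases h : ω n = 0
        · simp [h]; ring
        · simp [h])
    rw [this, integral_add (f := fun ω => (zeros ω n : ℝ) ^ 2 + 2 * ((zeros ω n : ℝ) *
      Set.indicator {0} 1 (ω n))) ((integrable_zeros_pow n 2).add h2) h3,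
      integral_add (integrable_zeros_pow n 2) h2, integral_const_mul,
      integral_mul_step (measurable_zeros n) (dependsOn_zeros n) (Set.indicator {0} 1),
      integral_eval n (Set.indicator {0} 1), integral_zeros, integral_indicator_zero]
    push_cast
    nlinarith [sq_nonneg (ρ.real {0})]

omit hρ in
/-- Chebyshev's inequality for the number of zeros. -/
theorem measure_zeros_lt_le {n N : ℕ} (h0 : 0 < ρ.real {0}) (hN : 0 < N)
    (hn : 2 * (n : ℝ) ≤ N * ρ.real {0}) :
    (stepLaw ρ).real {ω | zeros ω N < n} ≤ 4 / (N * ρ.real {0}) := by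
  have hN' : (0 : ℝ) < N := by exact_mod_cast hN
  set c := N * ρ.real {0} with hc
  have hc0 : 0 < c := by positivity
  have h1 := integrable_zeros_pow (ρ := ρ) N 1
  simp only [pow_one] at h1
  have h2 := integrable_zeros_pow (ρ := ρ) N 2
  have hint : Integrable (fun ω => ((zeros ω N : ℝ) - c) ^ 2) (stepLaw ρ) := by
    refine ((h2.sub (h1.const_mul (2 * c))).add (integrable_const (c ^ 2))).congr
      (.of_forall fun ω => ?_)
    simp only [Pi.add_apply, Pi.sub_apply]
    ring
  have hvar : ∫ ω, ((zeros ω N : ℝ) - c) ^ 2 ∂stepLaw ρ ≤ c := by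
    have : ∫ ω, ((zeros ω N : ℝ) - c) ^ 2 ∂stepLaw ρ =
        ∫ ω, ((zeros ω N : ℝ) ^ 2 - 2 * c * (zeros ω N : ℝ)) + c ^ 2 ∂stepLaw ρ :=
      integral_congr_ae (.of_forall fun ω => by beta_reduce; ring)
    rw [this, integral_add (f := fun ω => (zeros ω N : ℝ) ^ 2 - 2 * c * (zeros ω N : ℝ))
      (h2.sub (h1.const_mul (2 * c))) (integrable_const _),
      integral_sub h2 (h1.const_mul (2 * c)), integral_const_mul, integral_zeros]
    simp only [integral_const, probReal_univ, one_smul]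
    have := integral_zeros_sq_le (ρ := ρ) N
    rw [← hc] at *
    nlinarith
  have hmk := mul_meas_ge_le_integral_of_nonneg (μ := stepLaw ρ)
    (.of_forall fun ω => sq_nonneg ((zeros ω N : ℝ) - c)) hint ((c / 2) ^ 2)
  -- Since `n ≤ c / 2`, fewer than `n` zeros means a deviation of at least `c / 2` below the mean
  -- `c`.
  have hsub : (stepLaw ρ).real {ω | zeros ω N < n} ≤
      (stepLaw ρ).real {ω | (c / 2) ^ 2 ≤ ((zeros ω N : ℝ) - c) ^ 2} := by
    refine measureReal_mono fun ω hω => ?_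
    have h3 : (zeros ω N : ℝ) < n := by exact_mod_cast (show zeros ω N < n from hω)
    have h4 : c / 2 ≤ c - zeros ω N := by linarith
    simp only [Set.mem_ofPred_eq]
    nlinarith
  rw [le_div_iff₀ hc0]
  have h5 : (c / 2) ^ 2 * (stepLaw ρ).real {ω | zeros ω N < n} ≤ c :=
    (mul_le_mul_of_nonneg_left hsub (by positivity)).trans (hmk.trans hvar)
  have h6 : c * ((stepLaw ρ).real {ω | zeros ω N < n} * c) ≤ c * 4 := by nlinarith
  exact le_of_mul_le_mul_left h6 hc0

/-- The list of the first `n` coordinates, the last one first. -/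
def hist (ω : ℕ → ℕ) : ℕ → List ℕ
  | 0 => []
  | n + 1 => ω n :: hist ω n

omit hρ in
theorem length_hist (ω : ℕ → ℕ) (n : ℕ) : (hist ω n).length = n := by
  induction n with
  | zero => rfl
  | succ n ih => simp [hist, ih]

omit hρ in
theorem hist_congr {ω ω' : ℕ → ℕ} {n : ℕ} (h : ∀ i < n, ω i = ω' i) : hist ω n = hist ω' n := by
  induction n with
  | zero => rfl
  | succ n ih => rw [hist, hist, h n (by omega), ih fun i hi => h i (by omega)]

omit hρ in
theorem walk_eq_hist (ω : ℕ → ℕ) (n : ℕ) : walk ω n = n - (hist ω n).sum := by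
  induction n with
  | zero => simp [walk_zero, hist]
  | succ n ih =>
    rw [walk_succ, ih, hist, List.sum_cons]
    push_cast
    ring

omit hρ in
theorem zeros_eq_hist (ω : ℕ → ℕ) (n : ℕ) : zeros ω n = (hist ω n).count 0 := by
  induction n with
  | zero => simp [zeros, hist]
  | succ n ih =>
    rw [hist, List.count_cons, ← ih, zeros, Finset.sum_range_succ, ← zeros]
    simp

/-- The partial sums of the walk with the given list of jumps, the last one first, are
nonnegative. -/
def ValidHist : List ℕ → Prop
  | [] => True
  | j :: l => ValidHist l ∧ j + l.sum ≤ l.length + 1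

omit hρ in
theorem mem_stayNonneg_iff (ω : ℕ → ℕ) (n : ℕ) : ω ∈ stayNonneg n ↔ ValidHist (hist ω n) := by
  induction n with
  | zero => simp [stayNonneg, hist, ValidHist, walk_zero]
  | succ n ih =>
    have h1 : ω ∈ stayNonneg (n + 1) ↔ ω ∈ stayNonneg n ∧ 0 ≤ walk ω (n + 1) := by
      constructor
      · exact fun h => ⟨fun k hk => h k (by omega), h _ le_rfl⟩
      · rintro ⟨h, h'⟩ k hk
        rcases hk.eq_or_lt with rfl | hk
        · exact h'
        · exact h k (by omega)
    rw [h1, ih, hist, ValidHist, length_hist, walk_eq_hist, hist, List.sum_cons]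
    refine and_congr_right fun _ => ?_
    omega

omit hρ in
theorem measurableSet_hist_eq (n : ℕ) (l : List ℕ) : MeasurableSet {ω | hist ω n = l} := by
  induction n generalizing l with
  | zero =>
    by_cases h : [] = l <;> simp [hist, h]
  | succ n ih =>
    cases l with
    | nil => simp [hist]
    | cons j l =>
      have : {ω : ℕ → ℕ | hist ω (n + 1) = j :: l} =
          (fun ω => ω n) ⁻¹' {j} ∩ {ω | hist ω n = l} := by
        ext ω
        simp [hist]
      rw [this]
      exact (measurable_pi_apply n (measurableSet_singleton j)).inter (ih l)

omit hρ in
theorem measure_hist_eq (l : List ℕ) :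
    stepLaw ρ {ω | hist ω l.length = l} = (l.map fun j => ρ {j}).prod := by
  induction l with
  | nil => simp [hist]
  | cons j l ih =>
    have : {ω : ℕ → ℕ | hist ω (j :: l).length = j :: l} =
        {ω | hist ω l.length = l} ∩ (fun ω => ω l.length) ⁻¹' {j} := by
      ext ω
      simp [hist, and_comm]
    rw [this, infinitePi_inter_of_dependsOn (J := Set.Iio l.length)
      (measurableSet_hist_eq _ _) (measurable_pi_apply _ (measurableSet_singleton j)), ih,
      (measurePreserving_eval_infinitePi (fun _ : ℕ => ρ) l.length).measure_preimage
      (measurableSet_singleton j).nullMeasurableSet, List.map_cons, List.prod_cons, mul_comm]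
    · intro ω ω' h
      simp [hist_congr h]
    · intro ω ω' h
      simp [h l.length (by simp)]

omit hρ in
-- Events about the first `n` steps are split into single histories; walk and exploration will be
-- compared history by history.
theorem measure_hist_mem (n : ℕ) {S : Set (List ℕ)} (hS : ∀ l ∈ S, l.length = n) :
    stepLaw ρ {ω | hist ω n ∈ S} = ∑' l : S, ((l : List ℕ).map fun j => ρ {j}).prod := by
  have : {ω : ℕ → ℕ | hist ω n ∈ S} = ⋃ l ∈ S, {ω | hist ω n = l} := by
    ext ω
    simp
  rw [this, measure_biUnion S.to_countable]
  · refine tsum_congr fun l => ?_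
    rw [← measure_hist_eq, hS l l.2]
  · intro l _ l' _ hne
    refine Set.disjoint_left.2 fun ω h h' => hne ?_
    rw [← show hist ω n = l from h, ← show hist ω n = l' from h']
  · exact fun l _ => measurableSet_hist_eq n l

end Walk

/-! ### The half-plane map coded by bits -/

/-- The bottom endpoint of the `k`-th edge between the generations `r` and `r + 1`, when the bits
`b (r, ·)` tell whether the next edge moves its top endpoint (`true`) or its bottom endpoint
(`false`) to the right. -/
def botIdx (b : ℕ × ℕ → Bool) (r k : ℕ) : ℕ :=
  ∑ i ∈ Finset.range k, if b (r, i) = true then 0 else 1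

/-- The top endpoint of the `k`-th edge between the generations `r` and `r + 1`. -/
def topIdx (b : ℕ × ℕ → Bool) (r k : ℕ) : ℕ :=
  ∑ i ∈ Finset.range k, if b (r, i) = true then 1 else 0

/-- Open edges in the map with edge sequences coded by `b`. -/
def BitEdge (b o : ℕ × ℕ → Bool) (v w : ℕ × ℕ) : Prop :=
  ∃ k, v.2 = botIdx b v.1 k ∧ w = (v.1 + 1, topIdx b v.1 k) ∧ o (v.1, k) = true

/-- The vertices reached from `(0, 0)` by open directed paths. -/
def bitCluster (b o : ℕ × ℕ → Bool) : Set (ℕ × ℕ) :=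
  {v | Relation.ReflTransGen (BitEdge b o) (0, 0) v}

section Index

variable {b b' : ℕ × ℕ → Bool} {r k : ℕ}

theorem botIdx_succ_true (h : b (r, k) = true) : botIdx b r (k + 1) = botIdx b r k := by
  simp [botIdx, Finset.sum_range_succ, h]

theorem botIdx_succ_false (h : b (r, k) = false) : botIdx b r (k + 1) = botIdx b r k + 1 := by
  simp [botIdx, Finset.sum_range_succ, h]

theorem topIdx_succ_true (h : b (r, k) = true) : topIdx b r (k + 1) = topIdx b r k + 1 := by
  rw [topIdx, Finset.sum_range_succ, if_pos h, topIdx]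

theorem topIdx_succ_false (h : b (r, k) = false) : topIdx b r (k + 1) = topIdx b r k := by
  rw [topIdx, Finset.sum_range_succ, if_neg (by simp [h]), topIdx, add_zero]

theorem botIdx_mono : Monotone (botIdx b r) := fun _ _ h =>
  Finset.sum_le_sum_of_subset (Finset.range_mono h)

theorem topIdx_mono : Monotone (topIdx b r) := fun _ _ h =>
  Finset.sum_le_sum_of_subset (Finset.range_mono h)

theorem botIdx_congr (h : ∀ i < k, b (r, i) = b' (r, i)) : botIdx b r k = botIdx b' r k :=
  Finset.sum_congr rfl fun i hi => by rw [h i (Finset.mem_range.1 hi)]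

theorem topIdx_congr (h : ∀ i < k, b (r, i) = b' (r, i)) : topIdx b r k = topIdx b' r k :=
  Finset.sum_congr rfl fun i hi => by rw [h i (Finset.mem_range.1 hi)]

theorem botIdx_add_topIdx (b : ℕ × ℕ → Bool) (r k : ℕ) : botIdx b r k + topIdx b r k = k := by
  rw [botIdx, topIdx, ← Finset.sum_add_distrib]
  calc _ = ∑ i ∈ Finset.range k, 1 := Finset.sum_congr rfl fun i _ => by split_ifs <;> rfl
    _ = k := by simp

/-- The bits of the layer `r` from position `k` on start with `z` times `false`, then `true`. -/
def RunAt (b : ℕ × ℕ → Bool) (r k z : ℕ) : Prop :=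
  (∀ i < z, b (r, k + i) = false) ∧ b (r, k + z) = true

theorem RunAt.botIdx_add {z : ℕ} (h : RunAt b r k z) {i : ℕ} (hi : i ≤ z) :
    botIdx b r (k + i) = botIdx b r k + i := by
  induction i with
  | zero => rfl
  | succ i ih =>
    rw [← add_assoc, botIdx_succ_false (h.1 i (by omega)), ih (by omega)]
    rfl

theorem RunAt.topIdx_add {z : ℕ} (h : RunAt b r k z) {i : ℕ} (hi : i ≤ z) :
    topIdx b r (k + i) = topIdx b r k := by
  induction i with
  | zero => rfl
  | succ i ih => rw [← add_assoc, topIdx_succ_false (h.1 i (by omega)), ih (by omega)]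

theorem RunAt.botIdx_end {z : ℕ} (h : RunAt b r k z) :
    botIdx b r (k + z + 1) = botIdx b r k + z := by
  rw [botIdx_succ_true h.2, h.botIdx_add le_rfl]

theorem RunAt.topIdx_end {z : ℕ} (h : RunAt b r k z) :
    topIdx b r (k + z + 1) = topIdx b r k + 1 := by
  rw [topIdx_succ_true h.2, h.topIdx_add le_rfl]

theorem RunAt.unique {z z' : ℕ} (h : RunAt b r k z) (h' : RunAt b r k z') : z = z' := by
  rcases lt_trichotomy z z' with hlt | rfl | hlt
  · exact absurd h.2 (by simp [h'.1 z hlt])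
  · rfl
  · exact absurd h'.2 (by simp [h.1 z' hlt])

theorem RunAt.congr {z : ℕ} (h : RunAt b r k z)
    (hb : ∀ i, k ≤ i → i ≤ k + z → b (r, i) = b' (r, i)) : RunAt b' r k z :=
  ⟨fun i hi => by rw [← hb _ (by omega) (by omega), h.1 i hi],
    by rw [← hb _ (by omega) (by omega), h.2]⟩

end Index

/-! ### The depth-first exploration: determinism, locality, existence of steps -/

/-- Downward cascade of the exploration. The layers `≥ R` are up to date, the top endpoint of the
cursor of the layer `R - 1` has still to move by `c`, and its bottom endpoint has moved by `y`. The
cascade leads from the cursors `F` to the cursors `F'` and to the height `H` (`0` for the end of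
the exploration), and reads `n` bits `false`. -/
inductive Casc (b : ℕ × ℕ → Bool) :
    ℕ → ℕ → ℕ → (ℕ →₀ ℕ) → (ℕ →₀ ℕ) → ℕ → ℕ → Prop
  | dead (c y : ℕ) (F : ℕ →₀ ℕ) : Casc b 0 c y F F 0 0
  | finish (r : ℕ) (F : ℕ →₀ ℕ) : Casc b (r + 1) 0 0 F F (r + 1) 0
  | down {r y H n : ℕ} {F F' : ℕ →₀ ℕ} (hy : 0 < y) (h : Casc b r y 0 F F' H n) :
      Casc b (r + 1) 0 y F F' H n
  | run {r c y z H n : ℕ} {F F' : ℕ →₀ ℕ} (hz : RunAt b r (F r) z)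
      (h : Casc b (r + 1) c (y + z) (F.update r (F r + z + 1)) F' H n) :
      Casc b (r + 1) (c + 1) y F F' H (n + z)

/-- One step of the exploration, at height `H` (that is, at a vertex of generation `H - 1`) and
with cursors `F`: the height changes by `1 - J`, and `n` vertices are skipped. -/
inductive Step (b o : ℕ × ℕ → Bool) : ℕ → (ℕ →₀ ℕ) → ℕ → ℕ → (ℕ →₀ ℕ) → ℕ → Prop
  | up {h k : ℕ} {F : ℕ →₀ ℕ} (ho : o (h, F h) = true) (hk : F (h + 1) ≤ k)
      (hb : botIdx b (h + 1) k = topIdx b h (F h))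
      (hmin : ∀ i, F (h + 1) ≤ i → i < k → botIdx b (h + 1) i < topIdx b h (F h)) :
      Step b o (h + 1) F 0 (h + 2) (F.update (h + 1) k) 0
  | right {h : ℕ} {F : ℕ →₀ ℕ} (ho : o (h, F h) = false) (hb : b (h, F h) = true) :
      Step b o (h + 1) F 1 (h + 1) (F.update h (F h + 1)) 0
  | down {h H n : ℕ} {F F' : ℕ →₀ ℕ} (ho : o (h, F h) = false) (hb : b (h, F h) = false)
      (hc : Casc b h 1 0 (F.update h (F h + 1)) F' H n) :
      Step b o (h + 1) F (h + 2 - H) H F' n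

/-- The exploration with the given list of jumps (the last one first) leads to height `H` and
cursors `F` and skips `n` vertices. -/
inductive Run (b o : ℕ × ℕ → Bool) : List ℕ → ℕ → (ℕ →₀ ℕ) → ℕ → Prop
  | nil : Run b o [] 1 0 0
  | cons {l : List ℕ} {h H J n n' : ℕ} {F F' : ℕ →₀ ℕ} (hr : Run b o l (h + 1) F n)
      (hs : Step b o (h + 1) F J H F' n') : Run b o (J :: l) H F' (n + n')

section Deterministic

variable {b o b' o' : ℕ × ℕ → Bool}

theorem Casc.height_le {R c y H n : ℕ} {F F' : ℕ →₀ ℕ} (h : Casc b R c y F F' H n) : H ≤ R := by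
  induction h <;> omega

theorem Casc.le {R c y H n : ℕ} {F F' : ℕ →₀ ℕ} (h : Casc b R c y F F' H n) (r : ℕ) :
    F r ≤ F' r := by
  induction h with
  | dead | finish => exact le_rfl
  | down _ _ ih => exact ih
  | @run r' _ _ z _ _ F _ _ _ ih =>
    refine le_trans ?_ ih
    rw [Finsupp.coe_update, Function.update_apply]
    split_ifs with h
    · subst h; omega
    · exact le_rfl

theorem Casc.eq_of_lt {R c y H n : ℕ} {F F' : ℕ →₀ ℕ} (h : Casc b R c y F F' H n) {r : ℕ}
    (hr : r + 1 < H) : F' r = F r := by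
  induction h with
  | dead | finish => rfl
  | down _ _ ih => exact ih hr
  | run _ hc ih =>
    have := hc.height_le
    rw [ih hr, Finsupp.coe_update, Function.update_of_ne (by omega)]

/-- A cascade strictly advances the cursor of every layer that it leaves. Thus the path edge of such
a layer remains known: it passes from the cursor to the left of it. -/
theorem Casc.lt {R c y H n : ℕ} {F F' : ℕ →₀ ℕ} (h : Casc b R c y F F' H n) {r : ℕ}
    (hr : r < R) (hH : H ≤ r + 1) (hc : r + 1 = R → 0 < c) : F r < F' r := by
  induction h with
  | dead => omega
  | finish => omega
  | down hy _ ih => exact ih (by by_contra; have := hc (by omega); omega) hH fun _ => hy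
  | @run r' _ _ z _ _ F _ _ hcasc ih =>
    by_cases h : r = r'
    · subst h
      have := hcasc.le r
      rw [Finsupp.coe_update, Function.update_self] at this
      omega
    · have := ih hr hH (by omega)
      rwa [Finsupp.coe_update, Function.update_of_ne h] at this

theorem Casc.unique {R c y H H₂ n n₂ : ℕ} {F F' F₂ : ℕ →₀ ℕ} (h : Casc b R c y F F' H n)
    (h₂ : Casc b R c y F F₂ H₂ n₂) : F' = F₂ ∧ H = H₂ ∧ n = n₂ := by
  induction h generalizing F₂ H₂ n₂ with
  | dead => cases h₂; simp
  | finish => cases h₂ <;> simp_all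
  | down hy _ ih =>
    cases h₂ with
    | finish => omega
    | down _ h => exact ih h
  | run hz _ ih =>
    cases h₂ with
    | run hz' h =>
      obtain rfl := hz.unique hz'
      obtain ⟨h1, h2, h3⟩ := ih h
      exact ⟨h1, h2, by omega⟩

theorem Casc.congr_of_lt {R c y H n : ℕ} {F F' : ℕ →₀ ℕ} (h : Casc b R c y F F' H n)
    (hb : ∀ r k, k < F' r → b (r, k) = b' (r, k)) : Casc b' R c y F F' H n := by
  induction h with
  | dead => exact .dead _ _ _
  | finish => exact .finish _ _
  | down hy _ ih => exact .down hy (ih hb)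
  | @run r _ _ z _ _ F _ hz hc ih =>
    have := hc.le r
    rw [Finsupp.coe_update, Function.update_self] at this
    exact .run (hz.congr fun i _ hi => hb r i (by omega)) (ih hb)

/-- Only bits from the initial cursors on, in the layers below `R`, are read, which makes a cascade
independent of the past. `Casc.congr_of_lt` is the counterpart for the final cursors and yields
measurability. -/
theorem Casc.congr_of_ge {R c y H n : ℕ} {F F' : ℕ →₀ ℕ} (h : Casc b R c y F F' H n)
    (hb : ∀ r k, r < R → F r ≤ k → b (r, k) = b' (r, k)) : Casc b' R c y F F' H n := by
  induction h with
  | dead => exact .dead _ _ _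
  | finish => exact .finish _ _
  | down hy _ ih => exact .down hy (ih fun r k hr => hb r k (by omega))
  | @run r _ _ z _ _ F _ hz hc ih =>
    refine .run (hz.congr fun i hi _ => hb r i (by omega) hi) (ih fun r' k hr hk => ?_)
    rw [Finsupp.coe_update, Function.update_apply] at hk
    refine hb r' k hr ?_
    split_ifs at hk with h
    · subst h; omega
    · exact hk

theorem Step.height_eq {H J H' n : ℕ} {F F' : ℕ →₀ ℕ} (h : Step b o H F J H' F' n) :
    H' + J = H + 1 := by
  cases h with
  | up | right => omega
  | down _ _ hc => have := hc.height_le; omega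

theorem Step.unique {H J J₂ H' H₂ n n₂ : ℕ} {F F' F₂ : ℕ →₀ ℕ} (h : Step b o H F J H' F' n)
    (h₂ : Step b o H F J₂ H₂ F₂ n₂) : J = J₂ ∧ H' = H₂ ∧ F' = F₂ ∧ n = n₂ := by
  cases h with
  | @up _ k _ ho hk hb hmin =>
    cases h₂ with
    | @up _ k' _ ho' hk' hb' hmin' =>
      have : k = k' := by
        rcases lt_trichotomy k k' with hlt | h | hlt
        · have := hmin' k hk hlt; omega
        · exact h
        · have := hmin k' hk' hlt; omega
      subst this
      simp
    | right ho' => simp [ho] at ho'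
    | down ho' => simp [ho] at ho'
  | right ho hb =>
    cases h₂ with
    | up ho' => simp [ho] at ho'
    | right => simp
    | down _ hb' => simp [hb] at hb'
  | down ho hb hc =>
    cases h₂ with
    | up ho' => simp [ho] at ho'
    | right _ hb' => simp [hb] at hb'
    | down _ _ hc' =>
      obtain ⟨rfl, rfl, rfl⟩ := hc.unique hc'
      simp

theorem Run.unique {l : List ℕ} {H H₂ n n₂ : ℕ} {F F₂ : ℕ →₀ ℕ} (h : Run b o l H F n)
    (h₂ : Run b o l H₂ F₂ n₂) : H = H₂ ∧ F = F₂ ∧ n = n₂ := by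
  induction h generalizing H₂ F₂ n₂ with
  | nil => cases h₂; simp
  | cons _ hs ih =>
    cases h₂ with
    | cons hr' hs' =>
      obtain ⟨h1, rfl, rfl⟩ := ih hr'
      obtain rfl := Nat.succ.inj h1
      obtain ⟨-, rfl, rfl, rfl⟩ := hs.unique hs'
      simp

/-- Two histories of the same length coincide. -/
theorem Run.hist_unique {l l₂ : List ℕ} {H H₂ n n₂ : ℕ} {F F₂ : ℕ →₀ ℕ} (h : Run b o l H F n)
    (h₂ : Run b o l₂ H₂ F₂ n₂) (hl : l.length = l₂.length) : l = l₂ := by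
  induction h generalizing l₂ H₂ F₂ n₂ with
  | nil => exact (List.eq_nil_of_length_eq_zero hl.symm).symm
  | cons hr hs ih =>
    cases h₂ with
    | nil => simp at hl
    | cons hr' hs' =>
      obtain rfl := ih hr' (by simpa using hl)
      obtain ⟨h1, rfl, rfl⟩ := hr.unique hr'
      obtain rfl := Nat.succ.inj h1
      obtain ⟨rfl, -⟩ := hs.unique hs'
      rfl

theorem Run.height_eq {l : List ℕ} {H n : ℕ} {F : ℕ →₀ ℕ} (h : Run b o l H F n) :
    H + l.sum = l.length + 1 := by
  induction h with
  | nil => rfl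
  | cons _ hs ih =>
    have := hs.height_eq
    simp only [List.sum_cons, List.length_cons]
    omega

/-- The state `o (r, k)` is known to the exploration at height `H` and with cursors `F`. -/
def KnownEdge (H : ℕ) (F : ℕ →₀ ℕ) (e : ℕ × ℕ) : Prop :=
  e.2 < F e.1 ∨ e.2 = F e.1 ∧ e.1 + 1 < H

theorem Step.le {H J H' n : ℕ} {F F' : ℕ →₀ ℕ} (h : Step b o H F J H' F' n) (r : ℕ) :
    F r ≤ F' r := by
  cases h with
  | up _ hk =>
    rw [Finsupp.coe_update, Function.update_apply]
    split_ifs with h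
    · subst h; exact hk
    · exact le_rfl
  | right =>
    rw [Finsupp.coe_update, Function.update_apply]
    split_ifs with h
    · subst h; omega
    · exact le_rfl
  | down _ _ hc =>
    refine le_trans ?_ (hc.le r)
    rw [Finsupp.coe_update, Function.update_apply]
    split_ifs with h
    · subst h; omega
    · exact le_rfl

theorem Step.knownEdge {H J H' n : ℕ} {F F' : ℕ →₀ ℕ} (h : Step b o H F J H' F' n) {e : ℕ × ℕ}
    (he : KnownEdge H F e) : KnownEdge H' F' e := by
  rcases he with he | ⟨he, heH⟩
  · exact .inl (he.trans_le (h.le _))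
  · cases h with
    | up =>
      refine .inr ⟨?_, by omega⟩
      rw [Finsupp.coe_update, Function.update_of_ne (by omega), he]
    | right =>
      refine .inr ⟨?_, by omega⟩
      rw [Finsupp.coe_update, Function.update_of_ne (by omega), he]
    | @down h H' n F F' _ _ hc =>
      by_cases hlt : e.1 + 1 < H'
      · refine .inr ⟨?_, hlt⟩
        rw [hc.eq_of_lt hlt, Finsupp.coe_update, Function.update_of_ne (by omega), he]
      · have := hc.lt (r := e.1) (by omega) (by omega) (by omega)
        rw [Finsupp.coe_update, Function.update_of_ne (by omega)] at this
        exact .inl (by omega)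

theorem Step.congr {H J H' n : ℕ} {F F' : ℕ →₀ ℕ} (h : Step b o H F J H' F' n)
    (hb : ∀ r k, k < F' r → b (r, k) = b' (r, k)) (ho : ∀ e, KnownEdge H' F' e → o e = o' e) :
    Step b' o' H F J H' F' n := by
  have hle := h.le
  cases h with
  | @up h k F ho' hk hbot hmin =>
    have htop : topIdx b h (F h) = topIdx b' h (F h) :=
      topIdx_congr fun i hi => hb _ _ (hi.trans_le (hle h))
    have hbi : ∀ i ≤ k, botIdx b (h + 1) i = botIdx b' (h + 1) i := fun i hi =>
      botIdx_congr fun j hj => hb _ _ (by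
        rw [Finsupp.coe_update, Function.update_self]
        omega)
    refine .up ?_ hk ?_ ?_
    · rw [← ho _ (.inr ⟨?_, by simp⟩), ho']
      simp
    · rw [← hbi k le_rfl, hbot, htop]
    · intro i hi hik
      rw [← hbi i hik.le, ← htop]
      exact hmin i hi hik
  | @right h F ho' hb' =>
    refine .right ?_ ?_
    · rw [← ho _ (.inl (by simp)), ho']
    · rw [← hb _ _ (by simp), hb']
  | @down h H n F F' ho' hb' hc =>
    have : F h < F' h := by
      have := hc.le h
      rw [Finsupp.coe_update, Function.update_self] at this
      omega
    refine .down ?_ ?_ (hc.congr_of_lt hb)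
    · rw [← ho _ (.inl this), ho']
    · rw [← hb _ _ this, hb']

/-- The past of the exploration is determined by the bits on the left of the cursors and by the
known edges, since both sets only grow from step to step. -/
theorem Run.congr {l : List ℕ} {H n : ℕ} {F : ℕ →₀ ℕ} (h : Run b o l H F n)
    (hb : ∀ r k, k < F r → b (r, k) = b' (r, k)) (ho : ∀ e, KnownEdge H F e → o e = o' e) :
    Run b' o' l H F n := by
  induction h with
  | nil => exact .nil
  | cons _ hs ih =>
    exact .cons (ih (fun r k hk => hb r k (hk.trans_le (hs.le r)))
      fun e he => ho e (hs.knownEdge he)) (hs.congr hb ho)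

/-- Both values occur infinitely often in every layer. -/
def GoodBits (b : ℕ × ℕ → Bool) : Prop :=
  ∀ r k v, ∃ i, k ≤ i ∧ b (r, i) = v

theorem GoodBits.exists_runAt (hb : GoodBits b) (r k : ℕ) : ∃ z, RunAt b r k z := by
  classical
  have hex : ∃ z, b (r, k + z) = true := by
    obtain ⟨i, hi, h⟩ := hb r k true
    exact ⟨i - k, by rwa [Nat.add_sub_cancel' hi]⟩
  exact ⟨Nat.find hex, fun i hi => by simpa using Nat.find_min hex hi, Nat.find_spec hex⟩

/-- Lexicographic induction on the layer and on the pending moves in it: each run ends because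
`true` recurs, and a layer without pending moves is either final or left downwards. -/
theorem GoodBits.exists_casc (hb : GoodBits b) (R c y : ℕ) (F : ℕ →₀ ℕ) :
    ∃ F' H n, Casc b R c y F F' H n := by
  induction R generalizing c y F with
  | zero => exact ⟨F, 0, 0, .dead _ _ _⟩
  | succ r ihr =>
    induction c generalizing y F with
    | zero =>
      rcases y.eq_zero_or_pos with rfl | hy
      · exact ⟨F, r + 1, 0, .finish _ _⟩
      · obtain ⟨F', H, n, h⟩ := ihr y 0 F
        exact ⟨F', H, n, .down hy h⟩
    | succ c ihc =>
      obtain ⟨z, hz⟩ := hb.exists_runAt r (F r)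
      obtain ⟨F', H, n, h⟩ := ihc (y + z) (F.update r (F r + z + 1))
      exact ⟨F', H, n + z, .run hz h⟩

theorem GoodBits.exists_botIdx_ge (hb : GoodBits b) (r k : ℕ) : ∃ i, k ≤ botIdx b r i := by
  induction k with
  | zero => exact ⟨0, Nat.zero_le _⟩
  | succ k ih =>
    obtain ⟨i, hi⟩ := ih
    obtain ⟨j, hj, h⟩ := hb r i false
    exact ⟨j + 1, by rw [botIdx_succ_false h]; exact Nat.succ_le_succ (hi.trans (botIdx_mono hj))⟩

/-- The bottom endpoint moves by at most one at a time and tends to infinity, so it takes every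
value; an upward step places its cursor at the first edge of the new vertex. -/
theorem GoodBits.exists_botIdx_eq (hb : GoodBits b) {r k a : ℕ} (ha : botIdx b r k ≤ a) :
    ∃ i, k ≤ i ∧ botIdx b r i = a ∧ ∀ j, k ≤ j → j < i → botIdx b r j < a := by
  classical
  have hex : ∃ i, k ≤ i ∧ a ≤ botIdx b r i := by
    obtain ⟨i, hi⟩ := hb.exists_botIdx_ge r a
    exact ⟨max i k, le_max_right _ _, hi.trans (botIdx_mono (le_max_left _ _))⟩
  obtain ⟨h1, h2⟩ := Nat.find_spec hex
  have hmin : ∀ j, k ≤ j → j < Nat.find hex → botIdx b r j < a := fun j hj hlt => by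
    by_contra! h
    exact Nat.find_min hex hlt ⟨hj, h⟩
  refine ⟨Nat.find hex, h1, le_antisymm ?_ h2, hmin⟩
  rcases h1.eq_or_lt with heq | hlt
  · rw [← heq]
    exact ha
  · obtain ⟨j, hj⟩ : ∃ j, Nat.find hex = j + 1 := ⟨Nat.find hex - 1, by omega⟩
    have := hmin j (by omega) (by omega)
    rw [hj]
    cases hbj : b (r, j)
    · rw [botIdx_succ_false hbj]; omega
    · rw [botIdx_succ_true hbj]; omega

end Deterministic

/-! ### Invariants of the exploration and comparison with the cluster -/

section Exploration

variable {b o : ℕ × ℕ → Bool}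

/-- The set `D` contains the root and, as far as the edges on the left of the cursors `F` are
concerned, is closed under open edges; edges from the bottom endpoint of a cursor are treated as if
this vertex was in `D`. -/
structure ClosedBelow (b o : ℕ × ℕ → Bool) (F : ℕ →₀ ℕ) (D : Finset (ℕ × ℕ)) : Prop where
  root : (0, 0) ∈ D
  closed : ∀ r k, k < F r → o (r, k) = true →
    ((r, botIdx b r k) ∈ D ∨ botIdx b r k = botIdx b r (F r)) → (r + 1, topIdx b r k) ∈ D

/-- Invariant of the exploration, with visited vertices `V` and visited or skipped vertices `D`. -/
structure ExploreInv (b o : ℕ × ℕ → Bool) (H : ℕ) (F : ℕ →₀ ℕ) (V D : Finset (ℕ × ℕ)) : Prop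
    extends ClosedBelow b o F D where
  sub : V ⊆ D
  reach : ∀ v ∈ V, v ∈ bitCluster b o
  openPath : ∀ r, r + 1 < H → o (r, F r) = true
  align : ∀ r, r + 1 < H → botIdx b (r + 1) (F (r + 1)) = topIdx b r (F r)
  path : ∀ r, r < H → (r, botIdx b r (F r)) ∈ V
  le_bot : ∀ r i, r < H → (r, i) ∈ D → i ≤ botIdx b r (F r)
  lt_bot : ∀ r i, H ≤ r → (r, i) ∈ D → i < botIdx b r (F r)
  lt_top : ∀ r i, H ≤ r + 1 → (r + 1, i) ∈ D → i < topIdx b r (F r)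
  bot_le : ∀ r, H ≤ r + 1 → botIdx b (r + 1) (F (r + 1)) ≤ topIdx b r (F r)

/-- Invariant of the downward cascades. -/
structure CascInv (b o : ℕ × ℕ → Bool) (R c y : ℕ) (F : ℕ →₀ ℕ) (V D : Finset (ℕ × ℕ)) : Prop
    extends ClosedBelow b o F D where
  sub : V ⊆ D
  openPath : ∀ r, r + 1 < R → o (r, F r) = true
  align : ∀ r, r + 2 < R → botIdx b (r + 1) (F (r + 1)) = topIdx b r (F r)
  align_last : ∀ r, r + 2 = R → botIdx b (r + 1) (F (r + 1)) = topIdx b r (F r) + y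
  path : ∀ r, r + 1 < R → (r, botIdx b r (F r)) ∈ V
  path_last : ∀ r, r + 1 = R → y = 0 → (r, botIdx b r (F r)) ∈ V
  le_bot : ∀ r i, r < R → (r, i) ∈ D → i ≤ botIdx b r (F r)
  lt_bot_last : ∀ r i, r + 1 = R → 0 < y → (r, i) ∈ D → i < botIdx b r (F r)
  lt_bot : ∀ r i, R ≤ r → (r, i) ∈ D → i < botIdx b r (F r)
  pending : ∀ r, r + 1 = R → botIdx b (r + 1) (F (r + 1)) = topIdx b r (F r) + c
  pending_mem : ∀ r i, r + 1 = R → topIdx b r (F r) ≤ i → i < topIdx b r (F r) + c →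
    (r + 1, i) ∈ D
  skipped_mem : ∀ r i, r + 1 = R → botIdx b r (F r) ≤ i + y → i < botIdx b r (F r) → (r, i) ∈ D
  lt_top : ∀ r i, R ≤ r → (r + 1, i) ∈ D → i < topIdx b r (F r)
  bot_le : ∀ r, R ≤ r → botIdx b (r + 1) (F (r + 1)) ≤ topIdx b r (F r)

/-- The `y` vertices that the bottom endpoint of layer `q` has passed are top endpoints for the
layer below, hence its pending moves. They belong to `D`, so `skipped_mem` becomes `pending_mem`. -/
theorem CascInv.down {q y : ℕ} {F : ℕ →₀ ℕ} {V D : Finset (ℕ × ℕ)} (hy : 0 < y)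
    (h : CascInv b o (q + 1) 0 y F V D) : CascInv b o q y 0 F V D where
  toClosedBelow := h.toClosedBelow
  sub := h.sub
  openPath r hr := h.openPath r (by omega)
  align r hr := h.align r (by omega)
  align_last r hr := h.align r (by omega)
  path r hr := h.path r (by omega)
  path_last r hr _ := h.path r (by omega)
  le_bot r i hr := h.le_bot r i (by omega)
  lt_bot_last r i hr hy' := absurd hy' (lt_irrefl 0)
  lt_bot r i hr hi := by
    rcases hr.eq_or_lt with rfl | hr
    · exact h.lt_bot_last q i rfl hy hi
    · exact h.lt_bot r i hr hi
  pending r hr := h.align_last r (by omega)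
  pending_mem r i hr h1 h2 := by
    refine h.skipped_mem (r + 1) i (by omega) ?_ ?_
    · rw [h.align_last r (by omega)]; omega
    · rw [h.align_last r (by omega)]; omega
  skipped_mem r i _ h1 h2 := by omega
  lt_top r i hr hi := by
    rcases hr.eq_or_lt with rfl | hr
    · have := h.pending q rfl
      have := h.lt_bot (q + 1) i le_rfl hi
      omega
    · exact h.lt_top r i hr hi
  bot_le r hr := by
    rcases hr.eq_or_lt with rfl | hr
    · have := h.pending q rfl
      omega
    · exact h.bot_le r hr

/-- If the bottom endpoint has not moved, the path vertex of generation `q` keeps an unread edge,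
and the exploration resumes there. -/
theorem CascInv.finish {q : ℕ} {F : ℕ →₀ ℕ} {V D : Finset (ℕ × ℕ)}
    (h : CascInv b o (q + 1) 0 0 F V D) (hV : ∀ v ∈ V, v ∈ bitCluster b o) :
    ExploreInv b o (q + 1) F V D where
  toClosedBelow := h.toClosedBelow
  sub := h.sub
  reach := hV
  openPath r hr := h.openPath r (by omega)
  align r hr := by
    rcases (show r + 2 ≤ q + 1 by omega).eq_or_lt with hr | hr
    · exact h.align_last r hr
    · exact h.align r hr
  path r hr := by
    rcases (Nat.succ_le_of_lt hr).eq_or_lt with hr | hr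
    · exact h.path_last r hr rfl
    · exact h.path r hr
  le_bot := h.le_bot
  lt_bot := h.lt_bot
  lt_top r i hr hi := by
    rcases hr.eq_or_lt with hr | hr
    · have := h.pending r hr.symm
      have := h.lt_bot (r + 1) i (by omega) hi
      omega
    · exact h.lt_top r i (by omega) hi
  bot_le r hr := by
    rcases hr.eq_or_lt with hr | hr
    · have := h.pending r hr.symm
      omega
    · exact h.bot_le r (by omega)

theorem CascInv.dead {c y : ℕ} {F : ℕ →₀ ℕ} {V D : Finset (ℕ × ℕ)}
    (h : CascInv b o 0 c y F V D) (hV : ∀ v ∈ V, v ∈ bitCluster b o) :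
    ExploreInv b o 0 F V D where
  toClosedBelow := h.toClosedBelow
  sub := h.sub
  reach := hV
  openPath r hr := by omega
  align r hr := by omega
  path r hr := by omega
  le_bot r i hr := by omega
  lt_bot := h.lt_bot
  lt_top r i _ hi := h.lt_top r i (Nat.zero_le _) hi
  bot_le r _ := h.bot_le r (Nat.zero_le _)

/-- All edges read in the run end at the first pending vertex, which is already in `D`. Their states
are therefore irrelevant and need not be revealed; only the `z` bottom vertices left behind have to
be added to `D`. -/
theorem CascInv.run {q c y z : ℕ} {F : ℕ →₀ ℕ} {V D : Finset (ℕ × ℕ)}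
    (h : CascInv b o (q + 1) (c + 1) y F V D) (hz : RunAt b q (F q) z) :
    CascInv b o (q + 1) c (y + z) (F.update q (F q + z + 1)) V
      (D ∪ (Finset.range z).image fun i => (q, botIdx b q (F q) + i)) := by
  have hF : ∀ r, r ≠ q → F.update q (F q + z + 1) r = F r := fun r hr => by
    rw [Finsupp.coe_update, Function.update_of_ne hr]
  have hFq : F.update q (F q + z + 1) q = F q + z + 1 := by simp
  have hbot : botIdx b q (F.update q (F q + z + 1) q) = botIdx b q (F q) + z := by
    rw [hFq, hz.botIdx_end]
  have htop : topIdx b q (F.update q (F q + z + 1) q) = topIdx b q (F q) + 1 := by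
    rw [hFq, hz.topIdx_end]
  have hmem : ∀ r i, (r, i) ∈ D ∪ (Finset.range z).image (fun i => (q, botIdx b q (F q) + i)) ↔
      (r, i) ∈ D ∨ r = q ∧ botIdx b q (F q) ≤ i ∧ i < botIdx b q (F q) + z := fun r i => by
    simp only [Finset.mem_union, Finset.mem_image, Finset.mem_range, Prod.mk.injEq]
    refine or_congr_right ⟨?_, ?_⟩
    · rintro ⟨a, ha, rfl, rfl⟩
      exact ⟨rfl, by omega, by omega⟩
    · rintro ⟨rfl, h1, h2⟩
      exact ⟨i - botIdx b r (F r), by omega, rfl, by omega⟩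
  refine
    { root := Finset.mem_union_left _ h.root
      closed := ?_, sub := h.sub.trans Finset.subset_union_left, openPath := ?_, align := ?_,
      align_last := ?_, path := ?_, path_last := ?_, le_bot := ?_, lt_bot_last := ?_,
      lt_bot := ?_, pending := ?_, pending_mem := ?_, skipped_mem := ?_, lt_top := ?_,
      bot_le := ?_ }
  · intro r k hk ho hor
    rw [hmem]
    left
    by_cases hr : r = q
    · subst hr
      rw [hFq] at hk
      rcases lt_or_ge k (F r) with hlt | hge
      · refine h.closed r k hlt ho ?_
        have hle := botIdx_mono (b := b) (r := r) hlt.le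
        rw [hmem, hbot] at hor
        rcases hor with (hor | ⟨-, h1, -⟩) | hor
        · exact .inl hor
        · exact .inr (by omega)
        · exact .inr (by omega)
      · obtain ⟨j, rfl⟩ := Nat.exists_eq_add_of_le hge
        rw [hz.topIdx_add (by omega)]
        exact h.pending_mem r _ rfl le_rfl (by omega)
    · rw [hF r hr] at hk hor
      refine h.closed r k hk ho ?_
      rw [hmem] at hor
      rcases hor with (hor | ⟨h1, -⟩) | hor
      · exact .inl hor
      · exact absurd h1 hr
      · exact .inr hor
  · intro r hr
    rw [hF r (by omega)]
    exact h.openPath r hr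
  · intro r hr
    rw [hF r (by omega), hF (r + 1) (by omega)]
    exact h.align r hr
  · intro r hr
    obtain rfl : r + 1 = q := by omega
    rw [hF r (by omega), hbot, h.align_last r hr]
    ring
  · intro r hr
    rw [hF r (by omega)]
    exact h.path r hr
  · intro r hr hy
    obtain rfl : r = q := by omega
    rw [hbot, show z = 0 by omega, add_zero]
    exact h.path_last r rfl (by omega)
  · intro r i hr hi
    rw [hmem] at hi
    by_cases hrq : r = q
    · subst hrq
      rw [hbot]
      rcases hi with hi | hi
      · have := h.le_bot r i hr hi
        omega
      · omega
    · rw [hF r hrq]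
      exact h.le_bot r i hr (hi.resolve_right fun h => hrq h.1)
  · intro r i hr hy hi
    obtain rfl : r = q := by omega
    rw [hmem] at hi
    rw [hbot]
    rcases hi with hi | hi
    · have h1 := h.le_bot r i (by omega) hi
      rcases y.eq_zero_or_pos with rfl | hy'
      · omega
      · have := h.lt_bot_last r i rfl hy' hi
        omega
    · omega
  · intro r i hr hi
    rw [hmem] at hi
    rw [hF r (by omega)]
    exact h.lt_bot r i hr (hi.resolve_right fun h => by omega)
  · intro r hr
    obtain rfl : r = q := by omega
    rw [hF (r + 1) (by omega), htop, h.pending r rfl]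
    ring
  · intro r i hr h1 h2
    obtain rfl : r = q := by omega
    rw [htop] at h1 h2
    rw [hmem]
    exact .inl (h.pending_mem r i rfl (by omega) (by omega))
  · intro r i hr h1 h2
    obtain rfl : r = q := by omega
    rw [hbot] at h1 h2
    rw [hmem]
    rcases lt_or_ge i (botIdx b r (F r)) with hlt | hge
    · exact .inl (h.skipped_mem r i rfl (by omega) hlt)
    · exact .inr ⟨rfl, hge, h2⟩
  · intro r i hr hi
    rw [hmem] at hi
    rw [hF r (by omega)]
    exact h.lt_top r i hr (hi.resolve_right fun h => by omega)
  · intro r hr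
    rw [hF r (by omega), hF (r + 1) (by omega)]
    exact h.bot_le r hr

theorem CascInv.exploreInv {R c y H n : ℕ} {F F' : ℕ →₀ ℕ} {V D : Finset (ℕ × ℕ)}
    (hc : Casc b R c y F F' H n) (h : CascInv b o R c y F V D)
    (hV : ∀ v ∈ V, v ∈ bitCluster b o) :
    ∃ D', ExploreInv b o H F' V D' ∧ D'.card ≤ D.card + n := by
  induction hc generalizing D with
  | dead => exact ⟨D, h.dead hV, le_rfl⟩
  | finish => exact ⟨D, h.finish hV, le_rfl⟩
  | down hy _ ih => exact ih (h.down hy)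
  | @run q c y z _ n F _ hz _ ih =>
    obtain ⟨D', h1, h2⟩ := ih (h.run hz)
    refine ⟨D', h1, h2.trans ?_⟩
    have := Finset.card_union_le D ((Finset.range z).image fun i => (q, botIdx b q (F q) + i))
    have h3 : ((Finset.range z).image fun i => (q, botIdx b q (F q) + i)).card ≤ z :=
      Finset.card_image_le.trans (by simp)
    omega

/-- The last edge of the current vertex is closed, so the vertex is abandoned. It is the only
pending vertex, which explains the initial values `1` and `0`. -/
theorem ExploreInv.casc {h : ℕ} {F : ℕ →₀ ℕ} {V D : Finset (ℕ × ℕ)}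
    (hi : ExploreInv b o (h + 1) F V D) (ho : o (h, F h) = false) (hb : b (h, F h) = false) :
    CascInv b o h 1 0 (F.update h (F h + 1)) V D := by
  have hF : ∀ r, r ≠ h → F.update h (F h + 1) r = F r := fun r hr => by
    rw [Finsupp.coe_update, Function.update_of_ne hr]
  have hFh : F.update h (F h + 1) h = F h + 1 := by simp
  have hbot : botIdx b h (F.update h (F h + 1) h) = botIdx b h (F h) + 1 := by
    rw [hFh, botIdx_succ_false hb]
  have htop : topIdx b h (F.update h (F h + 1) h) = topIdx b h (F h) := by
    rw [hFh, topIdx_succ_false hb]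
  refine
    { root := hi.root
      closed := ?_, sub := hi.sub, openPath := ?_, align := ?_,
      align_last := ?_, path := ?_, path_last := ?_, le_bot := ?_, lt_bot_last := ?_,
      lt_bot := ?_, pending := ?_, pending_mem := ?_, skipped_mem := ?_, lt_top := ?_,
      bot_le := ?_ }
  · intro r k hk hok hor
    by_cases hr : r = h
    · subst hr
      rw [hFh] at hk
      rcases (Nat.lt_succ_iff.1 hk).eq_or_lt with rfl | hlt
      · simp [ho] at hok
      · have := botIdx_mono (b := b) (r := r) hlt.le
        exact hi.closed r k hlt hok (.inl (hor.resolve_right (by omega)))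
    · rw [hF r hr] at hk hor
      exact hi.closed r k hk hok hor
  · intro r hr
    rw [hF r (by omega)]
    exact hi.openPath r (by omega)
  · intro r hr
    rw [hF r (by omega), hF (r + 1) (by omega)]
    exact hi.align r (by omega)
  · intro r hr
    rw [hF r (by omega), hF (r + 1) (by omega)]
    exact hi.align r (by omega)
  · intro r hr
    rw [hF r (by omega)]
    exact hi.path r (by omega)
  · intro r hr _
    rw [hF r (by omega)]
    exact hi.path r (by omega)
  · intro r i hr
    rw [hF r (by omega)]
    exact hi.le_bot r i (by omega)
  · intro r i _ h0
    omega
  · intro r i hr hm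
    by_cases hrh : r = h
    · subst hrh
      rw [hbot]
      exact Nat.lt_succ_of_le (hi.le_bot r i (by omega) hm)
    · rw [hF r hrh]
      exact hi.lt_bot r i (by omega) hm
  · intro r hr
    subst hr
    rw [hbot, hF r (by omega), hi.align r (by omega)]
  · intro r i hr h1 h2
    subst hr
    rw [hF r (by omega), ← hi.align r (by omega)] at h1 h2
    obtain rfl : i = botIdx b (r + 1) (F (r + 1)) := by omega
    exact hi.sub (hi.path (r + 1) (by omega))
  · intro r i _ h1 h2
    omega
  · intro r i hr hm
    by_cases hrh : r = h
    · subst hrh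
      rw [htop]
      exact hi.lt_top r i (by omega) hm
    · rw [hF r hrh]
      exact hi.lt_top r i (by omega) hm
  · intro r hr
    rw [hF (r + 1) (by omega)]
    by_cases hrh : r = h
    · subst hrh
      rw [htop]
      exact hi.bot_le r (by omega)
    · rw [hF r hrh]
      exact hi.bot_le r (by omega)

theorem ExploreInv.right {h : ℕ} {F : ℕ →₀ ℕ} {V D : Finset (ℕ × ℕ)}
    (hi : ExploreInv b o (h + 1) F V D) (ho : o (h, F h) = false) (hb : b (h, F h) = true) :
    ExploreInv b o (h + 1) (F.update h (F h + 1)) V D := by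
  have hF : ∀ r, r ≠ h → F.update h (F h + 1) r = F r := fun r hr => by
    rw [Finsupp.coe_update, Function.update_of_ne hr]
  have hFh : F.update h (F h + 1) h = F h + 1 := by simp
  have hbot : ∀ r, botIdx b r (F.update h (F h + 1) r) = botIdx b r (F r) := fun r => by
    by_cases hr : r = h
    · subst hr
      rw [hFh, botIdx_succ_true hb]
    · rw [hF r hr]
  have htop : topIdx b h (F.update h (F h + 1) h) = topIdx b h (F h) + 1 := by
    rw [hFh, topIdx_succ_true hb]
  refine
    { root := hi.root
      closed := ?_, sub := hi.sub, reach := hi.reach, openPath := ?_, align := ?_,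
      path := ?_, le_bot := ?_, lt_bot := ?_, lt_top := ?_, bot_le := ?_ }
  · intro r k hk hok hor
    rw [hbot] at hor
    by_cases hr : r = h
    · subst hr
      rw [hFh] at hk
      rcases (Nat.lt_succ_iff.1 hk).eq_or_lt with rfl | hlt
      · simp [ho] at hok
      · exact hi.closed r k hlt hok hor
    · rw [hF r hr] at hk
      exact hi.closed r k hk hok hor
  · intro r hr
    rw [hF r (by omega)]
    exact hi.openPath r hr
  · intro r hr
    rw [hbot, hF r (by omega)]
    exact hi.align r hr
  · intro r hr
    rw [hbot]
    exact hi.path r hr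
  · intro r i hr hm
    rw [hbot]
    exact hi.le_bot r i hr hm
  · intro r i hr hm
    rw [hbot]
    exact hi.lt_bot r i hr hm
  · intro r i hr hm
    have := hi.lt_top r i hr hm
    by_cases hrh : r = h
    · subst hrh
      omega
    · rwa [hF r hrh]
  · intro r hr
    have := hi.bot_le r hr
    rw [hbot]
    by_cases hrh : r = h
    · subst hrh
      omega
    · rwa [hF r hrh]

/-- By `lt_top` the new vertex lies on the right of `D` in its generation. The edges passed while
moving the cursor to it start between `D` and the new vertex, by `lt_bot`, so they impose nothing on
`D`. -/
theorem ExploreInv.up {h k : ℕ} {F : ℕ →₀ ℕ} {V D : Finset (ℕ × ℕ)}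
    (hi : ExploreInv b o (h + 1) F V D) (ho : o (h, F h) = true) (hk : F (h + 1) ≤ k)
    (hb : botIdx b (h + 1) k = topIdx b h (F h))
    (hmin : ∀ i, F (h + 1) ≤ i → i < k → botIdx b (h + 1) i < topIdx b h (F h)) :
    ExploreInv b o (h + 2) (F.update (h + 1) k) (insert (h + 1, topIdx b h (F h)) V)
      (insert (h + 1, topIdx b h (F h)) D) := by
  have hF : ∀ r, r ≠ h + 1 → F.update (h + 1) k r = F r := fun r hr => by
    rw [Finsupp.coe_update, Function.update_of_ne hr]
  have hFh : F.update (h + 1) k (h + 1) = k := by simp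
  refine
    { root := Finset.mem_insert_of_mem hi.root
      closed := ?_, sub := Finset.insert_subset_insert _ hi.sub, reach := ?_, openPath := ?_,
      align := ?_, path := ?_, le_bot := ?_, lt_bot := ?_, lt_top := ?_, bot_le := ?_ }
  · intro r j hj hoj hor
    refine Finset.mem_insert_of_mem ?_
    by_cases hr : r = h + 1
    · subst hr
      rw [hFh] at hj hor
      rcases lt_or_ge j (F (h + 1)) with hlt | hge
      · refine hi.closed _ j hlt hoj ?_
        have h1 := botIdx_mono (b := b) (r := h + 1) hlt.le
        have h2 := botIdx_mono (b := b) (r := h + 1) hk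
        rw [hb] at hor h2
        rcases hor with hor | hor
        · rcases Finset.mem_insert.1 hor with hor | hor
          · have := (Prod.mk.inj hor).2
            exact .inr (by omega)
          · exact .inl hor
        · exact .inr (by omega)
      · exfalso
        have h1 := hmin j hge hj
        have h2 := botIdx_mono (b := b) (r := h + 1) hge
        rcases hor with hor | hor
        · rcases Finset.mem_insert.1 hor with hor | hor
          · have := (Prod.mk.inj hor).2
            omega
          · have := hi.lt_bot _ _ le_rfl hor
            omega
        · omega
    · rw [hF r hr] at hj hor
      refine hi.closed r j hj hoj (hor.imp_left fun h => ?_)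
      exact (Finset.mem_insert.1 h).resolve_left fun h => hr (Prod.mk.inj h).1
  · intro v hv
    rcases Finset.mem_insert.1 hv with rfl | hv
    · exact (hi.reach _ (hi.path h (by omega))).tail ⟨F h, rfl, rfl, ho⟩
    · exact hi.reach v hv
  · intro r hr
    rw [hF r (by omega)]
    rcases (show r ≤ h by omega).eq_or_lt with rfl | hr
    · exact ho
    · exact hi.openPath r (by omega)
  · intro r hr
    rw [hF r (by omega)]
    by_cases hrh : r = h
    · subst hrh
      rw [hFh, hb]
    · rw [hF _ (by omega)]
      exact hi.align r (by omega)
  · intro r hr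
    by_cases hrh : r = h + 1
    · subst hrh
      rw [hFh, hb]
      exact Finset.mem_insert_self _ _
    · rw [hF r hrh]
      exact Finset.mem_insert_of_mem (hi.path r (by omega))
  · intro r i hr hm
    by_cases hrh : r = h + 1
    · subst hrh
      rw [hFh, hb]
      rcases Finset.mem_insert.1 hm with hm | hm
      · exact (Prod.mk.inj hm).2.le
      · exact (hi.lt_top h i le_rfl hm).le
    · rw [hF r hrh]
      refine hi.le_bot r i (by omega) ?_
      exact (Finset.mem_insert.1 hm).resolve_left fun h => hrh (Prod.mk.inj h).1
  · intro r i hr hm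
    rw [hF r (by omega)]
    refine hi.lt_bot r i (by omega) ?_
    exact (Finset.mem_insert.1 hm).resolve_left fun h => by have := (Prod.mk.inj h).1; omega
  · intro r i hr hm
    have hm' : (r + 1, i) ∈ D :=
      (Finset.mem_insert.1 hm).resolve_left fun h => by have := (Prod.mk.inj h).1; omega
    have := hi.lt_top r i (by omega) hm'
    by_cases hrh : r = h + 1
    · subst hrh
      rw [hFh]
      exact this.trans_le (topIdx_mono hk)
    · rwa [hF r hrh]
  · intro r hr
    have := hi.bot_le r (by omega)
    rw [hF (r + 1) (by omega)]
    by_cases hrh : r = h + 1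
    · subst hrh
      rw [hFh]
      exact this.trans (topIdx_mono hk)
    · rwa [hF r hrh]

theorem exploreInv_zero : ExploreInv b o 1 0 {(0, 0)} {(0, 0)} where
  root := Finset.mem_singleton_self _
  closed r k hk := by simp at hk
  sub := subset_rfl
  reach v hv := by
    rw [Finset.mem_singleton.1 hv]
    exact Relation.ReflTransGen.refl
  openPath r hr := by omega
  align r hr := by omega
  path r hr := by
    obtain rfl : r = 0 := by omega
    simp [botIdx]
  le_bot r i hr hm := by simp_all
  lt_bot r i hr hm := by simp at hm; omega
  lt_top r i hr hm := by simp at hm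
  bot_le r hr := by simp [botIdx]

theorem Run.exploreInv {l : List ℕ} {H n : ℕ} {F : ℕ →₀ ℕ} (h : Run b o l H F n) :
    ∃ V D, ExploreInv b o H F V D ∧ V.card = l.count 0 + 1 ∧ D.card ≤ l.count 0 + 1 + n := by
  induction h with
  | nil => exact ⟨{(0, 0)}, {(0, 0)}, exploreInv_zero, rfl, le_rfl⟩
  | cons hr hs ih =>
    obtain ⟨V, D, hi, hV, hD⟩ := ih
    cases hs with
    | @up h k F ho hk hb hmin =>
      refine ⟨_, _, hi.up ho hk hb hmin, ?_, ?_⟩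
      · rw [Finset.card_insert_of_notMem, hV, List.count_cons_self]
        intro hmem
        -- A vertex reached upwards is strictly on the right of all earlier ones of its generation,
        -- so it is new.
        exact lt_irrefl _ (hi.lt_top _ _ le_rfl (hi.sub hmem))
      · rw [List.count_cons_self]
        refine (Finset.card_insert_le _ _).trans ?_
        omega
    | right ho hb =>
      refine ⟨V, D, hi.right ho hb, ?_, ?_⟩
      · simpa using hV
      · simpa using hD
    | @down h H n F F' ho hb hc =>
      obtain ⟨D', h1, h2⟩ := (hi.casc ho hb).exploreInv hc hi.reach
      have := hc.height_le
      refine ⟨V, D', h1, ?_, ?_⟩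
      · rw [List.count_cons_of_ne (by omega), hV]
      · rw [List.count_cons_of_ne (by omega)]
        omega

/-- The exploration visits different vertices of the cluster. -/
theorem Run.le_encard {l : List ℕ} {H n : ℕ} {F : ℕ →₀ ℕ} (h : Run b o l H F n) :
    ((l.count 0 + 1 : ℕ) : ℕ∞) ≤ (bitCluster b o).encard := by
  obtain ⟨V, D, hi, hV, -⟩ := h.exploreInv
  rw [← hV, ← Set.encard_coe_eq_coe_finsetCard]
  exact Set.encard_le_encard hi.reach

/-- When the exploration is over, each vertex of the cluster was visited or skipped. -/
theorem Run.encard_le {l : List ℕ} {n : ℕ} {F : ℕ →₀ ℕ} (h : Run b o l 0 F n) :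
    (bitCluster b o).encard ≤ ((l.count 0 + 1 + n : ℕ) : ℕ∞) := by
  obtain ⟨V, D, hi, -, hD⟩ := h.exploreInv
  -- At height `0` every vertex of `D` is on the left of the cursor of its layer, so all its edges
  -- are covered by `closed`, and `D` is closed under open edges.
  have hsub : bitCluster b o ⊆ D := by
    intro v hv
    induction hv with
    | refl => exact hi.root
    | @tail u w _ he ih =>
      obtain ⟨k, hk, rfl, ho⟩ := he
      have h1 : (u.1, u.2) ∈ D := ih
      have h2 := hi.lt_bot u.1 u.2 (Nat.zero_le _) h1
      refine hi.closed _ k ?_ ho (.inl (hk ▸ h1))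
      by_contra! hle
      have := botIdx_mono (b := b) (r := u.1) hle
      omega
  calc (bitCluster b o).encard ≤ (D : Set (ℕ × ℕ)).encard := Set.encard_le_encard hsub
    _ = (D.card : ℕ∞) := Set.encard_coe_eq_coe_finsetCard D
    _ ≤ _ := by exact_mod_cast hD

end Exploration

/-! ### Survival probabilities of the cascades and the law of the jumps -/

section Param

variable {α : I} (hα : 1 / 2 < (α : ℝ)) (hα' : (α : ℝ) < 1)
include hα hα'

theorem one_lt_offspringMean : 1 < offspringMean α := by
  rw [offspringMean, lt_div_iff₀ (by linarith)]
  linarith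

omit hα in
theorem one_sub_mul_offspringMean_add_one : (1 - (α : ℝ)) * (offspringMean α + 1) = 1 := by
  have : 1 - (α : ℝ) ≠ 0 := by linarith
  rw [offspringMean]
  field_simp
  ring

end Param

/-- The probability that a cascade of the exploration does not finish within `j` layers. -/
noncomputable def contProb (α : I) (j : ℕ) : ℝ :=
  (offspringMean α - 1) / (offspringMean α ^ (j + 1) - 1)

section Param

variable {α : I} (hα : 1 / 2 < (α : ℝ)) (hα' : (α : ℝ) < 1)
include hα hα'

theorem contProb_zero : contProb α 0 = 1 := by
  have := one_lt_offspringMean hα hα'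
  rw [contProb, zero_add, pow_one, div_self (by linarith)]

theorem pow_sub_one_pos (j : ℕ) : 0 < offspringMean α ^ (j + 1) - 1 :=
  sub_pos.2 (one_lt_pow₀ (one_lt_offspringMean hα hα') (by omega))

theorem contProb_pos (j : ℕ) : 0 < contProb α j :=
  div_pos (sub_pos.2 (one_lt_offspringMean hα hα')) (pow_sub_one_pos hα hα' j)

theorem contProb_le (j : ℕ) : contProb α j ≤ (offspringMean α)⁻¹ ^ j := by
  have hm := one_lt_offspringMean hα hα'
  rw [contProb, div_le_iff₀ (pow_sub_one_pos hα hα' j), inv_pow, ← div_eq_inv_mul,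
    le_div_iff₀ (by positivity), pow_succ]
  nlinarith [one_le_pow₀ (n := j) hm.le]

theorem contProb_succ_le (j : ℕ) : contProb α (j + 1) ≤ contProb α j := by
  have hm := one_lt_offspringMean hα hα'
  exact div_le_div_of_nonneg_left (by linarith) (pow_sub_one_pos hα hα' j)
    (sub_le_sub_right (pow_le_pow_right₀ hm.le (by omega)) _)

theorem contProb_le_one (j : ℕ) : contProb α j ≤ 1 := by
  induction j with
  | zero => exact (contProb_zero hα hα').le
  | succ j ih => exact (contProb_succ_le hα hα' j).trans ih

/-- This is the recursion of the extinction probabilities of a branching process with offspring law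
`α * (1 - α) ^ z`, whose generating function `α / (1 - (1 - α) * x)` is linear fractional, so that
it can be solved explicitly. -/
theorem contProb_succ (j : ℕ) :
    (1 - contProb α (j + 1)) * (1 - (1 - α) * (1 - contProb α j)) = α := by
  have hm := one_lt_offspringMean hα hα'
  have h1 := pow_sub_one_pos hα hα' j
  have h2 := pow_sub_one_pos hα hα' (j + 1)
  have h3 : (1 - (α : ℝ)) = 1 / (offspringMean α + 1) := by
    rw [eq_div_iff (by linarith), one_sub_mul_offspringMean_add_one hα']
  have h4 : (α : ℝ) = offspringMean α / (offspringMean α + 1) := by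
    rw [eq_div_iff (by linarith)]
    linarith [one_sub_mul_offspringMean_add_one hα']
  rw [h3, h4, contProb, contProb]
  generalize offspringMean α = m at *
  have : m + 1 ≠ 0 := by linarith
  field_simp
  ring

theorem summable_pow_mul_contProb (k : ℕ) : Summable fun j : ℕ => (j : ℝ) ^ k * contProb α j := by
  have hm := one_lt_offspringMean hα hα'
  refine Summable.of_nonneg_of_le
    (fun j => mul_nonneg (by positivity) (contProb_pos hα hα' j).le)
    (fun j => mul_le_mul_of_nonneg_left (contProb_le hα hα' j) (by positivity)) ?_
  apply summable_pow_mul_geometric_of_norm_lt_one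
  rw [norm_inv, Real.norm_of_nonneg (by linarith)]
  exact inv_lt_one_of_one_lt₀ hm

theorem hasSum_contProb_sub : HasSum (fun j => contProb α j - contProb α (j + 1)) 1 := by
  have hs := summable_pow_mul_contProb hα hα' 0
  simp only [pow_zero, one_mul] at hs
  rw [hasSum_iff_tendsto_nat_of_nonneg fun j => sub_nonneg.2 (contProb_succ_le hα hα' j)]
  have := (tendsto_const_nhds (x := (1 : ℝ))).sub hs.tendsto_atTop_zero
  rw [sub_zero] at this
  refine this.congr fun n => ?_
  rw [Finset.sum_range_sub' (contProb α), contProb_zero hα hα']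

/-- Abel summation: the partial sum up to `n` is that of `contProb` minus `n * contProb α n`, which
tends to `0`. -/
theorem hasSum_mul_contProb_sub :
    HasSum (fun j : ℕ => ((j : ℝ) + 1) * (contProb α j - contProb α (j + 1)))
      (∑' j, contProb α j) := by
  have hs := summable_pow_mul_contProb hα hα' 0
  have hs1 := summable_pow_mul_contProb hα hα' 1
  simp only [pow_zero, one_mul] at hs
  simp only [pow_one] at hs1
  rw [hasSum_iff_tendsto_nat_of_nonneg fun j =>
    mul_nonneg (by positivity) (sub_nonneg.2 (contProb_succ_le hα hα' j))]
  have := hs.hasSum.tendsto_sum_nat.sub hs1.tendsto_atTop_zero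
  rw [sub_zero] at this
  refine this.congr fun n => ?_
  induction n with
  | zero => simp
  | succ n ih =>
    rw [Finset.sum_range_succ, Finset.sum_range_succ, ← ih]
    push_cast
    ring

end Param

/-- The law of the downward jumps of the exploration. -/
noncomputable def jumpWeight (α p : I) : ℕ → ℝ
  | 0 => p
  | 1 => (1 - p) * α
  | j + 2 => (1 - p) * ((1 - α) * (contProb α j - contProb α (j + 1)))

/-- The law of the downward jumps of the exploration. -/
noncomputable def jumpLaw (α p : I) : Measure ℕ :=
  Measure.sum fun j => ENNReal.ofReal (jumpWeight α p j) • Measure.dirac j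

theorem jumpLaw_singleton (α p : I) (j : ℕ) :
    jumpLaw α p {j} = ENNReal.ofReal (jumpWeight α p j) := by
  rw [jumpLaw, Measure.sum_apply _ (.singleton j), tsum_eq_single j]
  · simp
  · intro k hk
    simp [hk]

section Param

variable {α : I} (hα : 1 / 2 < (α : ℝ)) (hα' : (α : ℝ) < 1) (p : I)
include hα hα'

theorem jumpWeight_nonneg (j : ℕ) : 0 ≤ jumpWeight α p j := by
  have h1 : 0 ≤ 1 - (p : ℝ) := sub_nonneg.2 p.2.2
  match j with
  | 0 => exact p.2.1
  | 1 => exact mul_nonneg h1 α.2.1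
  | j + 2 =>
    exact mul_nonneg h1 (mul_nonneg (by linarith) (sub_nonneg.2 (contProb_succ_le hα hα' j)))

omit hα hα' in
-- Splits off the two jumps that involve no cascade, so that mass, drift and second moment all
-- reduce to sums over the depth of the cascade.
theorem hasSum_jumpWeight_mul {f : ℕ → ℝ} {a : ℝ}
    (h : HasSum (fun j => f (j + 2) * (contProb α j - contProb α (j + 1))) a) :
    HasSum (fun j => jumpWeight α p j * f j)
      ((1 - p) * ((1 - α) * a) + (p * f 0 + (1 - p) * α * f 1)) := by
  have h2 := (h.mul_left (1 - (α : ℝ))).mul_left (1 - (p : ℝ))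
  have := (hasSum_nat_add_iff (f := fun j => jumpWeight α p j * f j) 2
    (g := (1 - p) * ((1 - α) * a))).1 (by
      convert! h2 using 2 with j
      rw [show jumpWeight α p (j + 2) =
        (1 - p) * ((1 - α) * (contProb α j - contProb α (j + 1))) from rfl]
      ring)
  simpa only [Finset.sum_range_succ, Finset.sum_range_zero, zero_add, jumpWeight] using this

theorem isProbabilityMeasure_jumpLaw : IsProbabilityMeasure (jumpLaw α p) := by
  have h := hasSum_jumpWeight_mul p (f := fun _ => 1)
    (by simpa using hasSum_contProb_sub hα hα')
  simp only [mul_one] at h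
  constructor
  rw [jumpLaw, Measure.sum_apply _ .univ]
  simp only [Measure.smul_apply, measure_univ, smul_eq_mul, mul_one]
  rw [← ENNReal.ofReal_tsum_of_nonneg (jumpWeight_nonneg hα hα' p) h.summable, h.tsum_eq,
    ENNReal.ofReal_eq_one]
  ring

theorem jumpLaw_real_zero : (jumpLaw α p).real {0} = p := by
  rw [measureReal_def, jumpLaw_singleton, ENNReal.toReal_ofReal (jumpWeight_nonneg hα hα' p 0)]
  rfl

theorem hasSum_integral_jumpLaw {f : ℕ → ℝ} (hf : Summable fun j => jumpWeight α p j * ‖f j‖) :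
    Integrable f (jumpLaw α p) ∧ ∫ j, f j ∂jumpLaw α p = ∑' j, jumpWeight α p j * f j := by
  have hw : ∀ j, (ENNReal.ofReal (jumpWeight α p j)).toReal = jumpWeight α p j := fun j =>
    ENNReal.toReal_ofReal (jumpWeight_nonneg hα hα' p j)
  have hs : Summable fun j => (ENNReal.ofReal (jumpWeight α p j)).toReal * ‖f j‖ := by
    simpa only [hw] using hf
  refine ⟨integrable_sum_dirac (x := id) (fun _ => ENNReal.ofReal_ne_top) hs, ?_⟩
  rw [jumpLaw, integral_sum_dirac_eq_tsum (fun _ => ENNReal.ofReal_ne_top) hs]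
  simp only [hw, smul_eq_mul]

theorem hasSum_sq_mul_contProb_sub :
    HasSum (fun j : ℕ => (1 - ((j + 2 : ℕ) : ℝ)) ^ 2 * (contProb α j - contProb α (j + 1)))
      (∑' j : ℕ, (1 - ((j + 2 : ℕ) : ℝ)) ^ 2 * (contProb α j - contProb α (j + 1))) := by
  refine Summable.hasSum ?_
  have h0 := summable_pow_mul_contProb hα hα' 0
  have h1 := summable_pow_mul_contProb hα hα' 1
  have h2 := summable_pow_mul_contProb hα hα' 2
  refine Summable.of_nonneg_of_le
    (fun j => mul_nonneg (sq_nonneg _) (sub_nonneg.2 (contProb_succ_le hα hα' j)))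
    (fun j => ?_) ((h2.add (h1.mul_left 2)).add h0)
  have := contProb_pos hα hα' (j + 1)
  calc _ ≤ (1 - ((j + 2 : ℕ) : ℝ)) ^ 2 * contProb α j := by gcongr; linarith
    _ = _ := by push_cast; ring

theorem integrable_jumpLaw_sq : Integrable (fun j : ℕ => (1 - (j : ℝ)) ^ 2) (jumpLaw α p) := by
  refine (hasSum_integral_jumpLaw hα hα' p ?_).1
  simp only [norm_pow, Real.norm_eq_abs, sq_abs]
  exact (hasSum_jumpWeight_mul p (f := fun j : ℕ => (1 - (j : ℝ)) ^ 2) (hasSum_sq_mul_contProb_sub hα hα')).summable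

end Param

/-- A bound for the second moment of the jumps, uniform in `p`. -/
noncomputable def stepSqBound (α : I) : ℝ :=
  1 + ∑' j : ℕ, (1 - ((j + 2 : ℕ) : ℝ)) ^ 2 * (contProb α j - contProb α (j + 1))

section Param

variable {α : I} (hα : 1 / 2 < (α : ℝ)) (hα' : (α : ℝ) < 1) (p : I)
include hα hα'

theorem stepSq_jumpLaw_le : stepSq (jumpLaw α p) ≤ stepSqBound α := by
  have hS := hasSum_jumpWeight_mul p (f := fun j : ℕ => (1 - (j : ℝ)) ^ 2)
    (hasSum_sq_mul_contProb_sub hα hα')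
  have h := hasSum_integral_jumpLaw hα hα' p (f := fun j : ℕ => (1 - (j : ℝ)) ^ 2) (by
    simp only [norm_pow, Real.norm_eq_abs, sq_abs]
    exact hS.summable)
  rw [stepSq, h.2, hS.tsum_eq, stepSqBound]
  set a := ∑' j : ℕ, (1 - ((j + 2 : ℕ) : ℝ)) ^ 2 * (contProb α j - contProb α (j + 1))
  have ha : 0 ≤ a := tsum_nonneg fun j =>
    mul_nonneg (sq_nonneg _) (sub_nonneg.2 (contProb_succ_le hα hα' j))
  have hp := p.2.1
  have hp' := p.2.2
  have : (1 - (p : ℝ)) * ((1 - α) * a) ≤ a := by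
    rw [← mul_assoc]
    refine mul_le_of_le_one_left ha (mul_le_one₀ (by linarith) (by linarith) (by linarith))
  simp
  linarith

theorem stepSqBound_pos : 0 < stepSqBound α := by
  have : 0 ≤ ∑' j : ℕ, (1 - ((j + 2 : ℕ) : ℝ)) ^ 2 * (contProb α j - contProb α (j + 1)) :=
    tsum_nonneg fun j => mul_nonneg (sq_nonneg _) (sub_nonneg.2 (contProb_succ_le hα hα' j))
  rw [stepSqBound]
  linarith

/-- A jump `j + 2` contributes `-(j + 1)`, so the drift is `p - (1 - p) * (1 - α) * ∑ contProb`.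
Here `(1 - α) * ∑ contProb` is `criticalOdds α`, because `1 - α = 1 / (m + 1)`; this is where the
value of `p_c` comes from. -/
theorem drift_jumpLaw :
    drift (jumpLaw α p) = (1 + criticalOdds α) * ((p : ℝ) - criticalParam α) := by
  have hS := hasSum_jumpWeight_mul p (f := fun j : ℕ => 1 - (j : ℝ))
    (a := -∑' j, contProb α j) (by
      convert! (hasSum_mul_contProb_sub hα hα').neg using 2 with j
      push_cast
      ring)
  have h := hasSum_integral_jumpLaw hα hα' p (f := fun j : ℕ => 1 - (j : ℝ)) (by
    have := hS.summable.norm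
    simpa only [norm_mul, Real.norm_of_nonneg (jumpWeight_nonneg hα hα' p _)] using this)
  rw [drift, h.2, hS.tsum_eq]
  have hη : criticalOdds α = (1 - α) * ∑' j, contProb α j := by
    have : (1 - (α : ℝ)) = 1 / (offspringMean α + 1) := by
      rw [eq_div_iff (by linarith [one_lt_offspringMean hα hα']),
        one_sub_mul_offspringMean_add_one hα']
    rw [criticalOdds, this]
    rfl
  have h0 := criticalOdds_nonneg α
  have hc : (criticalParam α : ℝ) = criticalOdds α / (1 + criticalOdds α) := rfl
  have : (1 + criticalOdds α) * ((p : ℝ) - criticalParam α) =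
      (1 + criticalOdds α) * p - criticalOdds α := by
    rw [hc]
    field_simp
  rw [this]
  have h2 : (1 - (p : ℝ)) * ((1 - α) * -∑' j, contProb α j) = -((1 - (p : ℝ)) * criticalOdds α) := by
    rw [hη]
    ring
  rw [h2]
  simp
  ring

theorem criticalOdds_pos : 0 < criticalOdds α := by
  have hm := one_lt_offspringMean hα hα'
  have hs := summable_pow_mul_contProb hα hα' 0
  simp only [pow_zero, one_mul] at hs
  exact mul_pos (by positivity)
    (hs.tsum_pos (fun j => (contProb_pos hα hα' j).le) 0 (contProb_pos hα hα' 0))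

theorem criticalParam_pos : 0 < (criticalParam α : ℝ) := by
  have := criticalOdds_pos hα hα'
  exact div_pos this (by linarith)

omit hα hα' in
theorem criticalParam_lt_one (α : I) : (criticalParam α : ℝ) < 1 := by
  have := criticalOdds_nonneg α
  exact (div_lt_one (by linarith)).2 (by linarith)

end Param

/-! ### Independent bits -/

/-- Independent coin tosses with success probability `p`. -/
noncomputable def coins {ι : Type*} (p : I) : Measure (ι → Bool) :=
  Measure.infinitePi fun _ => bernoulliMeasure true false p

instance {ι : Type*} (p : I) : IsProbabilityMeasure (coins (ι := ι) p) := by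
  unfold coins
  infer_instance

theorem measurableSet_of_finite_dependsOn {ι : Type*} {J : Set ι} (hJ : J.Finite)
    {A : Set (ι → Bool)} (hA : DependsOn (· ∈ A) J) : MeasurableSet A := by
  have : Finite J := hJ
  have h : A = J.domRestrict ⁻¹' (J.domRestrict '' A) := by
    refine (Set.subset_preimage_image _ _).antisymm ?_
    rintro x ⟨y, hy, hxy⟩
    exact (iff_of_eq (hA fun i hi => congr_fun hxy ⟨i, hi⟩)).1 hy
  have hm : Measurable (J.domRestrict : (ι → Bool) → J → Bool) :=
    measurable_pi_iff.2 fun i => measurable_pi_apply (i : ι)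
  rw [h]
  exact hm (Set.toFinite _).measurableSet

section Coins

variable {ι : Type*} (p : I)

theorem coin_true : (bernoulliMeasure true false p : Measure Bool) {true} = ENNReal.ofReal p := by
  classical
  rw [bernoulliMeasure_apply p (.singleton _)]
  simp [ENNReal.ofReal, Real.toNNReal_of_nonneg p.2.1]
  rfl

theorem coin_false :
    (bernoulliMeasure true false p : Measure Bool) {false} = ENNReal.ofReal (1 - p) := by
  classical
  rw [bernoulliMeasure_apply p (.singleton _)]
  simp [ENNReal.ofReal, Real.toNNReal_of_nonneg (sub_nonneg.2 p.2.2)]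
  rfl

theorem coins_cylinder (s : Finset ι) (v : ι → Bool) :
    coins p {x : ι → Bool | ∀ i ∈ s, x i = v i} =
      ∏ i ∈ s, (bernoulliMeasure true false p : Measure Bool) {v i} :=
  Measure.infinitePi_pi _ (t := fun i => {v i}) fun _ _ => .singleton _

theorem coins_eval (i : ι) (v : Bool) :
    coins p {x : ι → Bool | x i = v} = (bernoulliMeasure true false p : Measure Bool) {v} := by
  have := coins_cylinder p {i} fun _ => v
  simpa using this

end Coins

section GoodBits

variable {α : I} (hα : 0 < (α : ℝ)) (hα' : (α : ℝ) < 1)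
include hα hα'

theorem coin_lt_one (v : Bool) : (bernoulliMeasure true false α : Measure Bool) {v} < 1 := by
  cases v
  · rw [coin_false, ENNReal.ofReal_lt_one]
    linarith
  · rwa [coin_true, ENNReal.ofReal_lt_one]

theorem ae_goodBits : ∀ᵐ b ∂(coins α : Measure (ℕ × ℕ → Bool)), GoodBits b := by
  simp only [GoodBits, ae_all_iff]
  intro r k v
  rw [ae_iff]
  refine le_antisymm (ge_of_tendsto'
    (ENNReal.tendsto_pow_atTop_nhds_zero_of_lt_one (coin_lt_one hα hα' !v)) fun n => ?_) zero_le
  refine (measure_mono (t := {x | ∀ i ∈ (Finset.range n).image fun i => (r, k + i), x i = !v})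
    ?_).trans ?_
  · intro b hb i hi
    obtain ⟨j, -, rfl⟩ := Finset.mem_image.1 hi
    simp only [Set.mem_ofPred_eq, not_exists, not_and] at hb
    exact Bool.eq_not_of_ne (hb (k + j) (by omega))
  · rw [coins_cylinder α _ fun _ => !v, Finset.prod_const, Finset.card_image_of_injective _
      fun i j h => by simpa using h, Finset.card_range]

end GoodBits

/-! ### The depth of a cascade as an extinction time -/

section Cascade

variable {α : I}

theorem dependsOn_runAt (r k z : ℕ) :
    DependsOn (· ∈ {b | RunAt b r k z}) {e | e.1 = r ∧ k ≤ e.2 ∧ e.2 ≤ k + z} := by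
  intro b b' h
  exact propext ⟨fun hr => hr.congr fun i h1 h2 => h (r, i) ⟨rfl, h1, h2⟩,
    fun hr => hr.congr fun i h1 h2 => (h (r, i) ⟨rfl, h1, h2⟩).symm⟩

theorem measurableSet_runAt (r k z : ℕ) : MeasurableSet {b | RunAt b r k z} := by
  refine measurableSet_of_finite_dependsOn (Set.Finite.subset
    ((Set.finite_singleton r).prod (Set.finite_Iic (k + z))) ?_) (dependsOn_runAt r k z)
  rintro ⟨r', i⟩ ⟨h1, -, h2⟩
  exact ⟨h1, h2⟩

theorem coins_runAt (α : I) (r k z : ℕ) :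
    coins α {b | RunAt b r k z} = ENNReal.ofReal α * ENNReal.ofReal (1 - α) ^ z := by
  have h : {b | RunAt b r k z} = {x | ∀ e ∈ (Finset.range (z + 1)).image fun i => (r, k + i),
      x e = decide (e.2 = k + z)} := by
    ext b
    constructor
    · rintro ⟨h1, h2⟩ e he
      obtain ⟨i, hi, rfl⟩ := Finset.mem_image.1 he
      rcases (Nat.lt_succ_iff.1 (Finset.mem_range.1 hi)).eq_or_lt with rfl | hi
      · simpa using h2
      · simpa [hi.ne] using h1 i hi
    · intro h
      have h' : ∀ i ≤ z, b (r, k + i) = decide (k + i = k + z) := fun i hi =>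
        h _ (Finset.mem_image_of_mem _ (Finset.mem_range.2 (by omega)))
      exact ⟨fun i hi => by simpa [hi.ne] using h' i hi.le, by simpa using h' z le_rfl⟩
  rw [h, coins_cylinder α _ fun e : ℕ × ℕ => decide (e.2 = k + z),
    Finset.prod_image (by intro i _ j _ h; simpa using h), Finset.prod_range_succ, mul_comm]
  congr 1
  · simp only [decide_true, coin_true]
  · rw [← Finset.card_range z, ← Finset.prod_const, Finset.card_range]
    refine Finset.prod_congr rfl fun i hi => ?_
    rw [decide_eq_false (by simpa using (Finset.mem_range.1 hi).ne), coin_false]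

theorem finite_below (F : ℕ →₀ ℕ) : {e : ℕ × ℕ | e.2 < F e.1}.Finite := by
  refine Set.Finite.subset ((F.support.sigma fun r => Finset.range (F r)).finite_toSet.image
    fun e : (_ : ℕ) × ℕ => (e.1, e.2)) ?_
  rintro ⟨r, k⟩ h
  refine ⟨⟨r, k⟩, ?_, rfl⟩
  simp only [Set.mem_ofPred_eq] at h
  simp only [Finset.coe_sigma, Set.mem_sigma_iff, Finset.mem_coe, Finsupp.mem_support_iff,
    Finset.mem_range]
  omega

theorem measurableSet_casc (R c y H n : ℕ) (F F' : ℕ →₀ ℕ) :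
    MeasurableSet {b | Casc b R c y F F' H n} :=
  measurableSet_of_finite_dependsOn (finite_below F') fun _ _ h =>
    propext ⟨fun hc => hc.congr_of_lt fun r k hk => h (r, k) hk,
      fun hc => hc.congr_of_lt fun r k hk => (h (r, k) hk).symm⟩

/-- The cascade stops at a height of at least `K`. -/
def cascStop (R c y : ℕ) (F : ℕ →₀ ℕ) (K : ℕ) : Set (ℕ × ℕ → Bool) :=
  {b | ∃ F' H n, K ≤ H ∧ Casc b R c y F F' H n}

theorem measurableSet_cascStop (R c y : ℕ) (F : ℕ →₀ ℕ) (K : ℕ) :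
    MeasurableSet (cascStop R c y F K) := by
  simp only [cascStop, Set.ofPred_exists]
  refine .iUnion fun F' => .iUnion fun H => .iUnion fun n => ?_
  exact (MeasurableSet.const _).inter (measurableSet_casc R c y H n F F')

theorem dependsOn_cascStop (R c y : ℕ) (F : ℕ →₀ ℕ) (K : ℕ) :
    DependsOn (· ∈ cascStop R c y F K) {e | F e.1 ≤ e.2} := by
  intro b b' h
  exact propext ⟨fun ⟨F', H, n, hK, hc⟩ =>
    ⟨F', H, n, hK, hc.congr_of_ge fun r k _ hk => h (r, k) hk⟩, fun ⟨F', H, n, hK, hc⟩ =>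
    ⟨F', H, n, hK, hc.congr_of_ge fun r k _ hk => (h (r, k) hk).symm⟩⟩

theorem cascStop_run (r c y : ℕ) (F : ℕ →₀ ℕ) (K : ℕ) :
    cascStop (r + 1) (c + 1) y F K = ⋃ z, {b | RunAt b r (F r) z} ∩
      cascStop (r + 1) c (y + z) (F.update r (F r + z + 1)) K := by
  ext b
  simp only [cascStop, Set.mem_iUnion, Set.mem_inter_iff, Set.mem_ofPred_eq]
  constructor
  · rintro ⟨F', H, n, hK, hc⟩
    cases hc with
    | run hz hc => exact ⟨_, hz, _, _, _, hK, hc⟩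
  · rintro ⟨z, hz, F', H, n, hK, hc⟩
    exact ⟨_, _, _, hK, .run hz hc⟩

theorem cascStop_down (r y : ℕ) (hy : 0 < y) (F : ℕ →₀ ℕ) (K : ℕ) :
    cascStop (r + 1) 0 y F K = cascStop r y 0 F K := by
  ext b
  constructor
  · rintro ⟨F', H, n, hK, hc⟩
    cases hc with
    | finish => omega
    | down _ hc => exact ⟨_, _, _, hK, hc⟩
  · rintro ⟨F', H, n, hK, hc⟩
    exact ⟨_, _, _, hK, .down hy hc⟩

/-- The updated cursor is just behind the bit that ends the run, so whatever is read afterwards is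
independent of the run. -/
theorem runAt_inter (r z : ℕ) (F : ℕ →₀ ℕ) {A : Set (ℕ × ℕ → Bool)} (hA : MeasurableSet A)
    (hAF : DependsOn (· ∈ A) {e | F.update r (F r + z + 1) e.1 ≤ e.2}) :
    coins α ({b | RunAt b r (F r) z} ∩ A) =
      ENNReal.ofReal α * ENNReal.ofReal (1 - α) ^ z * coins α A := by
  rw [← coins_runAt α r (F r) z]
  refine infinitePi_inter_of_dependsOn (measurableSet_runAt _ _ _) hA (dependsOn_runAt _ _ _)
    (hAF.mono ?_)
  rintro ⟨r', i⟩ h ⟨h1, -, h2⟩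
  simp only at h1 h2
  subst h1
  simp only [Set.mem_ofPred_eq, Finsupp.coe_update, Function.update_self] at h
  omega

theorem coins_cascStop_run (r c y : ℕ) (F : ℕ →₀ ℕ) (K : ℕ) :
    coins α (cascStop (r + 1) (c + 1) y F K) =
      ∑' z, ENNReal.ofReal α * ENNReal.ofReal (1 - α) ^ z *
        coins α (cascStop (r + 1) c (y + z) (F.update r (F r + z + 1)) K) := by
  rw [cascStop_run, measure_iUnion]
  · exact tsum_congr fun z => runAt_inter r z F (measurableSet_cascStop _ _ _ _ _)
      (dependsOn_cascStop _ _ _ _ _)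
  · intro z z' hz
    exact Set.disjoint_left.2 fun b hb hb' => hz (hb.1.unique hb'.1)
  · exact fun z => (measurableSet_runAt _ _ _).inter (measurableSet_cascStop _ _ _ _ _)

variable (hα : 1 / 2 < (α : ℝ)) (hα' : (α : ℝ) < 1)
include hα hα'

theorem tsum_stopProb (j : ℕ) :
    ∑' z, ENNReal.ofReal α * ENNReal.ofReal (1 - α) ^ z * ENNReal.ofReal (1 - contProb α j) ^ z =
      ENNReal.ofReal (1 - contProb α (j + 1)) := by
  have h1 := contProb_le_one hα hα' j
  have h2 := contProb_succ hα hα' j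
  have h4 := contProb_pos hα hα' j
  have h5 : 0 < 1 - (1 - α) * (1 - contProb α j) := by nlinarith
  have h3 : 1 - contProb α (j + 1) = α / (1 - (1 - α) * (1 - contProb α j)) := by
    rw [eq_div_iff h5.ne', h2]
  simp_rw [mul_assoc, ← mul_pow]
  rw [ENNReal.tsum_mul_left, ENNReal.tsum_geometric, ← ENNReal.ofReal_mul (by linarith),
    ← ENNReal.ofReal_one, ← ENNReal.ofReal_sub _ (mul_nonneg (by linarith) (by linarith)),
    ← ENNReal.ofReal_inv_of_pos h5, ← ENNReal.ofReal_mul (by linarith), h3, div_eq_mul_inv]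

/-- Branching property: pending moves and moved bottom vertices start independent branching
processes, the former one generation earlier than the latter. All must be extinct by the prescribed
layer. The cursors do not matter, as the bits behind them are fresh. -/
theorem coins_cascStop {R j : ℕ} (hj : j < R) (c y : ℕ) (F : ℕ →₀ ℕ) :
    coins α (cascStop R c y F (R - j)) =
      ENNReal.ofReal (1 - contProb α (j + 1)) ^ c * ENNReal.ofReal (1 - contProb α j) ^ y := by
  induction R generalizing j c y F with
  | zero => omega
  | succ r ihr =>
    induction c generalizing y F with
    | zero =>
      rcases y.eq_zero_or_pos with rfl | hy
      · have : cascStop (r + 1) 0 0 F (r + 1 - j) = Set.univ :=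
          Set.eq_univ_of_forall fun b => ⟨F, r + 1, 0, by omega, .finish _ _⟩
        simp [this]
      · rw [cascStop_down r y hy]
        cases j with
        | zero =>
          have : cascStop r y 0 F (r + 1 - 0) = ∅ := by
            refine Set.eq_empty_of_forall_notMem ?_
            rintro b ⟨F', H, n, hK, hc⟩
            have := hc.height_le
            omega
          rw [this]
          simp [contProb_zero hα hα', hy.ne']
        | succ j =>
          rw [show r + 1 - (j + 1) = r - j by omega, ihr (by omega)]
          simp
    | succ c ihc =>
      rw [coins_cascStop_run]
      simp_rw [ihc]
      rw [pow_succ, ← tsum_stopProb hα hα' j, mul_assoc, mul_comm (∑' _, _), ← mul_assoc,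
        ← ENNReal.tsum_mul_left]
      exact tsum_congr fun z => by ring

/-- The probability that a cascade stops after exactly `j` layers. -/
theorem coins_casc_eq {R j : ℕ} (hj : j < R) (F : ℕ →₀ ℕ) :
    coins α {b | ∃ F' n, Casc b R 1 0 F F' (R - j) n} =
      ENNReal.ofReal (contProb α j - contProb α (j + 1)) := by
  have key : ∀ j < R, coins α (cascStop R 1 0 F (R - j)) =
      ENNReal.ofReal (1 - contProb α (j + 1)) := fun j hj => by
    simpa using coins_cascStop hα hα' hj 1 0 F
  cases j with
  | zero =>
    rw [contProb_zero hα hα', ← key 0 hj]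
    congr 1
    ext b
    constructor
    · rintro ⟨F', n, hc⟩
      exact ⟨F', _, n, le_rfl, hc⟩
    · rintro ⟨F', H, n, hK, hc⟩
      obtain rfl : H = R - 0 := le_antisymm hc.height_le hK
      exact ⟨F', n, hc⟩
  | succ j =>
    have h : {b | ∃ F' n, Casc b R 1 0 F F' (R - (j + 1)) n} =
        cascStop R 1 0 F (R - (j + 1)) \ cascStop R 1 0 F (R - j) := by
      ext b
      constructor
      · rintro ⟨F', n, hc⟩
        refine ⟨⟨F', _, n, le_rfl, hc⟩, ?_⟩
        rintro ⟨F₂, H, n₂, hK, hc₂⟩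
        have := (hc.unique hc₂).2.1
        omega
      · rintro ⟨⟨F', H, n, hK, hc⟩, hn⟩
        obtain rfl : H = R - (j + 1) := by
          by_contra hne
          exact hn ⟨F', H, n, by omega, hc⟩
        exact ⟨F', n, hc⟩
    rw [h, measure_sdiff, key _ hj, key j (by omega), ← ENNReal.ofReal_sub]
    · congr 1
      ring
    · exact sub_nonneg.2 (contProb_le_one hα hα' _)
    · rintro b ⟨F', H, n, hK, hc⟩
      exact ⟨F', H, n, by omega, hc⟩
    · exact (measurableSet_cascStop _ _ _ _ _).nullMeasurableSet
    · exact measure_ne_top _ _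

end Cascade

theorem measurableSet_of_finite_dependsOn₂ {ι κ : Type*} {J : Set ι} {K : Set κ} (hJ : J.Finite)
    (hK : K.Finite) {A : Set ((ι → Bool) × (κ → Bool))} (hA : DependsOn₂ A J K) :
    MeasurableSet A := by
  have : Finite J := hJ
  have : Finite K := hK
  let f : (ι → Bool) × (κ → Bool) → (J → Bool) × (K → Bool) :=
    fun x => (fun i => x.1 i, fun k => x.2 k)
  have hm : Measurable f := by fun_prop
  have h : A = f ⁻¹' (f '' A) := by
    refine (Set.subset_preimage_image _ _).antisymm ?_
    rintro x ⟨y, hy, hxy⟩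
    exact hA _ _ (fun i hi => congr_fun (congr_arg Prod.fst hxy) ⟨i, hi⟩)
      (fun k hk => congr_fun (congr_arg Prod.snd hxy) ⟨k, hk⟩) hy
  rw [h]
  exact hm (Set.toFinite _).measurableSet

theorem lintegral_tsum_mul {ι X : Type*} [Countable ι] [MeasurableSpace X] {μ : Measure X}
    {f g : ι → X → ℝ≥0∞} (hf : ∀ i, Measurable (f i)) (hg : ∀ i, Measurable (g i)) :
    ∫⁻ x, ∑' i, f i x * g i x ∂μ = ∑' i, ∫⁻ x, f i x * g i x ∂μ :=
  lintegral_tsum fun i => ((hf i).mul (hg i)).aemeasurable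

/-! ### The height of the exploration is a random walk -/

/-- The pair of bit arrays coding the tree and the percolation. -/
abbrev BitPair : Type := (ℕ × ℕ → Bool) × (ℕ × ℕ → Bool)

/-- Independent bits, with parameter `α` for the tree and `p` for the percolation. -/
noncomputable def bits (α p : I) : Measure BitPair := (coins α).prod (coins p)

instance (α p : I) : IsProbabilityMeasure (bits α p) := by
  unfold bits
  infer_instance

/-- The exploration follows the list of jumps `l` and is in the given state thereafter. -/
def runState (l : List ℕ) (h : ℕ) (F : ℕ →₀ ℕ) (n : ℕ) : Set BitPair :=
  {x | Run x.1 x.2 l (h + 1) F n}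

/-- The exploration follows the list of jumps `l` and is not over thereafter. -/
def runSet (l : List ℕ) : Set BitPair :=
  {x | ∃ h F n, Run x.1 x.2 l (h + 1) F n}

theorem finite_knownEdge (H : ℕ) (F : ℕ →₀ ℕ) : {e | KnownEdge H F e}.Finite := by
  refine ((finite_below F).union ((Set.finite_Iio H).image fun r => (r, F r))).subset ?_
  rintro ⟨r, k⟩ (h | ⟨h1, h2⟩)
  · exact .inl h
  · exact .inr ⟨r, by simp at h2 ⊢; omega, by simp at h1; rw [h1]⟩

theorem dependsOn_runState (l : List ℕ) (h : ℕ) (F : ℕ →₀ ℕ) (n : ℕ) :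
    DependsOn₂ (runState l h F n) {e | e.2 < F e.1} {e | KnownEdge (h + 1) F e} :=
  fun _ _ hb ho hr => Run.congr hr (fun r k hk => hb (r, k) hk) ho

theorem measurableSet_runState (l : List ℕ) (h : ℕ) (F : ℕ →₀ ℕ) (n : ℕ) :
    MeasurableSet (runState l h F n) :=
  measurableSet_of_finite_dependsOn₂ (finite_below F) (finite_knownEdge _ F)
    (dependsOn_runState l h F n)

theorem runSet_eq (l : List ℕ) : runSet l = ⋃ s : ℕ × (ℕ →₀ ℕ) × ℕ, runState l s.1 s.2.1 s.2.2 := by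
  ext x
  simp [runSet, runState]

theorem disjoint_runState (l : List ℕ) :
    Pairwise (Function.onFun Disjoint fun s : ℕ × (ℕ →₀ ℕ) × ℕ => runState l s.1 s.2.1 s.2.2) := by
  intro s s' hs
  refine Set.disjoint_left.2 fun x hx hx' => hs ?_
  obtain ⟨h1, h2, h3⟩ := Run.unique hx hx'
  exact Prod.ext (by omega) (Prod.ext h2 h3)

theorem measurableSet_runSet (l : List ℕ) : MeasurableSet (runSet l) := by
  rw [runSet_eq]
  exact .iUnion fun s => measurableSet_runState _ _ _ _

/-- The bits met by the exploration in a given state lead to a jump of `J`. -/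
def nextEvent (h : ℕ) (F : ℕ →₀ ℕ) : ℕ → Set BitPair
  | 0 => Set.univ ×ˢ {o | o (h, F h) = true}
  | 1 => {b | b (h, F h) = true} ×ˢ {o | o (h, F h) = false}
  | j + 2 => ({b | b (h, F h) = false} ∩
      {b | ∃ F' n, Casc b h 1 0 (F.update h (F h + 1)) F' (h - j) n}) ×ˢ {o | o (h, F h) = false}

theorem measurableSet_eval_eq {ι : Type*} (i : ι) (v : Bool) :
    MeasurableSet {x : ι → Bool | x i = v} :=
  measurableSet_eq_fun (measurable_pi_apply i) measurable_const

theorem measurableSet_exists_casc (R c y H : ℕ) (F : ℕ →₀ ℕ) :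
    MeasurableSet {b | ∃ F' n, Casc b R c y F F' H n} := by
  simp only [Set.ofPred_exists]
  exact .iUnion fun F' => .iUnion fun n => measurableSet_casc _ _ _ _ _ _ _

theorem measurableSet_nextEvent (h : ℕ) (F : ℕ →₀ ℕ) (J : ℕ) : MeasurableSet (nextEvent h F J) := by
  match J with
  | 0 => exact .prod .univ (measurableSet_eval_eq _ _)
  | 1 => exact .prod (measurableSet_eval_eq _ _) (measurableSet_eval_eq _ _)
  | j + 2 =>
    exact .prod ((measurableSet_eval_eq _ _).inter (measurableSet_exists_casc _ _ _ _ _))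
      (measurableSet_eval_eq _ _)

theorem exists_casc_congr {R c y H : ℕ} {F : ℕ →₀ ℕ} {b b' : ℕ × ℕ → Bool}
    (hb : ∀ r k, r < R → F r ≤ k → b (r, k) = b' (r, k)) (h : ∃ F' n, Casc b R c y F F' H n) :
    ∃ F' n, Casc b' R c y F F' H n :=
  let ⟨F', n, hc⟩ := h
  ⟨F', n, hc.congr_of_ge hb⟩

theorem not_knownEdge_self (h : ℕ) (F : ℕ →₀ ℕ) : ¬ KnownEdge (h + 1) F (h, F h) := by
  simp [KnownEdge]

theorem dependsOn_nextEvent (h : ℕ) (F : ℕ →₀ ℕ) (J : ℕ) :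
    DependsOn₂ (nextEvent h F J) {e | e.2 < F e.1}ᶜ {e | KnownEdge (h + 1) F e}ᶜ := by
  rintro ⟨b, o⟩ ⟨b', o'⟩ hb ho hx
  have h1 : b (h, F h) = b' (h, F h) := hb _ (by simp)
  have h2 : o (h, F h) = o' (h, F h) := ho _ (not_knownEdge_self h F)
  match J with
  | 0 => exact ⟨trivial, h2.symm.trans hx.2⟩
  | 1 => exact ⟨h1.symm.trans hx.1, h2.symm.trans hx.2⟩
  | j + 2 =>
    refine ⟨⟨h1.symm.trans hx.1.1, exists_casc_congr (fun r k hr hk => hb _ ?_) hx.1.2⟩,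
      h2.symm.trans hx.2⟩
    rw [Finsupp.coe_update, Function.update_of_ne (by omega)] at hk
    simpa using hk

section Measure

variable {α : I} (hα : 1 / 2 < (α : ℝ)) (hα' : (α : ℝ) < 1) (p : I)
include hα hα'

/-- The next jump is decided by one fresh edge state, by one fresh bit if the edge is closed, and by
the depth of one cascade if this bit is `false`. The bound on `J` keeps the exploration alive, that
is, the cascade stops at a positive height. -/
theorem bits_nextEvent (h : ℕ) (F : ℕ →₀ ℕ) {J : ℕ} (hJ : J ≤ h + 1) :
    bits α p (nextEvent h F J) = jumpLaw α p {J} := by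
  rw [jumpLaw_singleton]
  have hp := p.2.1
  have hp' := sub_nonneg.2 p.2.2
  match J with
  | 0 =>
    rw [nextEvent, bits, Measure.prod_prod, measure_univ, one_mul, coins_eval, coin_true]
    rfl
  | 1 =>
    rw [nextEvent, bits, Measure.prod_prod, coins_eval, coins_eval, coin_true, coin_false,
      ← ENNReal.ofReal_mul α.2.1, mul_comm]
    rfl
  | j + 2 =>
    rw [nextEvent, bits, Measure.prod_prod, coins_eval, coin_false]
    have : coins α ({b | b (h, F h) = false} ∩
        {b | ∃ F' n, Casc b h 1 0 (F.update h (F h + 1)) F' (h - j) n}) =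
        ENNReal.ofReal (1 - α) * ENNReal.ofReal (contProb α j - contProb α (j + 1)) := by
      rw [← coins_casc_eq hα hα' (show j < h by omega) (F.update h (F h + 1)), ← coin_false,
        ← coins_eval α (h, F h)]
      refine infinitePi_inter_of_dependsOn (J := {(h, F h)}) (measurableSet_eval_eq _ _)
        (measurableSet_exists_casc _ _ _ _ _) ?_ ?_
      · intro b b' hb
        simp [hb (h, F h) rfl]
      · intro b b' hb
        refine propext ⟨exists_casc_congr fun r k hr _ => hb _ ?_,
          exists_casc_congr fun r k hr _ => (hb _ ?_).symm⟩ <;>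
        · simp
          omega
    rw [this, ← ENNReal.ofReal_mul (by linarith), ← ENNReal.ofReal_mul, mul_comm]
    · rfl
    · exact mul_nonneg (by linarith) (sub_nonneg.2 (contProb_succ_le hα hα' j))

theorem ae_bits_goodBits : ∀ᵐ x ∂bits α p, GoodBits x.1 :=
  Measure.quasiMeasurePreserving_fst.ae (ae_goodBits (by linarith) hα')

omit hα hα' in
theorem exists_step_iff {b o : ℕ × ℕ → Bool} (hb : GoodBits b) {l : List ℕ} {h n : ℕ} {F : ℕ →₀ ℕ}
    (hr : Run b o l (h + 1) F n) {J : ℕ} (hJ : J ≤ h + 1) :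
    (∃ h' F' n', Step b o (h + 1) F J (h' + 1) F' n') ↔ (b, o) ∈ nextEvent h F J := by
  constructor
  · rintro ⟨h', F', n', hs⟩
    have hH := hs.height_eq
    generalize hH' : h' + 1 = H' at hs
    cases hs with
    | up ho => exact ⟨trivial, ho⟩
    | right ho hb => exact ⟨hb, ho⟩
    | down ho hb hc =>
      obtain ⟨j, rfl⟩ : ∃ j, H' + j = h := ⟨h - H', by have := hc.height_le; omega⟩
      rw [show H' + j + 2 - H' = j + 2 by omega]
      exact ⟨⟨hb, _, _, by rwa [Nat.add_sub_cancel]⟩, ho⟩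
  · intro hx
    match J with
    | 0 =>
      -- The bits passed by an upward step have no influence on the jump; good bits ensure that the
      -- new cursor position exists.
      obtain ⟨V, D, hi, -⟩ := hr.exploreInv
      obtain ⟨k, hk, hbk, hmin⟩ := hb.exists_botIdx_eq (hi.bot_le h le_rfl)
      exact ⟨_, _, _, .up hx.2 hk hbk hmin⟩
    | 1 => exact ⟨_, _, _, .right hx.2 hx.1⟩
    | j + 2 =>
      obtain ⟨⟨h1, F', n', hc⟩, h2⟩ := hx
      refine ⟨h - j - 1, F', n', ?_⟩
      have := Step.down h2 h1 hc
      rwa [show h + 2 - (h - j) = j + 2 by omega, show h - j = h - j - 1 + 1 by omega] at this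

/-- Decompose according to the state after `l`. The state depends on the explored coordinates and
the next jump on the others, and the probability of the jump is the same for all states. -/
theorem bits_runSet_cons (l : List ℕ) (J : ℕ) (hJ : J + l.sum ≤ l.length + 1) :
    bits α p (runSet (J :: l)) = bits α p (runSet l) * jumpLaw α p {J} := by
  have h1 : runSet (J :: l) =ᵐ[bits α p]
      ⋃ s : ℕ × (ℕ →₀ ℕ) × ℕ, runState l s.1 s.2.1 s.2.2 ∩ nextEvent s.1 s.2.1 J := by
    filter_upwards [ae_bits_goodBits hα hα' p] with x hx
    refine propext ?_
    change x ∈ runSet (J :: l) ↔ x ∈ ⋃ s : ℕ × (ℕ →₀ ℕ) × ℕ, _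
    simp only [Set.mem_iUnion, Set.mem_inter_iff, Prod.exists]
    constructor
    · rintro ⟨h', F', n', hr⟩
      cases hr with
      | @cons _ h _ _ n _ F _ hr hs =>
        have := hr.height_eq
        exact ⟨h, F, n, hr, (exists_step_iff hx hr (by omega)).1 ⟨_, _, _, hs⟩⟩
    · rintro ⟨h, F, n, hr, hs⟩
      have := Run.height_eq hr
      obtain ⟨h', F', n', hs'⟩ := (exists_step_iff hx hr (by omega)).2 hs
      exact ⟨_, _, _, .cons hr hs'⟩
  rw [measure_congr h1, runSet_eq, measure_iUnion, measure_iUnion (disjoint_runState l)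
    fun s => measurableSet_runState _ _ _ _, ← ENNReal.tsum_mul_right]
  · refine tsum_congr fun s => ?_
    by_cases he : (runState l s.1 s.2.1 s.2.2).Nonempty
    · obtain ⟨x, hx⟩ := he
      have := Run.height_eq hx
      rw [← bits_nextEvent hα hα' p s.1 s.2.1 (by omega)]
      exact prod_infinitePi_inter (measurableSet_runState _ _ _ _) (measurableSet_nextEvent _ _ _)
        (dependsOn_runState _ _ _ _) (dependsOn_nextEvent _ _ _)
    · simp [Set.not_nonempty_iff_eq_empty.1 he]
  · exact fun s s' hs => (disjoint_runState l hs).mono Set.inter_subset_left Set.inter_subset_left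
  · exact fun s => (measurableSet_runState _ _ _ _).inter (measurableSet_nextEvent _ _ _)

theorem bits_runSet {l : List ℕ} (hl : ValidHist l) :
    bits α p (runSet l) = (l.map fun j => jumpLaw α p {j}).prod := by
  induction l with
  | nil =>
    have : runSet [] = Set.univ := Set.eq_univ_of_forall fun x => ⟨0, 0, 0, .nil⟩
    simp [this]
  | cons J l ih =>
    rw [bits_runSet_cons hα hα' p l J hl.2, ih hl.1, List.map_cons, List.prod_cons, mul_comm]

omit hα hα' in
theorem validHist_of_run {b o : ℕ × ℕ → Bool} {l : List ℕ} {h n : ℕ} {F : ℕ →₀ ℕ}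
    (hr : Run b o l (h + 1) F n) : ValidHist l := by
  induction l generalizing h n F with
  | nil => trivial
  | cons J l ih =>
    have := hr.height_eq
    cases hr with
    | cons hr hs =>
      refine ⟨ih hr, ?_⟩
      simp only [List.sum_cons, List.length_cons] at this
      omega

/-- The exploration and the random walk have the same history. -/
theorem bits_iUnion_runSet [IsProbabilityMeasure (jumpLaw α p)] (n : ℕ) {S : Set (List ℕ)}
    (hS : ∀ l ∈ S, l.length = n) :
    bits α p (⋃ l ∈ S, runSet l) =
      stepLaw (jumpLaw α p) (stayNonneg n ∩ {ω | hist ω n ∈ S}) := by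
  -- Histories that would have reached height `0` earlier do not occur; on the side of the walk they
  -- are excluded by `stayNonneg n`.
  have h1 : ⋃ l ∈ S, runSet l = ⋃ l ∈ S ∩ {l | ValidHist l}, runSet l := by
    ext x
    simp only [Set.mem_iUnion, Set.mem_inter_iff, Set.mem_ofPred_eq, exists_prop]
    refine exists_congr fun l => ⟨fun h => ⟨⟨h.1, ?_⟩, h.2⟩, fun h => ⟨h.1.1, h.2⟩⟩
    obtain ⟨_, _, _, hr⟩ := h.2
    exact validHist_of_run hr
  have h2 : stayNonneg n ∩ {ω | hist ω n ∈ S} = {ω | hist ω n ∈ S ∩ {l | ValidHist l}} := by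
    ext ω
    simp [mem_stayNonneg_iff, and_comm]
  rw [h1, h2, measure_hist_mem n fun l hl => hS l hl.1, measure_biUnion (Set.to_countable _)]
  · exact tsum_congr fun l => bits_runSet hα hα' p l.2.2
  · intro l hl l' hl' hne
    refine Set.disjoint_left.2 fun x h h' => hne ?_
    obtain ⟨_, _, _, h⟩ := h
    obtain ⟨_, _, _, h'⟩ := h'
    exact h.hist_unique h' ((hS l hl.1).trans (hS l' hl'.1).symm)
  · exact fun l _ => measurableSet_runSet l

end Measure

/-! ### Skipped vertices and bounds for the size of the half-plane cluster -/

/-- The exploration is not over after `n` steps. -/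
def alive (n : ℕ) : Set BitPair := ⋃ l ∈ {l : List ℕ | l.length = n}, runSet l

/-- The number of vertices skipped by a cascade. -/
noncomputable def cascCost (b : ℕ × ℕ → Bool) : ℕ → ℕ → ℕ → (ℕ →₀ ℕ) → ℝ≥0∞
  | 0, _, _, _ => 0
  | r + 1, 0, y, F => cascCost b r y 0 F
  | r + 1, c + 1, y, F => ∑' z : ℕ, {b | RunAt b r (F r) z}.indicator 1 b *
      (z + cascCost b (r + 1) c (y + z) (F.update r (F r + z + 1)))
termination_by R c => (R, c)

/-- At most one run length occurs at each cursor, so the sum in `cascCost` follows the actual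
cascade. Being defined for all bits, it can be integrated layer by layer. -/
theorem Casc.le_cost {b : ℕ × ℕ → Bool} {R c y H n : ℕ} {F F' : ℕ →₀ ℕ}
    (h : Casc b R c y F F' H n) : (n : ℝ≥0∞) ≤ cascCost b R c y F := by
  induction h with
  | dead => simp
  | finish => simp
  | down _ _ ih =>
    rw [cascCost]
    exact ih
  | @run r c y z H n F F' hz _ ih =>
    rw [cascCost]
    refine le_trans ?_ (ENNReal.le_tsum z)
    rw [Set.indicator_of_mem (s := {b | RunAt b r (F r) z}) hz, Pi.one_apply, one_mul, Nat.cast_add,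
      add_comm]
    gcongr

theorem measurable_cascCost (R c y : ℕ) (F : ℕ →₀ ℕ) :
    Measurable fun b => cascCost b R c y F := by
  induction R generalizing c y F with
  | zero => simp [cascCost]
  | succ r ihr =>
    induction c generalizing y F with
    | zero =>
      simp only [cascCost]
      exact ihr _ _ _
    | succ c ihc =>
      simp only [cascCost]
      exact .tsum fun z => (measurable_one.indicator (measurableSet_runAt _ _ _)).mul
        (measurable_const.add (ihc (y + z) _))

theorem cascCost_congr {b b' : ℕ × ℕ → Bool} {R c y : ℕ} {F : ℕ →₀ ℕ}
    (hb : ∀ r k, r < R → F r ≤ k → b (r, k) = b' (r, k)) :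
    cascCost b R c y F = cascCost b' R c y F := by
  induction R generalizing c y F with
  | zero => simp [cascCost]
  | succ r ihr =>
    induction c generalizing y F with
    | zero =>
      simp only [cascCost]
      exact ihr fun r k hr => hb r k (by omega)
    | succ c ihc =>
      simp only [cascCost]
      refine tsum_congr fun z => ?_
      have hrun : {b | RunAt b r (F r) z}.indicator (1 : (ℕ × ℕ → Bool) → ℝ≥0∞) b =
          {b | RunAt b r (F r) z}.indicator 1 b' := by
        refine Set.indicator_eq_indicator (iff_of_eq (dependsOn_runAt r (F r) z ?_)) rfl
        rintro ⟨r', i⟩ ⟨h1, h2, -⟩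
        exact hb r' i (by simp at h1; omega) (by simp at h1; rwa [h1])
      have hc : cascCost b (r + 1) c (y + z) (F.update r (F r + z + 1)) =
          cascCost b' (r + 1) c (y + z) (F.update r (F r + z + 1)) := by
        refine ihc fun r' k hr hk => hb r' k hr ?_
        rw [Finsupp.coe_update, Function.update_apply] at hk
        split_ifs at hk with h
        · subst h; omega
        · exact hk
      rw [hrun, hc]

/-- The expected number of vertices skipped by a cascade is at most this. -/
noncomputable def costBound (α : I) : ℝ := (1 - α) / (2 * α - 1)

section Measure

variable {α : I} (hα : 1 / 2 < (α : ℝ)) (hα' : (α : ℝ) < 1) (p : I)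
include hα hα'

theorem costBound_nonneg : 0 ≤ costBound α := div_nonneg (by linarith) (by linarith)

/-- `costBound α` is the mean total progeny of the subcritical branching process with offspring mean
`(1 - α) / α`. It solves `A = (1 + A) * (1 - α) / α`, which makes the linear bound reproduce itself.
-/
theorem tsum_costBound (c y : ℕ) :
    ∑' z : ℕ, ENNReal.ofReal α * ENNReal.ofReal (1 - α) ^ z *
      (z + ENNReal.ofReal (costBound α * (c + (y + z)))) =
      ENNReal.ofReal (costBound α * (c + 1 + y)) := by
  have hA := costBound_nonneg hα hα'
  have h1 : (0 : ℝ) ≤ 1 - α := by linarith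
  have h2 : ‖1 - (α : ℝ)‖ < 1 := by
    rw [Real.norm_of_nonneg h1]
    linarith
  have hs1 := hasSum_geometric_of_norm_lt_one h2
  have hs2 := hasSum_coe_mul_geometric_of_norm_lt_one h2
  have hs := ((hs2.mul_left (1 + costBound α)).add
    (hs1.mul_left (costBound α * (c + y)))).mul_left (α : ℝ)
  have hval : (α : ℝ) * ((1 + costBound α) * ((1 - α) / (1 - (1 - α)) ^ 2) +
      costBound α * (c + y) * (1 - (1 - (α : ℝ)))⁻¹) = costBound α * (c + 1 + y) := by
    have h3 : (α : ℝ) ≠ 0 := by linarith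
    have h4 : costBound α * (2 * α - 1) = 1 - α := div_mul_cancel₀ _ (by linarith)
    rw [sub_sub_cancel]
    field_simp
    linear_combination -h4
  rw [hval] at hs
  rw [← hs.tsum_eq, ENNReal.ofReal_tsum_of_nonneg _ hs.summable]
  · refine tsum_congr fun z => ?_
    rw [← ENNReal.ofReal_natCast, ← ENNReal.ofReal_add (by positivity) (by positivity),
      ← ENNReal.ofReal_pow h1, ← ENNReal.ofReal_mul (by linarith),
      ← ENNReal.ofReal_mul (mul_nonneg (by linarith) (by positivity))]
    congr 1
    ring
  · intro z
    have : (0 : ℝ) ≤ α := by linarith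
    positivity

theorem lintegral_cascCost_le (R c y : ℕ) (F : ℕ →₀ ℕ) :
    ∫⁻ b, cascCost b R c y F ∂coins α ≤ ENNReal.ofReal (costBound α * (c + y)) := by
  have hA := costBound_nonneg hα hα'
  induction R generalizing c y F with
  | zero => simp [cascCost]
  | succ r ihr =>
    induction c generalizing y F with
    | zero =>
      simp only [cascCost]
      exact (ihr y 0 F).trans (le_of_eq (by simp))
    | succ c ihc =>
      simp only [cascCost]
      have hm : ∀ z : ℕ, Measurable fun b : ℕ × ℕ → Bool =>
          (z : ℝ≥0∞) + cascCost b (r + 1) c (y + z) (F.update r (F r + z + 1)) := fun z =>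
        measurable_const.add (measurable_cascCost _ _ _ _)
      have hm1 : ∀ z, Measurable ({b | RunAt b r (F r) z}.indicator (1 : (ℕ × ℕ → Bool) → ℝ≥0∞)) := fun z =>
        measurable_one.indicator (measurableSet_runAt _ _ _)
      rw [lintegral_tsum_mul hm1 hm, Nat.cast_add, Nat.cast_one,
        ← tsum_costBound hα hα' c y]
      refine ENNReal.tsum_le_tsum fun z => ?_
      rw [lintegral_mul_eq_lintegral_mul_lintegral_of_indepFun'' (μ := coins α)
        (hm1 z).aemeasurable
        (hm z).aemeasurable (indepFun_of_dependsOn (J := {e | e.1 = r ∧ F r ≤ e.2 ∧ e.2 ≤ F r + z})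
          (hm1 z) (hm z) ?_ ?_), lintegral_indicator_one (measurableSet_runAt _ _ _), coins_runAt]
      · rw [lintegral_add_left measurable_const]
        gcongr
        · simp
        · simpa using ihc (y + z) (F.update r (F r + z + 1))
      · intro b b' h
        exact Set.indicator_eq_indicator (iff_of_eq (dependsOn_runAt r (F r) z h)) rfl
      · intro b b' h
        have := cascCost_congr (b := b) (b' := b') (R := r + 1) (c := c) (y := y + z)
          (F := F.update r (F r + z + 1)) fun r' k hr hk => h _ (by
            rintro ⟨h1, -, h2⟩
            simp only at h1 h2
            subst h1
            simp only [Finsupp.coe_update, Function.update_self] at hk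
            omega)
        simp only [this]

/-- The number of vertices skipped by the step number `i` of the exploration is at most this. -/
noncomputable def stepCost (i : ℕ) (x : BitPair) : ℝ≥0∞ :=
  ∑' s : {l : List ℕ // l.length = i} × ℕ × (ℕ →₀ ℕ) × ℕ,
    (runState s.1 s.2.1 s.2.2.1 s.2.2.2).indicator 1 x *
      cascCost x.1 s.2.1 1 0 (s.2.2.1.update s.2.1 (s.2.2.1 s.2.1 + 1))

omit hα hα' in
theorem measurable_stepCost (i : ℕ) : Measurable (stepCost i) :=
  .tsum fun _ => (measurable_one.indicator (measurableSet_runState _ _ _ _)).mul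
    ((measurable_cascCost _ _ _ _).comp measurable_fst)

omit hα hα' in
theorem Run.le_sum_stepCost {b o : ℕ × ℕ → Bool} {l : List ℕ} {H n : ℕ} {F : ℕ →₀ ℕ}
    (h : Run b o l H F n) : (n : ℝ≥0∞) ≤ ∑ i ∈ Finset.range l.length, stepCost i (b, o) := by
  induction h with
  | nil => simp
  | @cons l h H J n n' F F' hr hs ih =>
    rw [List.length_cons, Finset.sum_range_succ, Nat.cast_add]
    refine add_le_add ih ?_
    cases hs with
    | up => simp
    | right => simp
    | down ho hb hc =>
      refine hc.le_cost.trans ?_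
      refine le_trans ?_ (ENNReal.le_tsum (⟨l, rfl⟩, h, F, n))
      rw [Set.indicator_of_mem (s := runState l h F n) (a := (b, o)) hr, Pi.one_apply, one_mul]

/-- The state before step `i` depends on explored coordinates only, and the cascade that may follow
reads the others, so its mean cost factors out and is bounded uniformly in the state. -/
theorem lintegral_stepCost_le (i : ℕ) :
    ∫⁻ x, stepCost i x ∂bits α p ≤ ENNReal.ofReal (costBound α) * bits α p (alive i) := by
  have hm1 : ∀ s : {l : List ℕ // l.length = i} × ℕ × (ℕ →₀ ℕ) × ℕ,
      Measurable ((runState s.1 s.2.1 s.2.2.1 s.2.2.2).indicator (1 : BitPair → ℝ≥0∞)) := fun s =>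
    measurable_one.indicator (measurableSet_runState _ _ _ _)
  have hm2 : ∀ s : {l : List ℕ // l.length = i} × ℕ × (ℕ →₀ ℕ) × ℕ,
      Measurable fun x : BitPair =>
        cascCost x.1 s.2.1 1 0 (s.2.2.1.update s.2.1 (s.2.2.1 s.2.1 + 1)) := fun s =>
    (measurable_cascCost _ _ _ _).comp measurable_fst
  have halive : alive i = ⋃ s : {l : List ℕ // l.length = i} × ℕ × (ℕ →₀ ℕ) × ℕ,
      runState s.1 s.2.1 s.2.2.1 s.2.2.2 := by
    ext x
    simp [alive, runSet, runState]
  have hdisj : Pairwise (Function.onFun Disjoint fun s : {l : List ℕ // l.length = i} × ℕ ×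
      (ℕ →₀ ℕ) × ℕ => runState s.1 s.2.1 s.2.2.1 s.2.2.2) := by
    rintro ⟨⟨l, hl⟩, s⟩ ⟨⟨l', hl'⟩, s'⟩ hs
    refine Set.disjoint_left.2 fun x hx hx' => hs ?_
    obtain rfl := Run.hist_unique hx hx' (hl.trans hl'.symm)
    congr
    by_contra hne
    exact Set.disjoint_left.1 (disjoint_runState l hne) hx hx'
  simp only [stepCost]
  rw [lintegral_tsum_mul hm1 hm2, halive,
    measure_iUnion hdisj fun s => measurableSet_runState _ _ _ _, ← ENNReal.tsum_mul_left]
  refine ENNReal.tsum_le_tsum fun s => ?_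
  rw [lintegral_mul_eq_lintegral_mul_lintegral_of_indepFun'' (hm1 s).aemeasurable
    (hm2 s).aemeasurable, lintegral_indicator_one (measurableSet_runState _ _ _ _), mul_comm]
  · gcongr
    rw [bits, measurePreserving_fst.lintegral_comp (measurable_cascCost _ _ _ _)]
    simpa using lintegral_cascCost_le hα hα' s.2.1 1 0
      (s.2.2.1.update s.2.1 (s.2.2.1 s.2.1 + 1))
  · rw [indepFun_iff_measure_inter_preimage_eq_mul]
    intro A B hA hB
    refine prod_infinitePi_inter (hm1 s hA) (hm2 s hB) (J := {e | e.2 < s.2.2.1 e.1})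
      (K := {e | KnownEdge (s.2.1 + 1) s.2.2.1 e}) ?_ ?_
    · intro x x' hb ho hx
      have : x ∈ runState s.1 s.2.1 s.2.2.1 s.2.2.2 ↔ x' ∈ runState s.1 s.2.1 s.2.2.1 s.2.2.2 :=
        ⟨dependsOn_runState _ _ _ _ x x' hb ho, dependsOn_runState _ _ _ _ x' x
          (fun e he => (hb e he).symm) fun e he => (ho e he).symm⟩
      rw [Set.mem_preimage] at hx ⊢
      rwa [← Set.indicator_eq_indicator (f := (1 : BitPair → ℝ≥0∞)) this rfl]
    · intro x x' hb _ hx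
      rw [Set.mem_preimage] at hx ⊢
      rwa [← cascCost_congr fun r k hr hk => hb _ ?_]
      rw [Finsupp.coe_update, Function.update_of_ne (by omega)] at hk
      simpa using hk

omit hα hα' in
/-- After `N` steps the exploration is still alive, or it has come to an end. -/
theorem exists_run {b o : ℕ × ℕ → Bool} (hb : GoodBits b) (N : ℕ) :
    (b, o) ∈ alive N ∨ ∃ l F n, l.length ≤ N ∧ Run b o l 0 F n := by
  induction N with
  | zero => exact .inl (Set.mem_biUnion (x := []) rfl ⟨0, 0, 0, .nil⟩)
  | succ N ih =>
    rcases ih with ih | ⟨l, F, n, hl, hr⟩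
    · simp only [alive, Set.mem_iUnion, Set.mem_ofPred_eq, exists_prop] at ih
      obtain ⟨l, rfl, h, F, n, hr⟩ := ih
      obtain ⟨J, H, F', n', hs⟩ : ∃ J H F' n', Step b o (h + 1) F J H F' n' := by
        cases ho : o (h, F h) with
        | true =>
          obtain ⟨V, D, hi, -⟩ := Run.exploreInv hr
          obtain ⟨k, hk, hbk, hmin⟩ := hb.exists_botIdx_eq (hi.bot_le h le_rfl)
          exact ⟨_, _, _, _, .up ho hk hbk hmin⟩
        | false =>
          cases hbh : b (h, F h) with
          | true => exact ⟨_, _, _, _, .right ho hbh⟩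
          | false =>
            obtain ⟨F', H, n, hc⟩ := hb.exists_casc h 1 0 (F.update h (F h + 1))
            exact ⟨_, _, _, _, .down ho hbh hc⟩
      have hr' := Run.cons hr hs
      cases H with
      | zero => exact .inr ⟨_, _, _, by simp, hr'⟩
      | succ H =>
        refine .inl (Set.mem_biUnion (x := J :: l) (by simp) ⟨_, _, _, hr'⟩)
    · exact .inr ⟨l, F, n, by omega, hr⟩

omit hα in
theorem bits_infinite_le (hα : 0 < (α : ℝ)) (N : ℕ) :
    bits α p {x | (bitCluster x.1 x.2).Infinite} ≤ bits α p (alive N) := by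
  refine measure_mono_ae ?_
  have : ∀ᵐ x ∂bits α p, GoodBits x.1 := Measure.quasiMeasurePreserving_fst.ae (ae_goodBits hα hα')
  filter_upwards [this] with x hx hinf
  refine (exists_run hx N).resolve_right ?_
  rintro ⟨l, F, n, -, hr⟩
  refine hinf (Set.encard_ne_top_iff.1 (ne_top_of_le_ne_top ?_ hr.encard_le))
  exact_mod_cast ENat.natCast_ne_top (l.count 0 + 1 + n)

/-- If the exploration ends within `N` steps, it visits at most `N + 1` vertices; a cluster of size
`2 * N + 2` then forces `N + 1` skipped ones. Markov's inequality bounds this by the mean total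
cost. -/
theorem bits_large_le (N : ℕ) :
    bits α p {x | ((2 * N + 2 : ℕ) : ℕ∞) ≤ (bitCluster x.1 x.2).encard} ≤
      bits α p (alive N) + ENNReal.ofReal (costBound α) *
        (∑ i ∈ Finset.range N, bits α p (alive i)) / (N + 1 : ℕ) := by
  have h1 : bits α p {x | ((2 * N + 2 : ℕ) : ℕ∞) ≤ (bitCluster x.1 x.2).encard} ≤
      bits α p (alive N ∪ {x | ((N + 1 : ℕ) : ℝ≥0∞) ≤ ∑ i ∈ Finset.range N, stepCost i x}) := by
    refine measure_mono_ae ?_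
    filter_upwards [ae_bits_goodBits hα hα' p] with x hx hlarge
    refine (exists_run hx N).imp id ?_
    rintro ⟨l, F, n, hl, hr⟩
    have h2 := (show ((2 * N + 2 : ℕ) : ℕ∞) ≤ _ from hlarge).trans hr.encard_le
    have h3 : 2 * N + 2 ≤ l.count 0 + 1 + n := by exact_mod_cast h2
    have h4 : l.count 0 ≤ l.length := List.count_le_length
    have h5 : N + 1 ≤ n := by omega
    refine le_trans ?_ (hr.le_sum_stepCost.trans (Finset.sum_le_sum_of_subset
      (Finset.range_subset_range.2 hl)))
    exact_mod_cast h5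
  refine h1.trans ((measure_union_le _ _).trans ?_)
  gcongr
  refine (meas_ge_le_lintegral_div ?_ (by simp) (ENNReal.natCast_ne_top _)).trans ?_
  · exact (Finset.measurable_fun_sum _ fun i _ => measurable_stepCost i).aemeasurable
  · gcongr
    rw [lintegral_finsetSum _ fun i _ => measurable_stepCost i, Finset.mul_sum]
    exact Finset.sum_le_sum fun i _ => lintegral_stepCost_le hα hα' p i

theorem bits_alive [IsProbabilityMeasure (jumpLaw α p)] (N : ℕ) :
    bits α p (alive N) = stepLaw (jumpLaw α p) (stayNonneg N) := by
  rw [alive, bits_iUnion_runSet hα hα' p N (S := {l | l.length = N}) fun l hl => hl]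
  congr 1
  exact Set.inter_eq_left.2 fun ω _ => length_hist ω N

theorem le_bits_large [IsProbabilityMeasure (jumpLaw α p)] (N n : ℕ) :
    stepLaw (jumpLaw α p) (stayNonneg N ∩ {ω | n ≤ zeros ω N}) ≤
      bits α p {x | (n : ℕ∞) ≤ (bitCluster x.1 x.2).encard} := by
  have h := bits_iUnion_runSet hα hα' p N (S := {l | l.length = N ∧ n ≤ l.count 0}) fun l hl => hl.1
  have h2 : {ω : ℕ → ℕ | hist ω N ∈ {l : List ℕ | l.length = N ∧ n ≤ l.count 0}} =
      {ω | n ≤ zeros ω N} := by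
    ext ω
    simp [length_hist, zeros_eq_hist]
  rw [h2] at h
  rw [← h]
  refine measure_mono (Set.iUnion₂_subset ?_)
  rintro l ⟨-, hl⟩ x ⟨h, F, m, hr⟩
  refine le_trans ?_ hr.le_encard
  exact_mod_cast hl.trans (Nat.le_succ _)

end Measure

/-! ### Tail estimates for the half-plane cluster -/

/-- The probability that the cluster coded by random bits has at least `n` vertices. -/
noncomputable def bitTail (α p : I) (n : ℕ) : ℝ :=
  (bits α p).real {x | (n : ℕ∞) ≤ (bitCluster x.1 x.2).encard}

theorem sum_inv_sqrt_le (N : ℕ) :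
    ∑ i ∈ Finset.range N, 1 / √((i : ℝ) + 1) ≤ 2 * √N := by
  induction N with
  | zero => simp
  | succ N ih =>
    rw [Finset.sum_range_succ]
    have h1 : 0 < √((N : ℝ) + 1) := Real.sqrt_pos.2 (by positivity)
    have h2 : 0 ≤ √(N : ℝ) := Real.sqrt_nonneg _
    have h3 := Real.sq_sqrt (show (0 : ℝ) ≤ N + 1 by positivity)
    have h4 := Real.sq_sqrt (show (0 : ℝ) ≤ N by positivity)
    have : 1 / √((N : ℝ) + 1) ≤ 2 * √((N : ℝ) + 1) - 2 * √N := by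
      rw [div_le_iff₀ h1]
      nlinarith [sq_nonneg (√((N : ℝ) + 1) - √N)]
    push_cast
    linarith

section Param

variable {α : I} (hα : 1 / 2 < (α : ℝ)) (hα' : (α : ℝ) < 1)
include hα hα'

theorem real_alive {p : I} (hp : 0 < (p : ℝ)) [IsProbabilityMeasure (jumpLaw α p)] (N : ℕ) :
    (bits α p).real (alive N) = (stepLaw (jumpLaw α p)).real (stayPos (N + 1)) / p := by
  rw [measure_stayPos_succ, jumpLaw_real_zero hα hα' p, mul_div_cancel_left₀ _ hp.ne',
    measureReal_def, measureReal_def, bits_alive hα hα']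

theorem real_alive_le {p : I} (hp : 0 < (p : ℝ)) (hpc : (criticalParam α : ℝ) ≤ p) (N : ℕ) :
    (bits α p).real (alive N) ≤
      2 * √(stepSqBound α / (N + 1) + ((1 + criticalOdds α) * (p - criticalParam α)) ^ 2) / p := by
  have := isProbabilityMeasure_jumpLaw hα hα' p
  have h0 := criticalOdds_nonneg α
  rw [real_alive hα hα' hp]
  refine div_le_div_of_nonneg_right ?_ hp.le
  have hd := drift_jumpLaw hα hα' p
  have h1 := sq_stayPos_le (integrable_jumpLaw_sq hα hα' p)
    (by rw [hd]; exact mul_nonneg (by linarith) (by linarith)) (Nat.succ_le_succ (Nat.zero_le N))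
  rw [hd] at h1
  have h2 := stepSq_jumpLaw_le hα hα' p
  refine abs_le_of_sq_le_sq' ?_ (by positivity) |>.2
  rw [mul_pow, Real.sq_sqrt (by have := stepSqBound_pos hα hα'; positivity)]
  refine h1.trans ?_
  push_cast
  norm_num
  gcongr

/-- An infinite cluster keeps the exploration alive for ever. As `N → ∞` the diffusive term
disappears from the survival bound and twice the drift over `p` remains. -/
theorem bits_infinite_le_of_gt {p : I} (hp : (criticalParam α : ℝ) ≤ p) :
    (bits α p).real {x | (bitCluster x.1 x.2).Infinite} ≤
      2 * (1 + criticalOdds α) / criticalParam α * (p - criticalParam α) := by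
  have hc := criticalParam_pos hα hα'
  have hp0 : 0 < (p : ℝ) := hc.trans_le hp
  have h0 := criticalOdds_nonneg α
  have h1 : ∀ N : ℕ, (bits α p).real {x | (bitCluster x.1 x.2).Infinite} ≤
      2 * √(stepSqBound α * (1 / ((N : ℝ) + 1)) +
        ((1 + criticalOdds α) * (p - criticalParam α)) ^ 2) / p := fun N => by
    rw [mul_one_div]
    refine le_trans ?_ (real_alive_le hα hα' hp0 hp N)
    exact ENNReal.toReal_mono (measure_ne_top _ _) (bits_infinite_le hα' p (by linarith) N)
  have h2 : Filter.Tendsto (fun N : ℕ => 2 * √(stepSqBound α * (1 / ((N : ℝ) + 1)) +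
        ((1 + criticalOdds α) * (p - criticalParam α)) ^ 2) / p) Filter.atTop
        (nhds (2 * √(stepSqBound α * 0 +
          ((1 + criticalOdds α) * (p - criticalParam α)) ^ 2) / p)) := by
    have := tendsto_one_div_add_atTop_nhds_zero_nat (𝕜 := ℝ)
    exact (((this.const_mul _).add_const _).sqrt.const_mul 2).div_const _
  refine (ge_of_tendsto' h2 h1).trans ?_
  rw [mul_zero, zero_add, Real.sqrt_sq (mul_nonneg (by linarith) (by linarith)),
    div_mul_eq_mul_div, mul_assoc]
  refine div_le_div_of_nonneg_left ?_ hc hp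
  exact mul_nonneg zero_le_two (mul_nonneg (by linarith) (by linarith))

/-- An exploration alive after `N` steps has visited `n` vertices unless fewer than `n` of the steps
go up, and Chebyshev's inequality bounds the latter. -/
theorem le_bitTail {p : I} (hp : 0 < (p : ℝ)) [IsProbabilityMeasure (jumpLaw α p)] {n N : ℕ}
    (hN : 0 < N) (hn : 2 * n ≤ N * (p : ℝ)) :
    (stepLaw (jumpLaw α p)).real (stayPos (N + 1)) / p - 4 / (N * p) ≤ bitTail α p n := by
  have h1 := measure_zeros_lt_le (ρ := jumpLaw α p) (n := n) (N := N)
    (by rwa [jumpLaw_real_zero hα hα']) hN (by rwa [jumpLaw_real_zero hα hα'])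
  rw [jumpLaw_real_zero hα hα'] at h1
  rw [measure_stayPos_succ, jumpLaw_real_zero hα hα' p, mul_div_cancel_left₀ _ hp.ne']
  have h2 : (stepLaw (jumpLaw α p)).real (stayNonneg N ∩ {ω | n ≤ zeros ω N}) ≤ bitTail α p n :=
    ENNReal.toReal_mono (measure_ne_top _ _) (le_bits_large hα hα' p N n)
  have h3 : (stepLaw (jumpLaw α p)).real (stayNonneg N) ≤
      (stepLaw (jumpLaw α p)).real (stayNonneg N ∩ {ω | n ≤ zeros ω N}) +
        (stepLaw (jumpLaw α p)).real {ω | zeros ω N < n} := by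
    refine le_trans (measureReal_mono ?_) (measureReal_union_le _ _)
    intro ω hω
    rcases lt_or_ge (zeros ω N) n with h | h
    · exact .inr h
    · exact .inl ⟨hω, h⟩
  linarith

/-- The survival probability is at least the drift for every number of steps, so the number of steps
can tend to infinity for fixed `n`, which removes the Chebyshev error. -/
theorem drift_le_bitTail {p : I} (hp : (criticalParam α : ℝ) ≤ p) (n : ℕ) :
    (1 + criticalOdds α) * (p - criticalParam α) ≤ bitTail α p n := by
  have := isProbabilityMeasure_jumpLaw hα hα' p
  have hp0 : 0 < (p : ℝ) := (criticalParam_pos hα hα').trans_le hp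
  have h0 := criticalOdds_nonneg α
  have hd := drift_jumpLaw hα hα' p
  have h1 : ∀ᶠ N : ℕ in Filter.atTop, drift (jumpLaw α p) - 4 / (N * p) ≤ bitTail α p n := by
    filter_upwards [Filter.eventually_ge_atTop (⌈2 * n / (p : ℝ)⌉₊ + 1)] with N hN
    refine le_trans (sub_le_sub_right ?_ _) (le_bitTail hα hα' hp0 (n := n) (by omega) ?_)
    · refine (drift_le_stayPos (integrable_jumpLaw_sq hα hα' p) (N + 1)).trans ?_
      exact le_div_self measureReal_nonneg hp0 p.2.2
    · rw [← div_le_iff₀ hp0]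
      exact (Nat.le_ceil _).trans (by exact_mod_cast (Nat.le_succ _).trans hN)
  have h2 : Filter.Tendsto (fun N : ℕ => drift (jumpLaw α p) - 4 / (N * (p : ℝ))) Filter.atTop
      (nhds (drift (jumpLaw α p) - 0)) := by
    refine tendsto_const_nhds.sub (Filter.Tendsto.const_div_atTop ?_ _)
    exact tendsto_natCast_atTop_atTop.atTop_mul_const hp0
  rw [sub_zero] at h2
  rw [← hd]
  exact le_of_tendsto h2 h1

theorem exists_le_bitTail : ∃ c : ℝ, 0 < c ∧ ∀ n : ℕ, 1 ≤ n →
    c / √n ≤ bitTail α (criticalParam α) n := by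
  set p := criticalParam α with hpdef
  have := isProbabilityMeasure_jumpLaw hα hα' p
  have hp : 0 < (p : ℝ) := criticalParam_pos hα hα'
  set S := stepSqBound α with hS
  have hS0 : 0 < S := stepSqBound_pos hα hα'
  set c₁ := (p : ℝ) / (S * (1 + 2 * √(2 * S))) with hc₁
  have hc₁0 : 0 < c₁ := by positivity
  -- The exploration is run for `M * n` steps. The first bound on `M` makes `n` upward steps at most
  -- half of their mean number; the second makes the Chebyshev error at most half of the survival
  -- probability.
  obtain ⟨M, hM⟩ := exists_nat_ge (max (2 / (p : ℝ)) ((8 / (p * c₁)) ^ 2))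
  have hM1 : 2 / (p : ℝ) ≤ M := (le_max_left _ _).trans hM
  have hM2 : (8 / (p * c₁)) ^ 2 ≤ M := (le_max_right _ _).trans hM
  have hM0 : 0 < (M : ℝ) := lt_of_lt_of_le (by positivity) hM1
  have hsM : 8 / (p * c₁) ≤ √M := Real.le_sqrt_of_sq_le hM2
  have hsM0 : 0 < √(M : ℝ) := Real.sqrt_pos.2 hM0
  refine ⟨c₁ / (2 * √M), by positivity, fun n hn => ?_⟩
  have hn0 : (1 : ℝ) ≤ n := by exact_mod_cast hn
  have hN : 0 < M * n := Nat.mul_pos (by exact_mod_cast hM0) hn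
  have h1 := le_bitTail hα hα' hp (n := n) hN (by
    push_cast
    rw [div_le_iff₀ hp] at hM1
    nlinarith)
  refine le_trans ?_ h1
  have h2 := sq_le_stayPos_mul (integrable_jumpLaw_sq hα hα' p)
    (by rw [drift_jumpLaw hα hα', ← hpdef, sub_self, mul_zero]) (Nat.succ_le_succ (Nat.zero_le (M * n)))
  rw [jumpLaw_real_zero hα hα' p] at h2
  have h3 := stepSq_jumpLaw_le hα hα' p
  rw [← hS] at h3
  set a := (stepLaw (jumpLaw α p)).real (stayPos (M * n + 1)) with ha
  have ha0 : 0 ≤ a := measureReal_nonneg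
  have hN1 : (1 : ℝ) ≤ (M : ℝ) * n := by exact_mod_cast hN
  have hsn : 1 ≤ √((M : ℝ) * n) := Real.one_le_sqrt.2 hN1
  have h4 : (p : ℝ) ^ 2 ≤ a * ((S * (1 + 2 * √(2 * S))) * √(M * n)) := by
    refine h2.trans (mul_le_mul_of_nonneg_left ?_ ha0)
    have h5 : √(((M * n).succ : ℕ) * stepSq (jumpLaw α p)) ≤ √(2 * S) * √(M * n) := by
      rw [← Real.sqrt_mul (by positivity)]
      refine Real.sqrt_le_sqrt ?_
      have := stepSq_nonneg (ρ := jumpLaw α p)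
      push_cast
      calc ((M : ℝ) * n + 1) * stepSq (jumpLaw α p) ≤ (2 * (M * n)) * S := by gcongr; linarith
        _ = _ := by ring
    have := stepSq_nonneg (ρ := jumpLaw α p)
    calc _ ≤ S * (1 + 2 * (√(2 * S) * √(M * n))) := by gcongr
      _ ≤ S * (√(M * n) + 2 * (√(2 * S) * √(M * n))) := by gcongr
      _ = _ := by ring
  have h6 : c₁ / √(M * n) ≤ a / p := by
    rw [hc₁, div_div, div_le_div_iff₀ (by positivity) hp]
    linarith
  have h7 : 4 / (((M * n : ℕ) : ℝ) * p) ≤ c₁ / (2 * √(M * n)) := by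
    rw [div_le_iff₀ (by positivity)] at hsM
    push_cast
    rw [div_le_div_iff₀ (by positivity) (by positivity)]
    have h8 := Real.sq_sqrt (show (0 : ℝ) ≤ M * n by positivity)
    have h9 : √(M : ℝ) ≤ √(M * n) := Real.sqrt_le_sqrt (by nlinarith)
    have h10 : 8 ≤ √(M * n) * (p * c₁) := hsM.trans (by gcongr)
    nlinarith
  have h11 : c₁ / (2 * √M) / √n = c₁ / (2 * √(M * n)) := by
    rw [Real.sqrt_mul hM0.le, div_div, mul_assoc]
  have h12 : c₁ / √(M * n) = 2 * (c₁ / (2 * √(M * n))) := by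
    field_simp
  rw [h11]
  linarith

theorem exists_bitTail_le : ∃ C : ℝ, 0 < C ∧ ∀ n : ℕ, 1 ≤ n →
    bitTail α (criticalParam α) n ≤ C / √n := by
  set p := criticalParam α with hpdef
  have hp : 0 < (p : ℝ) := criticalParam_pos hα hα'
  set S := stepSqBound α with hS
  have hS0 : 0 < S := stepSqBound_pos hα hα'
  set A := costBound α with hA
  have hA0 : 0 ≤ A := costBound_nonneg hα hα'
  set K := 2 * √S / (p : ℝ) with hK
  have hK0 : 0 < K := by positivity
  have h1 : ∀ N : ℕ, (bits α p).real (alive N) ≤ K * (1 / √((N : ℝ) + 1)) := fun N => by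
    have := real_alive_le hα hα' hp le_rfl N
    rw [← hpdef, sub_self, mul_zero, zero_pow two_ne_zero, add_zero,
      Real.sqrt_div hS0.le] at this
    refine this.trans (le_of_eq ?_)
    rw [hK]
    field_simp
  -- The survival probabilities of the first `N` steps add up to order `√N`, so the Markov term,
  -- divided by `N + 1`, has the same order as the survival term.
  have h2 : ∀ N : ℕ, bitTail α p (2 * N + 2) ≤ K * (1 + 2 * A) * (1 / √((N : ℝ) + 1)) := fun N => by
    have h3 := ENNReal.toReal_mono (ENNReal.add_ne_top.2 ⟨measure_ne_top _ _,
      ENNReal.div_ne_top (ENNReal.mul_ne_top ENNReal.ofReal_ne_top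
        (ENNReal.sum_ne_top.2 fun i _ => measure_ne_top (bits α p) (alive i))) (by simp)⟩)
      (bits_large_le hα hα' p N)
    rw [ENNReal.toReal_add (measure_ne_top _ _) (ENNReal.div_ne_top (ENNReal.mul_ne_top
      ENNReal.ofReal_ne_top (ENNReal.sum_ne_top.2 fun i _ => measure_ne_top (bits α p) (alive i)))
      (by simp)), ENNReal.toReal_div, ENNReal.toReal_mul, ENNReal.toReal_ofReal hA0,
      ENNReal.toReal_sum fun i _ => measure_ne_top _ _, ENNReal.toReal_natCast] at h3
    have h4 : ∑ i ∈ Finset.range N, ((bits α p) (alive i)).toReal ≤ K * (2 * √((N : ℝ) + 1)) := by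
      calc _ ≤ ∑ i ∈ Finset.range N, K * (1 / √((i : ℝ) + 1)) :=
            Finset.sum_le_sum fun i _ => h1 i
        _ = K * ∑ i ∈ Finset.range N, 1 / √((i : ℝ) + 1) := by rw [Finset.mul_sum]
        _ ≤ K * (2 * √(N : ℝ)) := by gcongr; exact sum_inv_sqrt_le N
        _ ≤ _ := by gcongr; linarith
    have h5 : 0 < √((N : ℝ) + 1) := Real.sqrt_pos.2 (by positivity)
    have h6 := Real.sq_sqrt (show (0 : ℝ) ≤ N + 1 by positivity)
    calc bitTail α p (2 * N + 2) ≤ _ := h3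
      _ ≤ K * (1 / √((N : ℝ) + 1)) + A * (K * (2 * √((N : ℝ) + 1))) / (N + 1 : ℕ) := by
          gcongr
          exact h1 N
      _ = _ := by
          rw [show (((N + 1 : ℕ) : ℝ)) = √((N : ℝ) + 1) ^ 2 by rw [h6]; push_cast; rfl]
          generalize √((N : ℝ) + 1) = s at h5 ⊢
          field_simp
  refine ⟨1 + 2 * (K * (1 + 2 * A)), by positivity, fun n hn => ?_⟩
  have hn0 : (1 : ℝ) ≤ n := by exact_mod_cast hn
  have hsn : 1 ≤ √(n : ℝ) := Real.one_le_sqrt.2 hn0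
  rcases hn.eq_or_lt with rfl | hn
  · have : bitTail α p 1 ≤ 1 := measureReal_le_one
    simp only [Nat.cast_one, Real.sqrt_one, div_one]
    have : 0 < K * (1 + 2 * A) := by positivity
    linarith
  -- For `n ≥ 2` the argument on the right is `n` rounded down to an even number.
  · have h3 : bitTail α p n ≤ bitTail α p (2 * (n / 2 - 1) + 2) := by
      have hle : ((2 * (n / 2 - 1) + 2 : ℕ) : ℕ∞) ≤ n := by
        exact_mod_cast (by omega : 2 * (n / 2 - 1) + 2 ≤ n)
      exact measureReal_mono fun x hx => hle.trans (show (n : ℕ∞) ≤ _ from hx)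
    refine h3.trans ((h2 _).trans ?_)
    have h4 : √(n : ℝ) / 2 ≤ √(((n / 2 - 1 : ℕ) : ℝ) + 1) := by
      refine Real.le_sqrt_of_sq_le ?_
      rw [div_pow, Real.sq_sqrt (by positivity)]
      have : n ≤ 4 * (n / 2 - 1 + 1) := by omega
      have : (n : ℝ) ≤ 4 * (((n / 2 - 1 : ℕ) : ℝ) + 1) := by exact_mod_cast this
      linarith
    calc K * (1 + 2 * A) * (1 / √(((n / 2 - 1 : ℕ) : ℝ) + 1)) ≤
        K * (1 + 2 * A) * (1 / (√(n : ℝ) / 2)) := by gcongr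
      _ = 2 * (K * (1 + 2 * A)) / √n := by field_simp
      _ ≤ _ := by gcongr; linarith

end Param

/-! ### A layer with geometric offspring numbers is a sequence of coin tosses -/

/-- The edges in one layer from left to right, `(i, j)` standing for the `j`-th edge of the `i`-th
vertex, if the offspring numbers are `s`. -/
def edgePos (s : ℕ → ℕ) : ℕ → ℕ × ℕ
  | 0 => (0, 0)
  | k + 1 =>
    if (edgePos s k).2 < s (edgePos s k).1 then ((edgePos s k).1, (edgePos s k).2 + 1)
    else ((edgePos s k).1 + 1, 0)

/-- Whether the edge number `k + 1` of the layer has the same bottom endpoint as the edge number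
`k`. Otherwise it has the same top endpoint. -/
def edgeBit (s : ℕ → ℕ) (k : ℕ) : Bool := decide ((edgePos s k).2 < s (edgePos s k).1)

theorem edgePos_le (s : ℕ → ℕ) (k : ℕ) : (edgePos s k).2 ≤ s (edgePos s k).1 := by
  induction k with
  | zero => exact Nat.zero_le _
  | succ k ih =>
    rw [edgePos]
    split_ifs with h
    · exact h
    · exact Nat.zero_le _

theorem edgePos_sum (s : ℕ → ℕ) (k : ℕ) :
    (edgePos s k).1 + (∑ i ∈ Finset.range (edgePos s k).1, s i + (edgePos s k).2) = k := by
  induction k with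
  | zero => rfl
  | succ k ih =>
    have := edgePos_le s k
    rw [edgePos]
    split_ifs with h
    · simp only
      omega
    · simp only [Finset.sum_range_succ]
      omega

theorem edgePos_injective (s : ℕ → ℕ) : Function.Injective (edgePos s) := fun k l h => by
  rw [← edgePos_sum s k, ← edgePos_sum s l, h]

theorem exists_edgePos_eq (s : ℕ → ℕ) (i : ℕ) {j : ℕ} (hj : j ≤ s i) : ∃ k, edgePos s k = (i, j) := by
  induction i generalizing j with
  | zero =>
    induction j with
    | zero => exact ⟨0, rfl⟩
    | succ j ih =>
      obtain ⟨k, hk⟩ := ih (by omega)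
      exact ⟨k + 1, by rw [edgePos, hk, if_pos (by simpa using hj)]⟩
  | succ i ih =>
    induction j with
    | zero =>
      obtain ⟨k, hk⟩ := ih le_rfl
      exact ⟨k + 1, by rw [edgePos, hk, if_neg (lt_irrefl _)]⟩
    | succ j ih' =>
      obtain ⟨k, hk⟩ := ih' (by omega)
      exact ⟨k + 1, by rw [edgePos, hk, if_pos (by simpa using hj)]⟩

theorem edgePos_succ_of_zero {s : ℕ → ℕ} (h : s 0 = 0) (k : ℕ) :
    edgePos s (k + 1) = ((edgePos (fun i => s (i + 1)) k).1 + 1,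
      (edgePos (fun i => s (i + 1)) k).2) := by
  induction k with
  | zero => simp [edgePos, h]
  | succ k ih =>
    rw [edgePos, ih, edgePos]
    split_ifs <;> rfl

/-- Deleting the first edge of a vertex with children leaves the layer in which this vertex has one
child less. Together with `edgePos_succ_of_zero`, where the childless first vertex disappears, this
gives a recursion for the bits. -/
theorem edgePos_succ_of_pos {s : ℕ → ℕ} (h : s 0 ≠ 0) (k : ℕ) :
    edgePos s (k + 1) = ((edgePos (Function.update s 0 (s 0 - 1)) k).1,
      if (edgePos (Function.update s 0 (s 0 - 1)) k).1 = 0 then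
        (edgePos (Function.update s 0 (s 0 - 1)) k).2 + 1
      else (edgePos (Function.update s 0 (s 0 - 1)) k).2) := by
  induction k with
  | zero => simp [edgePos, Nat.pos_of_ne_zero h]
  | succ k ih =>
    rw [edgePos, ih, edgePos]
    generalize edgePos (Function.update s 0 (s 0 - 1)) k = e
    obtain ⟨i, j⟩ := e
    rcases Nat.eq_zero_or_pos i with rfl | hi
    · by_cases hj : j + 1 < s 0
      · simp [hj, show j < s 0 - 1 by omega]
      · simp [hj, show ¬ j < s 0 - 1 by omega]
    · by_cases hj : j < s i <;> simp [hj, hi.ne']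

theorem edgeBit_zero (s : ℕ → ℕ) : edgeBit s 0 = decide (s 0 ≠ 0) := by
  simp [edgeBit, edgePos, Nat.pos_iff_ne_zero]

theorem edgeBit_succ_of_zero {s : ℕ → ℕ} (h : s 0 = 0) (k : ℕ) :
    edgeBit s (k + 1) = edgeBit (fun i => s (i + 1)) k := by
  simp only [edgeBit, edgePos_succ_of_zero h]

theorem edgeBit_succ_of_pos {s : ℕ → ℕ} (h : s 0 ≠ 0) (k : ℕ) :
    edgeBit s (k + 1) = edgeBit (Function.update s 0 (s 0 - 1)) k := by
  simp only [edgeBit, edgePos_succ_of_pos h]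
  generalize edgePos (Function.update s 0 (s 0 - 1)) k = e
  obtain ⟨i, j⟩ := e
  rcases Nat.eq_zero_or_pos i with rfl | hi
  · simp only [if_true, Function.update_self, decide_eq_decide]
    omega
  · simp [hi.ne']

theorem measurable_edgePos (k : ℕ) : Measurable fun s : ℕ → ℕ => edgePos s k := by
  induction k with
  | zero => exact measurable_const
  | succ k ih =>
    have heval : Measurable fun q : (ℕ → ℕ) × ℕ => q.1 q.2 :=
      measurable_from_prod_countable_left fun i => measurable_pi_apply i
    have h1 : Measurable fun s : ℕ → ℕ => s (edgePos s k).1 :=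
      heval.comp (measurable_id.prodMk ih.fst)
    simp only [edgePos]
    refine Measurable.ite (measurableSet_lt ih.snd h1) ?_ ?_
    · exact ih.fst.prodMk (ih.snd.add_const 1)
    · exact (ih.fst.add_const 1).prodMk measurable_const

theorem measurable_edgeBit (k : ℕ) : Measurable fun s : ℕ → ℕ => edgeBit s k := by
  have heval : Measurable fun q : (ℕ → ℕ) × ℕ => q.1 q.2 :=
    measurable_from_prod_countable_left fun i => measurable_pi_apply i
  have h1 : Measurable fun s : ℕ → ℕ => s (edgePos s k).1 :=
    heval.comp (measurable_id.prodMk (measurable_edgePos k).fst)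
  refine measurable_to_bool ?_
  have : (fun s : ℕ → ℕ => edgeBit s k) ⁻¹' {true} =
      {s | (edgePos s k).2 < s (edgePos s k).1} := by
    ext s
    simp [edgeBit]
  rw [this]
  exact measurableSet_lt (measurable_edgePos k).snd h1

/-- The law of the offspring numbers in one layer. -/
noncomputable abbrev layerLaw (α : I) : Measure (ℕ → ℕ) :=
  Measure.infinitePi fun _ : ℕ => geometricMeasure (σ α)

section Layer

variable {α : I} (hα' : (α : ℝ) < 1)
include hα'

theorem geometric_singleton (n : ℕ) :
    geometricMeasure (σ α) {n} = ENNReal.ofReal (α ^ n * (1 - α)) := by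
  have h : (σ α : I) ≠ 0 := fun h => by
    have : (1 - (α : ℝ)) = 0 := congr_arg Subtype.val h
    linarith
  rw [geometricMeasure_singleton h]
  simp

theorem geometric_singleton_succ (n : ℕ) :
    geometricMeasure (σ α) {n + 1} = ENNReal.ofReal α * geometricMeasure (σ α) {n} := by
  rw [geometric_singleton hα', geometric_singleton hα', ← ENNReal.ofReal_mul α.2.1]
  congr 1
  ring

theorem layerLaw_zero_inter {A : Set (ℕ → ℕ)} (hA : MeasurableSet A) :
    layerLaw α {s | s 0 = 0 ∧ (fun i => s (i + 1)) ∈ A} =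
      ENNReal.ofReal (1 - α) * layerLaw α A := by
  have hinj : Function.Injective fun i : ℕ => i + 1 := fun _ _ h => Nat.succ.inj h
  have hmp := measurePreserving_reindex (geometricMeasure (σ α)) hinj
  have h0 := measurePreserving_eval_infinitePi (fun _ : ℕ => geometricMeasure (σ α)) 0
  have : {s : ℕ → ℕ | s 0 = 0 ∧ (fun i => s (i + 1)) ∈ A} =
      (fun s => s 0) ⁻¹' {0} ∩ (fun (s : ℕ → ℕ) i => s (i + 1)) ⁻¹' A := rfl
  have h0' : layerLaw α ((fun s => s 0) ⁻¹' {0}) = geometricMeasure (σ α) {0} :=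
    h0.measure_preimage (MeasurableSet.singleton 0).nullMeasurableSet
  have hm0 : MeasurableSet ((fun s : ℕ → ℕ => s 0) ⁻¹' {0}) := h0.measurable (.singleton 0)
  rw [this, infinitePi_inter_of_dependsOn (J := ({0} : Set ℕ)) hm0
    (hmp.measurable hA), hmp.measure_preimage hA.nullMeasurableSet, h0', geometric_singleton hα']
  · simp
  · intro s s' h
    simp [h 0 rfl]
  · intro s s' h
    have : (fun i => s (i + 1)) = fun i => s' (i + 1) := funext fun i => h (i + 1) (by simp)
    simp [Set.mem_preimage, this]

omit hα' in
theorem measurable_update_zero (k : ℕ) : Measurable fun s : ℕ → ℕ => Function.update s 0 k :=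
  measurable_pi_iff.2 fun i => by
    rcases eq_or_ne i 0 with rfl | hi
    · simp
    · simp only [Function.update_of_ne hi]
      exact measurable_pi_apply i

omit hα' in
theorem layerLaw_eq_inter {A : Set (ℕ → ℕ)} (hA : MeasurableSet A) (k l : ℕ) :
    layerLaw α {s | s 0 = l ∧ Function.update s 0 k ∈ A} =
      geometricMeasure (σ α) {l} * layerLaw α {s | Function.update s 0 k ∈ A} := by
  have h0 := measurePreserving_eval_infinitePi (fun _ : ℕ => geometricMeasure (σ α)) 0
  have : {s : ℕ → ℕ | s 0 = l ∧ Function.update s 0 k ∈ A} =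
      (fun s => s 0) ⁻¹' {l} ∩ {s | Function.update s 0 k ∈ A} := rfl
  have h0' : layerLaw α ((fun s => s 0) ⁻¹' {l}) = geometricMeasure (σ α) {l} :=
    h0.measure_preimage (MeasurableSet.singleton l).nullMeasurableSet
  have hm0 : MeasurableSet ((fun s : ℕ → ℕ => s 0) ⁻¹' {l}) := h0.measurable (.singleton l)
  have hmA : MeasurableSet {s : ℕ → ℕ | Function.update s 0 k ∈ A} := measurable_update_zero k hA
  rw [this, infinitePi_inter_of_dependsOn (J := ({0} : Set ℕ)) hm0 hmA, h0']
  · intro s s' h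
    simp [h 0 rfl]
  · intro s s' h
    have : Function.update s 0 k = Function.update s' 0 k := by
      funext i
      rcases eq_or_ne i 0 with rfl | hi
      · simp
      · simpa [Function.update_of_ne hi] using h i hi
    simp [Set.mem_ofPred_eq, this]

/-- Lack of memory: given that the geometric variable `s 0` is not `0`, `s 0 - 1` has the original
law, and the other coordinates are unaffected. -/
theorem layerLaw_pos_inter {A : Set (ℕ → ℕ)} (hA : MeasurableSet A) :
    layerLaw α {s | s 0 ≠ 0 ∧ Function.update s 0 (s 0 - 1) ∈ A} =
      ENNReal.ofReal α * layerLaw α A := by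
  have hm : ∀ k l, MeasurableSet {s : ℕ → ℕ | s 0 = l ∧ Function.update s 0 k ∈ A} := fun k l =>
    (measurableSet_eq_fun (measurable_pi_apply 0) measurable_const).inter
      (measurable_update_zero k hA)
  have h1 : {s : ℕ → ℕ | s 0 ≠ 0 ∧ Function.update s 0 (s 0 - 1) ∈ A} =
      ⋃ k, {s | s 0 = k + 1 ∧ Function.update s 0 k ∈ A} := by
    ext s
    simp only [Set.mem_iUnion, Set.mem_ofPred_eq]
    constructor
    · exact fun h => ⟨s 0 - 1, by omega, h.2⟩
    · rintro ⟨k, hk, h⟩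
      refine ⟨by omega, ?_⟩
      rwa [hk, Nat.add_sub_cancel]
  have h2 : A = ⋃ k, {s | s 0 = k ∧ Function.update s 0 k ∈ A} := by
    ext s
    simp [Function.update_eq_self]
  have hdisj : ∀ f : ℕ → ℕ, Function.Injective f → Pairwise (Function.onFun Disjoint
      fun k => {s : ℕ → ℕ | s 0 = f k ∧ Function.update s 0 k ∈ A}) := fun f hf k l hkl =>
    Set.disjoint_left.2 fun s hs hs' => hkl (hf (hs.1.symm.trans hs'.1))
  conv_rhs => rw [h2]
  rw [h1, measure_iUnion (hdisj _ fun _ _ h => Nat.succ.inj h) fun k => hm k _,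
    measure_iUnion (hdisj (fun k => k) Function.injective_id) fun k => hm k _,
    ← ENNReal.tsum_mul_left]
  refine tsum_congr fun k => ?_
  rw [layerLaw_eq_inter hA, layerLaw_eq_inter hA, geometric_singleton_succ hα', mul_assoc]

omit hα' in
theorem measurableSet_edgeBit (n : ℕ) (T : ℕ → Set Bool) :
    MeasurableSet {s | ∀ k < n, edgeBit s k ∈ T k} := by
  simp only [Set.ofPred_forall]
  exact .iInter fun k => .iInter fun _ => measurable_edgeBit k (Set.toFinite _).measurableSet

omit hα' in
theorem coin_apply (p : I) (T : Set Bool) [DecidablePred (· ∈ T)] :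
    (bernoulliMeasure true false p : Measure Bool) T =
      (if false ∈ T then ENNReal.ofReal (1 - p) else 0) +
        if true ∈ T then ENNReal.ofReal p else 0 := by
  have h1 : ((toNNReal p : NNReal) : ℝ≥0∞) = ENNReal.ofReal p := by
    rw [← coin_true, bernoulliMeasure_apply p (.singleton _)]
    simp
  have h2 : ((toNNReal (σ p) : NNReal) : ℝ≥0∞) = ENNReal.ofReal (1 - p) := by
    rw [← coin_false, bernoulliMeasure_apply p (.singleton _)]
    simp
  have h3 : ENNReal.ofReal (1 - p) + ENNReal.ofReal p = 1 := by
    rw [← ENNReal.ofReal_add (sub_nonneg.2 p.2.2) p.2.1, sub_add_cancel, ENNReal.ofReal_one]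
  rw [bernoulliMeasure_apply p (Set.toFinite T).measurableSet, h1, h2]
  split_ifs <;> simp [h3]

/-- Induction on the number of bits: whatever the first bit is, the remaining layer has the original
law. -/
theorem layerLaw_edgeBit (n : ℕ) (T : ℕ → Set Bool) :
    layerLaw α {s | ∀ k < n, edgeBit s k ∈ T k} =
      ∏ k ∈ Finset.range n, (bernoulliMeasure true false α : Measure Bool) (T k) := by
  classical
  induction n generalizing T with
  | zero => simp
  | succ n ih =>
    have hm := measurableSet_edgeBit n fun k => T (k + 1)
    have h1 : {s | ∀ k < n + 1, edgeBit s k ∈ T k} =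
        {s | false ∈ T 0 ∧ s 0 = 0 ∧
          (fun i => s (i + 1)) ∈ {s | ∀ k < n, edgeBit s k ∈ T (k + 1)}} ∪
        {s | true ∈ T 0 ∧ s 0 ≠ 0 ∧
          Function.update s 0 (s 0 - 1) ∈ {s | ∀ k < n, edgeBit s k ∈ T (k + 1)}} := by
      ext s
      have hall : (∀ k < n + 1, edgeBit s k ∈ T k) ↔
          edgeBit s 0 ∈ T 0 ∧ ∀ k < n, edgeBit s (k + 1) ∈ T (k + 1) :=
        ⟨fun h => ⟨h 0 (by omega), fun k hk => h _ (by omega)⟩, fun h k hk => by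
          cases k with
          | zero => exact h.1
          | succ k => exact h.2 k (by omega)⟩
      simp only [Set.mem_union, Set.mem_ofPred_eq, hall, edgeBit_zero]
      by_cases h0 : s 0 = 0
      · simp [h0, edgeBit_succ_of_zero h0]
      · simp [h0, edgeBit_succ_of_pos h0]
    have hup : Measurable fun s : ℕ → ℕ => Function.update s 0 (s 0 - 1) :=
      measurable_pi_iff.2 fun i => by
        rcases eq_or_ne i 0 with rfl | hi
        · simp only [Function.update_self]
          exact (measurable_pi_apply 0).sub_const 1
        · simp only [Function.update_of_ne hi]
          exact measurable_pi_apply i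
    have hm2 : MeasurableSet {s : ℕ → ℕ | true ∈ T 0 ∧ s 0 ≠ 0 ∧
        Function.update s 0 (s 0 - 1) ∈ {s | ∀ k < n, edgeBit s k ∈ T (k + 1)}} :=
      (MeasurableSet.const _).inter
        ((measurableSet_eq_fun (measurable_pi_apply 0) measurable_const).compl.inter (hup hm))
    rw [h1, measure_union (Set.disjoint_left.2 fun s hs hs' => hs'.2.1 hs.2.1) hm2,
      Finset.prod_range_succ', ← ih fun k => T (k + 1), coin_apply, mul_comm, add_mul]
    congr 1
    · split_ifs with h
      · simpa [h] using layerLaw_zero_inter hα' hm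
      · simp [h]
    · split_ifs with h
      · simpa [h] using layerLaw_pos_inter hα' hm
      · simp [h]

theorem map_edgeBit :
    (layerLaw α).map edgeBit = Measure.infinitePi fun _ => bernoulliMeasure true false α := by
  classical
  refine Measure.eq_infinitePi _ fun s t ht => ?_
  have hm : Measurable edgeBit := measurable_pi_iff.2 measurable_edgeBit
  rw [Measure.map_apply hm (.pi s.countable_toSet fun i _ => ht i)]
  obtain ⟨n, hn⟩ : ∃ n, s ⊆ Finset.range n := s.exists_nat_subset_range
  have h1 : edgeBit ⁻¹' (s : Set ℕ).pi t =
      {x | ∀ k < n, edgeBit x k ∈ if k ∈ s then t k else Set.univ} := by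
    ext x
    simp only [Set.mem_preimage, Set.mem_pi, Finset.mem_coe, Set.mem_ofPred_eq]
    constructor
    · intro h k _
      split_ifs with hk
      · exact h k hk
      · trivial
    · intro h k hk
      simpa [hk] using h k (Finset.mem_range.1 (hn hk))
  rw [h1, layerLaw_edgeBit hα' n fun k => if k ∈ s then t k else Set.univ,
    ← Finset.prod_subset hn (f := fun k => (bernoulliMeasure true false α : Measure Bool)
      (if k ∈ s then t k else Set.univ))]
  · exact Finset.prod_congr rfl fun k hk => by rw [if_pos hk]
  · intro k _ hk
    rw [if_neg hk, measure_univ]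

end Layer

instance (α : I) : IsProbabilityMeasure (galtonWatson α) := by
  unfold galtonWatson
  infer_instance

instance (p : I) : IsProbabilityMeasure (percolation p) := by
  unfold percolation
  infer_instance

/-! ### The half-plane percolation on a tree and its coding -/

/-- The bits coding a tree. -/
def treeBits (t : PlaneTree) : ℕ × ℕ → Bool := fun e => edgeBit (fun i => t (e.1, i)) e.2

/-- The states of the edges in the coding by bits. -/
def edgeStates (t : PlaneTree) (ω : (ℕ × ℕ) × ℕ → Bool) : ℕ × ℕ → Bool := fun e =>
  ω ((e.1, (edgePos (fun i => t (e.1, i)) e.2).1), (edgePos (fun i => t (e.1, i)) e.2).2)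

/-- Open edges in the triangulation of a half-plane that is obtained without taking the widths of
the generations into account. -/
def LinEdge (t : PlaneTree) (ω : (ℕ × ℕ) × ℕ → Bool) (v w : ℕ × ℕ) : Prop :=
  ∃ j ≤ t v, ω (v, j) = true ∧ w = (v.1 + 1, firstChild t v.1 v.2 + j)

/-- The cluster of `v` in the half-plane. -/
def linCluster (t : PlaneTree) (ω : (ℕ × ℕ) × ℕ → Bool) (v : ℕ × ℕ) : Set (ℕ × ℕ) :=
  {w | Relation.ReflTransGen (LinEdge t ω) v w}

theorem botIdx_treeBits (t : PlaneTree) (r k : ℕ) :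
    botIdx (treeBits t) r k = (edgePos (fun i => t (r, i)) k).1 := by
  induction k with
  | zero => rfl
  | succ k ih =>
    rw [edgePos]
    split_ifs with h
    · rw [botIdx_succ_true (by simpa [treeBits, edgeBit] using h), ih]
    · rw [botIdx_succ_false (by simpa [treeBits, edgeBit] using h), ih]

theorem topIdx_treeBits (t : PlaneTree) (r k : ℕ) :
    topIdx (treeBits t) r k = firstChild t r (edgePos (fun i => t (r, i)) k).1 +
      (edgePos (fun i => t (r, i)) k).2 := by
  have h1 := botIdx_add_topIdx (treeBits t) r k
  have h2 := edgePos_sum (fun i => t (r, i)) k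
  rw [botIdx_treeBits] at h1
  rw [firstChild]
  omega

theorem linEdge_iff (t : PlaneTree) (ω : (ℕ × ℕ) × ℕ → Bool) (v w : ℕ × ℕ) :
    LinEdge t ω v w ↔ BitEdge (treeBits t) (edgeStates t ω) v w := by
  obtain ⟨r, i⟩ := v
  simp only [LinEdge, BitEdge, botIdx_treeBits, topIdx_treeBits, edgeStates]
  constructor
  · rintro ⟨j, hj, ho, rfl⟩
    obtain ⟨k, hk⟩ := exists_edgePos_eq (fun i => t (r, i)) i hj
    exact ⟨k, by rw [hk], by rw [hk], by rwa [hk]⟩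
  · rintro ⟨k, rfl, rfl, ho⟩
    exact ⟨_, edgePos_le (fun i => t (r, i)) k, ho, rfl⟩

theorem linCluster_zero (t : PlaneTree) (ω : (ℕ × ℕ) × ℕ → Bool) :
    linCluster t ω (0, 0) = bitCluster (treeBits t) (edgeStates t ω) := by
  have : LinEdge t ω = BitEdge (treeBits t) (edgeStates t ω) := by
    funext v w
    exact propext (linEdge_iff t ω v w)
  rw [linCluster, bitCluster, this]

theorem measurable_treeBits : Measurable treeBits :=
  measurable_pi_iff.2 fun e => (measurable_edgeBit e.2).comp
    (measurable_pi_iff.2 fun i => measurable_pi_apply (e.1, i))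

theorem measurable_edgeStates :
    Measurable fun x : PlaneTree × ((ℕ × ℕ) × ℕ → Bool) => edgeStates x.1 x.2 := by
  have heval : Measurable fun q : ((ℕ × ℕ) × ℕ → Bool) × ((ℕ × ℕ) × ℕ) => q.1 q.2 :=
    measurable_from_prod_countable_left fun i => measurable_pi_apply i
  refine measurable_pi_iff.2 fun e => heval.comp (measurable_snd.prodMk ?_)
  have : Measurable fun x : PlaneTree × ((ℕ × ℕ) × ℕ → Bool) =>
      edgePos (fun i => x.1 (e.1, i)) e.2 :=
    (measurable_edgePos e.2).comp (measurable_pi_iff.2 fun i =>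
      (measurable_pi_apply (e.1, i)).comp measurable_fst)
  exact (measurable_const.prodMk this.fst).prodMk this.snd

theorem measurePreserving_treeBits {α : I} (hα' : (α : ℝ) < 1) :
    MeasurePreserving treeBits (galtonWatson α) (coins α) := by
  refine ⟨measurable_treeBits, ?_⟩
  have h1 := Measure.infinitePi_map_curry fun _ _ : ℕ => geometricMeasure (σ α)
  have h2 := Measure.infinitePi_map_curry_symm fun _ _ : ℕ =>
    (bernoulliMeasure true false α : Measure Bool)
  have hm : Measurable edgeBit := measurable_pi_iff.2 measurable_edgeBit
  have h3 := Measure.infinitePi_map_pi (fun _ : ℕ => layerLaw α) (f := fun _ => edgeBit)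
    fun _ => hm
  simp_rw [map_edgeBit hα'] at h3
  have hm' : Measurable fun (x : ℕ → ℕ → ℕ) i => edgeBit (x i) :=
    measurable_pi_iff.2 fun i => hm.comp (measurable_pi_apply i)
  rw [galtonWatson, coins, ← h2, ← h3, ← h1, Measure.map_map hm' (MeasurableEquiv.measurable _),
    Measure.map_map (MeasurableEquiv.measurable _) (hm'.comp (MeasurableEquiv.measurable _))]
  rfl

/-- The half-plane percolation on a Galton-Watson tree is coded by independent bits. -/
theorem measurePreserving_bits {α : I} (hα' : (α : ℝ) < 1) (p : I) :
    MeasurePreserving (fun x : PlaneTree × ((ℕ × ℕ) × ℕ → Bool) =>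
      (treeBits x.1, edgeStates x.1 x.2)) ((galtonWatson α).prod (percolation p)) (bits α p) := by
  have hm : Measurable fun x : PlaneTree × ((ℕ × ℕ) × ℕ → Bool) =>
      (treeBits x.1, edgeStates x.1 x.2) :=
    (measurable_treeBits.comp measurable_fst).prodMk measurable_edgeStates
  refine ⟨hm, (Measure.prod_eq fun A C hA hC => ?_).symm⟩
  -- For each tree the coding reads the states at distinct places, so they remain i.i.d. with a law
  -- that does not depend on the tree; hence the two bit arrays are independent.
  have key : ∀ t, percolation p {ω | edgeStates t ω ∈ C} = coins p C := fun t => by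
    have hinj : Function.Injective fun e : ℕ × ℕ =>
        (((e.1, (edgePos (fun i => t (e.1, i)) e.2).1), (edgePos (fun i => t (e.1, i)) e.2).2) :
          (ℕ × ℕ) × ℕ) := by
      rintro ⟨r, k⟩ ⟨r', k'⟩ h
      simp only [Prod.mk.injEq] at h
      obtain ⟨⟨rfl, h1⟩, h2⟩ := h
      rw [edgePos_injective _ (Prod.ext h1 h2)]
    exact (measurePreserving_reindex (bernoulliMeasure true false p : Measure Bool)
      hinj).measure_preimage hC.nullMeasurableSet
  rw [Measure.map_apply hm (hA.prod hC), Measure.prod_apply (hm (hA.prod hC)),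
    ← (measurePreserving_treeBits hα').measure_preimage hA.nullMeasurableSet, mul_comm,
    ← lintegral_indicator_const (measurable_treeBits hA)]
  refine lintegral_congr fun t => ?_
  by_cases ht : t ∈ treeBits ⁻¹' A
  · rw [Set.indicator_of_mem ht, ← key t]
    congr 1
    ext ω
    simp only [Set.mem_preimage, Set.mem_prod, Set.mem_ofPred_eq]
    exact and_iff_right ht
  · rw [Set.indicator_of_notMem ht]
    convert measure_empty (μ := percolation p)
    ext ω
    simp only [Set.mem_preimage, Set.mem_prod, Set.mem_empty_iff_false, iff_false, not_and]
    exact fun h => absurd h ht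

/-! ### Measurability of reachability and of cluster sizes -/

section Measurability

variable {X V : Type*} [MeasurableSpace X] [Countable V]

theorem measurableSet_reflTransGen {E : X → V → V → Prop}
    (hE : ∀ v w, MeasurableSet {x | E x v w}) (a v : V) :
    MeasurableSet {x | Relation.ReflTransGen (E x) a v} := by
  let R : ℕ → V → Set X := fun n => Nat.rec (fun v => {_x | v = a})
    (fun _ S v => ⋃ u, S u ∩ {x | E x u v}) n
  have hR : ∀ n v, MeasurableSet (R n v) := fun n => by
    induction n with
    | zero => exact fun v => .const _
    | succ n ih => exact fun v => .iUnion fun u => (ih u).inter (hE u v)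
  have h : {x | Relation.ReflTransGen (E x) a v} = ⋃ n, R n v := by
    ext x
    simp only [Set.mem_ofPred_eq, Set.mem_iUnion]
    constructor
    · intro hx
      induction hx with
      | refl => exact ⟨0, rfl⟩
      | tail _ he ih =>
        obtain ⟨n, hn⟩ := ih
        exact ⟨n + 1, Set.mem_iUnion.2 ⟨_, hn, he⟩⟩
    · rintro ⟨n, hn⟩
      induction n generalizing v with
      | zero => exact (show v = a from hn) ▸ .refl
      | succ n ih =>
        obtain ⟨u, hu, he⟩ := Set.mem_iUnion.1 hn
        exact (ih u hu).tail he
  rw [h]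
  exact .iUnion fun n => hR n v

theorem measurableSet_le_encard {C : X → Set V} (hC : ∀ v, MeasurableSet {x | v ∈ C x}) (n : ℕ) :
    MeasurableSet {x | (n : ℕ∞) ≤ (C x).encard} := by
  have h : {x | (n : ℕ∞) ≤ (C x).encard} =
      ⋃ s : {s : Finset V // s.card = n}, ⋂ v ∈ s.1, {x | v ∈ C x} := by
    ext x
    simp only [Set.mem_ofPred_eq, Set.mem_iUnion, Set.mem_iInter]
    constructor
    · intro hx
      obtain ⟨s, hs, hn⟩ := Set.exists_subset_encard_eq hx
      have hf : s.Finite := Set.finite_of_encard_eq_coe hn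
      refine ⟨⟨hf.toFinset, ?_⟩, fun v hv => hs (hf.mem_toFinset.1 hv)⟩
      rw [hf.encard_eq_coe_toFinset_card] at hn
      exact_mod_cast hn
    · rintro ⟨⟨s, hs⟩, hx⟩
      rw [← hs, ← Set.encard_coe_eq_coe_finsetCard]
      exact Set.encard_le_encard fun v hv => hx v hv
  rw [h]
  exact .iUnion fun s => .biInter s.1.countable_toSet fun v _ => hC v

omit [MeasurableSpace X] [Countable V] in
theorem infinite_eq_iInter (C : X → Set V) :
    {x | (C x).Infinite} = ⋂ n : ℕ, {x | (n : ℕ∞) ≤ (C x).encard} := by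
  ext x
  simp only [Set.mem_ofPred_eq, Set.mem_iInter]
  rw [← Set.encard_eq_top_iff, ENat.eq_top_iff_forall_ge]

theorem measurableSet_infinite {C : X → Set V} (hC : ∀ v, MeasurableSet {x | v ∈ C x}) :
    MeasurableSet {x | (C x).Infinite} := by
  rw [infinite_eq_iInter]
  exact .iInter fun n => measurableSet_le_encard hC n

end Measurability

/-! ### Shifting generations, independence, and conditioning on survival -/

/-- Trees together with states of edges. -/
abbrev TreeStates : Type := PlaneTree × ((ℕ × ℕ) × ℕ → Bool)

theorem measurable_firstChild (r i : ℕ) : Measurable fun t : PlaneTree => firstChild t r i :=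
  Finset.measurable_fun_sum _ fun _ _ => measurable_pi_apply _

theorem measurable_width (r : ℕ) : Measurable fun t : PlaneTree => width t r := by
  induction r with
  | zero => exact measurable_const
  | succ r ih =>
    have h : Measurable fun q : PlaneTree × ℕ => firstChild q.1 r q.2 :=
      measurable_from_prod_countable_left fun i => measurable_firstChild r i
    exact h.comp (measurable_id.prodMk ih)

theorem measurableSet_survives : MeasurableSet {t | Survives t} := by
  simp only [Survives, Set.ofPred_forall]
  exact .iInter fun r => measurableSet_lt measurable_const (measurable_width r)

theorem measurableSet_state (e : (ℕ × ℕ) × ℕ) : MeasurableSet {x : TreeStates | x.2 e = true} :=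
  measurable_snd (measurableSet_eval_eq e true)

theorem measurableSet_linEdge (v w : ℕ × ℕ) :
    MeasurableSet {x : TreeStates | LinEdge x.1 x.2 v w} := by
  simp only [LinEdge, Set.ofPred_exists]
  refine .iUnion fun j => .inter ?_ (.inter (measurableSet_state _) ?_)
  · exact measurableSet_le measurable_const ((measurable_pi_apply v).comp measurable_fst)
  · exact measurableSet_eq_fun measurable_const (measurable_const.prodMk
      (((measurable_firstChild v.1 v.2).comp measurable_fst).add_const j))

theorem measurableSet_mem_linCluster (v w : ℕ × ℕ) :
    MeasurableSet {x : TreeStates | w ∈ linCluster x.1 x.2 v} :=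
  measurableSet_reflTransGen measurableSet_linEdge v w

theorem measurableSet_openEdge (v w : ℕ × ℕ) :
    MeasurableSet {x : TreeStates | OpenEdge x.1 x.2 v w} := by
  simp only [OpenEdge, Set.ofPred_exists]
  refine .iUnion fun j => .inter ?_ (.inter (measurableSet_state _) ?_)
  · have : Measurable fun t : PlaneTree => upDegree t v := by
      unfold upDegree
      split_ifs
      · exact measurable_pi_apply v
      · exact (measurable_pi_apply v).add_const 1
    exact measurableSet_lt measurable_const (this.comp measurable_fst)
  · have hmod : Measurable fun q : ℕ × ℕ => q.1 % q.2 := measurable_of_countable _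
    have : Measurable fun t : PlaneTree => (firstChild t v.1 v.2 + j) % width t (v.1 + 1) :=
      hmod.comp (((measurable_firstChild v.1 v.2).add_const j).prodMk (measurable_width (v.1 + 1)))
    exact measurableSet_eq_fun measurable_const
      (measurable_const.prodMk (this.comp measurable_fst))

theorem measurableSet_mem_cluster (v : ℕ × ℕ) :
    MeasurableSet {x : TreeStates | v ∈ cluster x.1 x.2} :=
  measurableSet_reflTransGen measurableSet_openEdge (0, 0) v

/-- The part of the tree array above generation `r`. -/
def shiftTree (r : ℕ) (t : PlaneTree) : PlaneTree := fun e => t (r + e.1, e.2)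

/-- The states of edges above generation `r`. -/
def shiftStates (r : ℕ) (ω : (ℕ × ℕ) × ℕ → Bool) : (ℕ × ℕ) × ℕ → Bool :=
  fun e => ω ((r + e.1.1, e.1.2), e.2)

theorem linEdge_shift (r : ℕ) (t : PlaneTree) (ω : (ℕ × ℕ) × ℕ → Bool) (v w : ℕ × ℕ) :
    LinEdge (shiftTree r t) (shiftStates r ω) v w ↔
      LinEdge t ω (r + v.1, v.2) (r + w.1, w.2) := by
  simp only [LinEdge, shiftTree, shiftStates, firstChild, Prod.ext_iff]
  refine exists_congr fun j => and_congr_right fun _ => and_congr_right fun _ =>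
    and_congr_left fun _ => ?_
  omega

theorem linCluster_shift (r : ℕ) (t : PlaneTree) (ω : (ℕ × ℕ) × ℕ → Bool) (i : ℕ) :
    linCluster t ω (r, i) = (fun e : ℕ × ℕ => (r + e.1, e.2)) ''
      linCluster (shiftTree r t) (shiftStates r ω) (0, i) := by
  ext w
  constructor
  · intro hw
    induction hw with
    | refl => exact ⟨(0, i), .refl, rfl⟩
    | @tail u w _ he ih =>
      obtain ⟨u, hu, rfl⟩ := ih
      obtain ⟨j, hj, ho, rfl⟩ := id he
      exact ⟨(u.1 + 1, _), hu.tail ((linEdge_shift r t ω u (u.1 + 1, _)).2 he), rfl⟩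
  · rintro ⟨w, hw, rfl⟩
    induction hw with
    | refl => exact .refl
    | tail _ he ih => exact ih.tail ((linEdge_shift r t ω _ _).1 he)

theorem encard_linCluster_shift (r : ℕ) (t : PlaneTree) (ω : (ℕ × ℕ) × ℕ → Bool) (i : ℕ) :
    (linCluster t ω (r, i)).encard =
      (linCluster (shiftTree r t) (shiftStates r ω) (0, i)).encard := by
  rw [linCluster_shift]
  refine Function.Injective.encard_image ?_ _
  rintro ⟨a, b⟩ ⟨c, d⟩ h
  simp only [Prod.mk.injEq] at h
  exact Prod.ext (by simpa using h.1) h.2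

/-- A Galton-Watson tree and independent states of edges. -/
noncomputable def treeLaw (α p : I) : Measure TreeStates := (galtonWatson α).prod (percolation p)

instance (α p : I) : IsProbabilityMeasure (treeLaw α p) := by
  unfold treeLaw
  infer_instance

theorem measurePreserving_shift (α p : I) (r : ℕ) :
    MeasurePreserving (fun x : TreeStates => (shiftTree r x.1, shiftStates r x.2))
      (treeLaw α p) (treeLaw α p) := by
  have h1 : Function.Injective fun e : ℕ × ℕ => (r + e.1, e.2) := by
    rintro ⟨a, b⟩ ⟨c, d⟩ h
    simp only [Prod.mk.injEq] at h
    exact Prod.ext (by simpa using h.1) h.2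
  have h2 : Function.Injective fun e : (ℕ × ℕ) × ℕ => ((r + e.1.1, e.1.2), e.2) := by
    rintro ⟨a, b⟩ ⟨c, d⟩ h
    simp only [Prod.mk.injEq] at h
    exact Prod.ext (h1 (Prod.ext h.1.1 h.1.2)) h.2
  exact (measurePreserving_reindex (geometricMeasure (σ α)) h1).prod
    (measurePreserving_reindex (bernoulliMeasure true false p : Measure Bool) h2)

theorem measurableSet_le_encard_linCluster (n : ℕ) (v : ℕ × ℕ) :
    MeasurableSet {x : TreeStates | (n : ℕ∞) ≤ (linCluster x.1 x.2 v).encard} :=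
  measurableSet_le_encard (fun w => measurableSet_mem_linCluster v w) n

theorem measurableSet_bitEdge (v w : ℕ × ℕ) : MeasurableSet {x : BitPair | BitEdge x.1 x.2 v w} := by
  have hb : ∀ r k, Measurable fun x : BitPair => botIdx x.1 r k := fun r k =>
    Finset.measurable_fun_sum _ fun i _ => (measurable_of_countable fun v : Bool =>
      if v = true then 0 else 1).comp ((measurable_pi_apply (r, i)).comp measurable_fst)
  have ht : ∀ r k, Measurable fun x : BitPair => topIdx x.1 r k := fun r k =>
    Finset.measurable_fun_sum _ fun i _ => (measurable_of_countable fun v : Bool =>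
      if v = true then 1 else 0).comp ((measurable_pi_apply (r, i)).comp measurable_fst)
  simp only [BitEdge, Set.ofPred_exists]
  refine .iUnion fun k => .inter (measurableSet_eq_fun measurable_const (hb _ _)) (.inter ?_ ?_)
  · exact measurableSet_eq_fun measurable_const (measurable_const.prodMk (ht _ _))
  · exact measurable_snd (measurableSet_eval_eq _ true)

theorem measurableSet_mem_bitCluster (v : ℕ × ℕ) :
    MeasurableSet {x : BitPair | v ∈ bitCluster x.1 x.2} :=
  measurableSet_reflTransGen measurableSet_bitEdge (0, 0) v

section Transfer

variable {α : I} (hα' : (α : ℝ) < 1) (p : I)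
include hα'

theorem measurePreserving_shift_bits (r : ℕ) :
    MeasurePreserving (fun x : TreeStates => (treeBits (shiftTree r x.1),
      edgeStates (shiftTree r x.1) (shiftStates r x.2))) (treeLaw α p) (bits α p) :=
  (measurePreserving_bits hα' p).comp (measurePreserving_shift α p r)

/-- Half-plane clusters only look upwards, and the array of offspring numbers above generation `r`
has the law of the whole array. -/
theorem treeLaw_large_linCluster (r n : ℕ) :
    (treeLaw α p).real {x | (n : ℕ∞) ≤ (linCluster x.1 x.2 (r, 0)).encard} = bitTail α p n := by
  rw [bitTail, measureReal_def, measureReal_def,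
    ← (measurePreserving_shift_bits hα' p r).measure_preimage
      (measurableSet_le_encard measurableSet_mem_bitCluster n).nullMeasurableSet]
  simp only [encard_linCluster_shift, linCluster_zero]
  rfl

theorem treeLaw_infinite_linCluster (r : ℕ) :
    (treeLaw α p).real {x | (linCluster x.1 x.2 (r, 0)).Infinite} =
      (bits α p).real {x | (bitCluster x.1 x.2).Infinite} := by
  rw [measureReal_def, measureReal_def,
    ← (measurePreserving_shift_bits hα' p r).measure_preimage
      (measurableSet_infinite measurableSet_mem_bitCluster).nullMeasurableSet]
  simp only [← Set.encard_eq_top_iff, encard_linCluster_shift, linCluster_zero]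
  rfl

end Transfer

section Independence

variable {α p : I} {J : Set (ℕ × ℕ)}

theorem treeLaw_inter {A B : Set TreeStates} (hA : MeasurableSet A) (hB : MeasurableSet B)
    (hAJ : DependsOn₂ A J (Prod.fst ⁻¹' J)) (hBJ : DependsOn₂ B Jᶜ (Prod.fst ⁻¹' Jᶜ)) :
    treeLaw α p (A ∩ B) = treeLaw α p A * treeLaw α p B :=
  prod_infinitePi_inter hA hB hAJ hBJ

theorem setLIntegral_of_dependsOn {A : Set TreeStates} {f : TreeStates → ℝ≥0∞}
    (hA : MeasurableSet A) (hf : Measurable f) (hAJ : DependsOn₂ A J (Prod.fst ⁻¹' J))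
    (hfJ : ∀ x x' : TreeStates, (∀ e ∉ J, x.1 e = x'.1 e) →
      (∀ e : (ℕ × ℕ) × ℕ, e.1 ∉ J → x.2 e = x'.2 e) → f x = f x') :
    ∫⁻ x in A, f x ∂treeLaw α p = treeLaw α p A * ∫⁻ x, f x ∂treeLaw α p := by
  have h1 : Measurable (A.indicator (1 : TreeStates → ℝ≥0∞)) := measurable_one.indicator hA
  rw [← lintegral_indicator hA, ← lintegral_indicator_one hA,
    ← lintegral_mul_eq_lintegral_mul_lintegral_of_indepFun'' h1.aemeasurable hf.aemeasurable]
  · refine lintegral_congr fun x => ?_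
    by_cases hx : x ∈ A <;> simp [hx]
  · rw [indepFun_iff_measure_inter_preimage_eq_mul]
    intro S T hS hT
    refine treeLaw_inter (J := J) (h1 hS) (hf hT) ?_ ?_
    · intro x x' ht ho hx
      have : x ∈ A ↔ x' ∈ A := ⟨hAJ x x' ht ho, hAJ x' x (fun e he => (ht e he).symm)
        fun e he => (ho e he).symm⟩
      rw [Set.mem_preimage] at hx ⊢
      rwa [← Set.indicator_eq_indicator (f := (1 : TreeStates → ℝ≥0∞)) this rfl]
    · intro x x' ht ho hx
      rw [Set.mem_preimage] at hx ⊢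
      rwa [← hfJ x x' ht ho]

end Independence

/-- The generating function of the offspring distribution. -/
noncomputable def offspringGen (α : I) (y : ℝ≥0∞) : ℝ≥0∞ :=
  ∫⁻ k, y ^ k ∂geometricMeasure (σ α)

theorem lintegral_pow_sum (α : I) (y : ℝ≥0∞) (s : Finset (ℕ × ℕ)) :
    ∫⁻ t, y ^ (∑ e ∈ s, t e) ∂galtonWatson α = offspringGen α y ^ s.card := by
  have hmeas : Measurable fun k : ℕ => y ^ k := measurable_of_countable _
  have hind : iIndepFun (fun (e : ℕ × ℕ) (t : PlaneTree) => y ^ t e) (galtonWatson α) :=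
    iIndepFun_infinitePi (P := fun _ : ℕ × ℕ => geometricMeasure (σ α)) fun _ => hmeas
  simp_rw [← Finset.prod_pow_eq_pow_sum]
  rw [lintegral_prod_eq_prod_lintegral_of_indepFun s _ hind fun e =>
    hmeas.comp (measurable_pi_apply e), ← Finset.prod_const]
  refine Finset.prod_congr rfl fun e _ => ?_
  exact (measurePreserving_eval_infinitePi (fun _ : ℕ × ℕ => geometricMeasure (σ α)) e).lintegral_comp
    hmeas

theorem lintegral_pow_sum_treeLaw (α p : I) (y : ℝ≥0∞) (s : Finset (ℕ × ℕ)) :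
    ∫⁻ x, y ^ (∑ e ∈ s, x.1 e) ∂treeLaw α p = offspringGen α y ^ s.card := by
  rw [← lintegral_pow_sum, treeLaw, measurePreserving_fst.lintegral_comp
    (f := fun t : PlaneTree => y ^ (∑ e ∈ s, t e))]
  exact (measurable_of_countable fun k : ℕ => y ^ k).comp
    (Finset.measurable_fun_sum _ fun e _ => measurable_pi_apply e)

theorem offspringGen_ofReal {α : I} (hα' : (α : ℝ) < 1) {y : ℝ} (hy : 0 ≤ y) (hy1 : y ≤ 1) :
    offspringGen α (ENNReal.ofReal y) = ENNReal.ofReal ((1 - α) / (1 - α * y)) := by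
  have hα := α.2.1
  have h1 : (α : ℝ) * y < 1 := by nlinarith
  have h2 : HasSum (fun k : ℕ => (α : ℝ) ^ k * (1 - α) * y ^ k) ((1 - α) / (1 - α * y)) := by
    have := (hasSum_geometric_of_lt_one (mul_nonneg hα hy) h1).mul_left (1 - (α : ℝ))
    rw [← div_eq_mul_inv] at this
    convert! this using 2 with k
    rw [mul_pow]
    ring
  rw [offspringGen, lintegral_countable', ← h2.tsum_eq, ENNReal.ofReal_tsum_of_nonneg _ h2.summable]
  · refine tsum_congr fun k => ?_
    rw [geometric_singleton hα', ← ENNReal.ofReal_pow hy, mul_comm,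
      ← ENNReal.ofReal_mul (mul_nonneg (pow_nonneg hα k) (by linarith))]
  · exact fun k => mul_nonneg (mul_nonneg (pow_nonneg hα k) (by linarith)) (pow_nonneg hy k)

/-- Conditioning costs a constant factor, so that all estimates can be made under the product law,
where the generations are independent. -/
theorem annealed_apply (α p : I) (E : Set TreeStates) :
    annealed α p E = (galtonWatson α {t | Survives t})⁻¹ *
      treeLaw α p (E ∩ {x | Survives x.1}) := by
  rw [annealed, survivingTree, ProbabilityTheory.cond, Measure.prod_smul_left, Measure.smul_apply, smul_eq_mul,
    ← Measure.restrict_univ (μ := percolation p), Measure.prod_restrict,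
    Measure.restrict_apply' (measurableSet_survives.prod .univ)]
  congr 3
  ext x
  simp

/-! ### The gap on the right of the cluster and the probability of winding around -/

section Deterministic

variable {t t' : PlaneTree} {ω ω' : (ℕ × ℕ) × ℕ → Bool}

theorem firstChild_succ (t : PlaneTree) (r i : ℕ) :
    firstChild t r (i + 1) = firstChild t r i + t (r, i) :=
  Finset.sum_range_succ _ _

theorem firstChild_mono (t : PlaneTree) (r : ℕ) : Monotone (firstChild t r) := fun _ _ h =>
  Finset.sum_le_sum_of_subset (Finset.range_subset_range.2 h)

theorem firstChild_width (t : PlaneTree) (r : ℕ) : firstChild t r (width t r) = width t (r + 1) :=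
  rfl

theorem upDegree_le (t : PlaneTree) (v : ℕ × ℕ) : upDegree t v ≤ t v + 1 := by
  unfold upDegree
  split_ifs <;> omega

theorem width_pos_of_succ {r : ℕ} (h : 0 < width t (r + 1)) : 0 < width t r := by
  by_contra! h0
  rw [width, Nat.le_zero.1 h0] at h
  simp at h

theorem firstChild_congr {r : ℕ} (h : ∀ i, t (r, i) = t' (r, i)) (i : ℕ) :
    firstChild t r i = firstChild t' r i :=
  Finset.sum_congr rfl fun j _ => h j

theorem width_congr {r : ℕ} (h : ∀ e : ℕ × ℕ, e.1 < r → t e = t' e) : width t r = width t' r := by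
  induction r with
  | zero => rfl
  | succ r ih =>
    rw [width, width, ih fun e he => h e (by omega)]
    exact firstChild_congr (fun i => h (r, i) (by simp)) _

theorem cluster_congr {r : ℕ} (h : ∀ e : ℕ × ℕ, e.1 < r → t e = t' e)
    (h' : ∀ e : (ℕ × ℕ) × ℕ, e.1.1 < r → ω e = ω' e) {v : ℕ × ℕ} (hv : v ∈ cluster t ω)
    (hr : v.1 ≤ r) : v ∈ cluster t' ω' := by
  induction hv with
  | refl => exact .refl
  | @tail u v _ he ih =>
    obtain ⟨j, hj, ho, rfl⟩ := he
    simp only [upNeighbour] at hr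
    refine (ih (by omega)).tail ⟨j, ?_, ?_, ?_⟩
    · unfold upDegree at hj ⊢
      rwa [← h u (by omega)]
    · rw [← h' _ (by simpa using hr), ho]
    · rw [upNeighbour, upNeighbour, firstChild_congr fun i => h (u.1, i) (by simpa using hr),
        width_congr fun e he => h e (by omega)]

/-- There is an open edge from the cluster that winds around the triangulation and leads to the
leftmost vertex of generation `r`. For `r = 0` this is the root, without any condition. -/
def Wraps (t : PlaneTree) (ω : (ℕ × ℕ) × ℕ → Bool) : ℕ → Prop
  | 0 => True
  | r + 1 => ∃ i j, (r, i) ∈ cluster t ω ∧ j < upDegree t (r, i) ∧ ω ((r, i), j) = true ∧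
      firstChild t r i + j = width t (r + 1)

/-- One step of `gap`. -/
def nextGap (e r w g : ℕ) (x : TreeStates) : ℕ :=
  if g ≤ e ∧ x.1 (r, w - 1) = e + 2 ∧ ∀ j ≤ e + 2, x.2 ((r, w - 1), j) = false then e + 1
  else (∑ i ∈ Finset.Ico (w - g) w, x.1 (r, i)) - 1

/-- A number of vertices on the right of generation `r` that are outside the cluster, computed
recursively. -/
def gap (e : ℕ) (x : TreeStates) : ℕ → ℕ
  | 0 => 0
  | r + 1 => nextGap e r (width x.1 r) (gap e x r) x

theorem firstChild_add_sum_Ico (t : PlaneTree) (r : ℕ) {a b : ℕ} (h : a ≤ b) :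
    firstChild t r a + ∑ i ∈ Finset.Ico a b, t (r, i) = firstChild t r b :=
  Finset.sum_range_add_sum_Ico _ h

theorem target_le {u : ℕ × ℕ} {j : ℕ} (hj : j < upDegree t u) :
    firstChild t u.1 u.2 + j ≤ firstChild t u.1 (u.2 + 1) := by
  obtain ⟨r, i⟩ := u
  have := upDegree_le t (r, i)
  change firstChild t r i + j ≤ firstChild t r (i + 1)
  rw [firstChild_succ]
  omega

/-- The last edge of a vertex reaches at most the first child of the next one, so the children of
the `g` rightmost vertices are missed except possibly the first: hence the `- 1`. In the special
case the rightmost vertex has only closed edges, and all of its `e + 2` children but the first are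
missed. -/
theorem target_add_gap (e : ℕ) {u : ℕ × ℕ} {j : ℕ} (hw : 0 < width t (u.1 + 1))
    (hu : u.2 + gap e (t, ω) u.1 < width t u.1) (hj : j < upDegree t u) (ho : ω (u, j) = true) :
    firstChild t u.1 u.2 + j + gap e (t, ω) (u.1 + 1) < width t (u.1 + 1) ∨
      gap e (t, ω) (u.1 + 1) = 0 := by
  obtain ⟨r, i⟩ := u
  have h1 := target_le hj
  have h4 := upDegree_le t (r, i)
  simp only [gap, nextGap] at hu h1 ⊢
  rw [show width t (r + 1) = firstChild t r (width t r) from rfl]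
  generalize width t r = w at hu h1 hw ⊢
  generalize gap e (t, ω) r = g at hu ⊢
  split_ifs with h
  · left
    obtain ⟨-, h2, h3⟩ := h
    have hi : i ≠ w - 1 := by
      rintro rfl
      rw [h3 j (by omega)] at ho
      exact absurd ho (by simp)
    have h5 := firstChild_mono t r (show i + 1 ≤ w - 1 by omega)
    have h6 := firstChild_succ t r (w - 1)
    rw [show w - 1 + 1 = w by omega] at h6
    omega
  · have h5 := firstChild_mono t r (show i + 1 ≤ w - g by omega)
    have h6 := firstChild_add_sum_Ico t r (Nat.sub_le w g)
    omega

theorem add_gap_lt_width (e : ℕ) {v : ℕ × ℕ} (hv : v ∈ cluster t ω) (hw : 0 < width t v.1) :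
    v.2 + gap e (t, ω) v.1 < width t v.1 := by
  induction hv with
  | refl => simp [gap, width]
  | @tail u v _ he ih =>
    obtain ⟨j, hj, ho, rfl⟩ := he
    simp only [upNeighbour] at hw ⊢
    rcases target_add_gap e hw (ih (width_pos_of_succ hw)) hj ho with h | h
    · rwa [Nat.mod_eq_of_lt (by omega)]
    · rw [h]
      exact Nat.mod_lt _ hw

theorem gap_eq_zero_of_wraps (e : ℕ) {r : ℕ} (h : Wraps t ω r) (hw : 0 < width t r) :
    gap e (t, ω) r = 0 := by
  cases r with
  | zero => rfl
  | succ r =>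
    obtain ⟨i, j, hi, hj, ho, hij⟩ := h
    refine (target_add_gap e (u := (r, i)) hw
      (add_gap_lt_width e hi (width_pos_of_succ hw)) hj ho).resolve_left ?_
    simp only
    omega

/-- Behind the last edge that winds around, a path starts at position `0` and uses only edges whose
target needs no reduction modulo the width, so it is a half-plane path. -/
theorem exists_wraps_of_mem_cluster (ht : Survives t) {v : ℕ × ℕ} (hv : v ∈ cluster t ω) :
    ∃ r, Wraps t ω r ∧ v ∈ linCluster t ω (r, 0) := by
  induction hv with
  | refl => exact ⟨0, trivial, .refl⟩
  | @tail u v hu he ih =>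
    obtain ⟨r, hr, hur⟩ := ih
    obtain ⟨j, hj, ho, rfl⟩ := he
    have h1 := target_le hj
    have h2 := add_gap_lt_width 0 hu (ht u.1)
    have h3 := firstChild_mono t u.1 (show u.2 + 1 ≤ width t u.1 by omega)
    rw [firstChild_width] at h3
    have h4 := upDegree_le t u
    rcases (h1.trans h3).eq_or_lt with h | h
    · refine ⟨u.1 + 1, ⟨u.2, j, hu, hj, ho, h⟩, ?_⟩
      rw [upNeighbour, h, Nat.mod_self]
      exact .refl
    · refine ⟨r, hr, hur.tail ⟨j, by omega, ho, ?_⟩⟩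
      rw [upNeighbour, Nat.mod_eq_of_lt h]

theorem wraps_congr {r : ℕ} (h : ∀ e : ℕ × ℕ, e.1 < r → t e = t' e)
    (h' : ∀ e : (ℕ × ℕ) × ℕ, e.1.1 < r → ω e = ω' e) (hr : Wraps t ω r) : Wraps t' ω' r := by
  cases r with
  | zero => trivial
  | succ r =>
    obtain ⟨i, j, hi, hj, ho, hij⟩ := hr
    refine ⟨i, j, cluster_congr h h' hi (Nat.le_succ r), ?_, ?_, ?_⟩
    · unfold upDegree at hj ⊢
      rwa [← h (r, i) (by simp)]
    · rw [← h' _ (by simp), ho]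
    · rw [← firstChild_congr fun i => h (r, i) (by simp), hij, width_congr h]

theorem nextGap_congr {e r w g : ℕ} {x x' : TreeStates}
    (h : ∀ i, x.1 (r, i) = x'.1 (r, i)) (h' : ∀ i j, x.2 ((r, i), j) = x'.2 ((r, i), j)) :
    nextGap e r w g x = nextGap e r w g x' := by
  simp only [nextGap, h, h']

theorem gap_congr {e r : ℕ} {x x' : TreeStates} (h : ∀ e : ℕ × ℕ, e.1 < r → x.1 e = x'.1 e)
    (h' : ∀ e : (ℕ × ℕ) × ℕ, e.1.1 < r → x.2 e = x'.2 e) : gap e x r = gap e x' r := by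
  induction r with
  | zero => rfl
  | succ r ih =>
    rw [gap, gap, ih (fun e he => h e (by omega)) fun e he => h' e (by omega),
      width_congr fun e he => h e (by omega)]
    exact nextGap_congr (fun i => h (r, i) (by simp)) fun i j => h' ((r, i), j) (by simp)

theorem gap_le_width (e : ℕ) (x : TreeStates) {r : ℕ} (hw : 0 < width x.1 r) :
    gap e x r ≤ width x.1 r := by
  cases r with
  | zero => exact Nat.zero_le _
  | succ r =>
    have hw' := width_pos_of_succ hw
    rw [gap, nextGap, ← firstChild_width]
    split_ifs with h
    · have h6 := firstChild_succ x.1 r (width x.1 r - 1)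
      rw [show width x.1 r - 1 + 1 = width x.1 r by omega] at h6
      omega
    · have h6 := firstChild_add_sum_Ico x.1 r (Nat.sub_le (width x.1 r) (gap e x r))
      omega

end Deterministic

section Measurability

/-- The vertex `v` has `k` children and all its upward edges are closed. -/
def closedAt (v : ℕ × ℕ) (k : ℕ) : Set TreeStates :=
  {x | x.1 v = k ∧ ∀ j ≤ k, x.2 (v, j) = false}

theorem closedAt_eq (v : ℕ × ℕ) (k : ℕ) : closedAt v k = {t | t v = k} ×ˢ
    {ω | ∀ e ∈ (Finset.range (k + 1)).image fun j => (v, j), ω e = false} := by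
  ext x
  simp [closedAt]

theorem measurableSet_closedAt (v : ℕ × ℕ) (k : ℕ) : MeasurableSet (closedAt v k) := by
  rw [closedAt_eq]
  refine .prod (measurableSet_eq_fun (measurable_pi_apply v) measurable_const) ?_
  simp only [Set.ofPred_forall]
  exact .iInter fun e => .iInter fun _ => measurableSet_eval_eq _ false

theorem measurable_nextGap (e r w g : ℕ) : Measurable (nextGap e r w g) := by
  have h1 : ∀ v : ℕ × ℕ, Measurable fun x : TreeStates => x.1 v := fun v =>
    (measurable_pi_apply v).comp measurable_fst
  unfold nextGap
  exact Measurable.ite ((MeasurableSet.const _).inter (measurableSet_closedAt (r, w - 1) (e + 2)))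
    measurable_const ((Finset.measurable_fun_sum _ fun i _ => h1 (r, i)).sub_const 1)

theorem measurable_gap (e r : ℕ) : Measurable fun x => gap e x r := by
  induction r with
  | zero => exact measurable_const
  | succ r ih =>
    have h : Measurable fun q : TreeStates × (ℕ × ℕ) => nextGap e r q.2.1 q.2.2 q.1 :=
      measurable_from_prod_countable_left fun i => measurable_nextGap e r i.1 i.2
    exact h.comp (measurable_id.prodMk (((measurable_width r).comp measurable_fst).prodMk ih))

theorem measurableSet_wraps (r : ℕ) : MeasurableSet {x : TreeStates | Wraps x.1 x.2 r} := by
  cases r with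
  | zero => exact .const True
  | succ r =>
    simp only [Wraps, Set.ofPred_exists]
    refine .iUnion fun i => .iUnion fun j => .inter (measurableSet_mem_cluster _)
      (.inter ?_ (.inter (measurableSet_state _) ?_))
    · have : Measurable fun t : PlaneTree => upDegree t (r, i) := by
        unfold upDegree
        split_ifs
        · exact measurable_pi_apply _
        · exact (measurable_pi_apply _).add_const 1
      exact measurableSet_lt measurable_const (this.comp measurable_fst)
    · exact measurableSet_eq_fun (((measurable_firstChild r i).add_const j).comp measurable_fst)
        ((measurable_width (r + 1)).comp measurable_fst)

end Measurability

/-- A superharmonic function for the gaps. -/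
noncomputable def gapWeight (e : ℕ) (y : ℝ≥0∞) (g : ℕ) : ℝ≥0∞ := if g ≤ e then 1 else y ^ (g - e)

section Measure

variable {α p : I}

theorem pow_mul_gapWeight_le {e : ℕ} {y : ℝ≥0∞} (hy : y ≤ 1) (s : ℕ) :
    y ^ (e + 1) * gapWeight e y (s - 1) ≤ y ^ s := by
  rw [gapWeight]
  split_ifs with h
  · rw [mul_one]
    exact pow_le_pow_right_of_le_one' hy (by omega)
  · rw [← pow_add, show e + 1 + (s - 1 - e) = s by omega]

theorem gapWeight_le_one {e : ℕ} {y : ℝ≥0∞} (hy : y ≤ 1) (g : ℕ) : gapWeight e y g ≤ 1 := by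
  rw [gapWeight]
  split_ifs
  · exact le_rfl
  · exact pow_le_one' hy _

/-- The children of the `g` rightmost vertices have generating function `offspringGen α y ^ g`.
Multiplication by `y ^ (e + 1)` absorbs both the truncation at `e` and the lost child. -/
theorem lintegral_gapWeight_of_gt {e r w g : ℕ} {y l : ℝ≥0∞} (hy : y ≤ 1) (hy0 : y ≠ 0)
    (hg : e < g) (hgw : g ≤ w) (hl : offspringGen α y ^ g ≤ l * y ^ (g + 1)) :
    ∫⁻ x, gapWeight e y (nextGap e r w g x) ∂treeLaw α p ≤ l * gapWeight e y g := by
  have hy1 : y ≠ ⊤ := ne_top_of_le_ne_top ENNReal.one_ne_top hy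
  have h1 : y ^ (e + 1) * ∫⁻ x, gapWeight e y (nextGap e r w g x) ∂treeLaw α p ≤
      offspringGen α y ^ g := by
    have hm : Measurable fun x => gapWeight e y (nextGap e r w g x) :=
      (measurable_of_countable (gapWeight e y)).comp (measurable_nextGap e r w g)
    rw [← lintegral_const_mul _ hm]
    have hc : ((Finset.Ico (w - g) w).image fun i => (r, i)).card = g := by
      rw [Finset.card_image_of_injective _ fun i j h => by simpa using h, Nat.card_Ico]
      omega
    rw [← hc, ← lintegral_pow_sum_treeLaw α p, hc]
    refine lintegral_mono fun x => ?_
    rw [Finset.sum_image fun i _ j _ h => by simpa using h, nextGap, if_neg (by omega)]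
    exact pow_mul_gapWeight_le hy _
  have h2 : y ^ (e + 1) * (l * gapWeight e y g) = l * y ^ (g + 1) := by
    rw [gapWeight, if_neg (by omega), show g + 1 = (e + 1) + (g - e) by omega, pow_add]
    ring
  refine (ENNReal.mul_le_mul_iff_right (pow_ne_zero (e + 1) hy0) (ENNReal.pow_ne_top hy1)).1 ?_
  rw [h2]
  exact h1.trans hl

theorem treeLaw_closedAt (hα' : (α : ℝ) < 1) (p : I) (v : ℕ × ℕ) (k : ℕ) :
    treeLaw α p (closedAt v k) =
      ENNReal.ofReal (α ^ k * (1 - α) * (1 - p) ^ (k + 1)) := by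
  have h1 : galtonWatson α {t | t v = k} = geometricMeasure (σ α) {k} :=
    (measurePreserving_eval_infinitePi (fun _ : ℕ × ℕ => geometricMeasure (σ α)) v).measure_preimage
      (MeasurableSet.singleton k).nullMeasurableSet
  have h2 : percolation p
      {ω | ∀ e ∈ (Finset.range (k + 1)).image fun j => (v, j), ω e = false} =
      ENNReal.ofReal (1 - p) ^ (k + 1) := by
    have := coins_cylinder p ((Finset.range (k + 1)).image fun j => (v, j)) fun _ => false
    rw [Finset.prod_const, coin_false,
      Finset.card_image_of_injective _ fun i j h => by simpa using h, Finset.card_range] at this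
    exact this
  rw [closedAt_eq, treeLaw, Measure.prod_prod, h1, h2, geometric_singleton hα',
    ← ENNReal.ofReal_pow (sub_nonneg.2 p.2.2), ← ENNReal.ofReal_mul]
  exact mul_nonneg (pow_nonneg α.2.1 k) (by linarith)

/-- Small gaps have weight `1`. With the probability of `closedAt` the gap is lifted to `e + 1`,
where the weight is `y`; otherwise the weight is at most `1`. -/
theorem lintegral_gapWeight_of_le (hα' : (α : ℝ) < 1) {e r w g : ℕ} {y : ℝ} (hy : 0 ≤ y) (hy1 : y ≤ 1)
    (hg : g ≤ e) :
    ∫⁻ x, gapWeight e (ENNReal.ofReal y) (nextGap e r w g x) ∂treeLaw α p ≤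
      ENNReal.ofReal (1 - α ^ (e + 2) * (1 - α) * (1 - p) ^ (e + 3) * (1 - y)) := by
  set B := closedAt (r, w - 1) (e + 2) with hB
  set d := (α : ℝ) ^ (e + 2) * (1 - α) * (1 - p) ^ (e + 3) with hd
  have hd0 : 0 ≤ d := mul_nonneg (mul_nonneg (pow_nonneg α.2.1 _) (by linarith))
    (pow_nonneg (sub_nonneg.2 p.2.2) _)
  have hBd : treeLaw α p B = ENNReal.ofReal d := treeLaw_closedAt hα' p _ _
  have hd1 : d ≤ 1 := by
    have : ENNReal.ofReal d ≤ 1 := hBd ▸ prob_le_one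
    rwa [ENNReal.ofReal_le_one] at this
  have hmB : MeasurableSet B := measurableSet_closedAt _ _
  have h1 : ∀ x, gapWeight e (ENNReal.ofReal y) (nextGap e r w g x) ≤
      B.indicator (fun _ => ENNReal.ofReal y) x + Bᶜ.indicator 1 x := fun x => by
    by_cases hx : x ∈ B
    · rw [Set.indicator_of_mem hx, Set.indicator_of_notMem (by simpa using hx), add_zero, nextGap,
        if_pos ⟨hg, hx⟩, gapWeight, if_neg (by omega), Nat.add_sub_cancel_left, pow_one]
    · rw [Set.indicator_of_notMem hx, Set.indicator_of_mem (by simpa using hx), zero_add]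
      exact gapWeight_le_one (by simpa using hy1) _
  refine (lintegral_mono h1).trans ?_
  rw [lintegral_add_left (measurable_const.indicator hmB), lintegral_indicator_const hmB,
    lintegral_indicator_one hmB.compl, prob_compl_eq_one_sub hmB, hBd, ← ENNReal.ofReal_mul hy,
    ← ENNReal.ofReal_one, ← ENNReal.ofReal_sub _ hd0,
    ← ENNReal.ofReal_add (mul_nonneg hy hd0) (sub_nonneg.2 hd1)]
  refine le_of_eq ?_
  congr 1
  ring

/-- Width and gap are functions of the lower generations and the next step uses a fresh one, so the
one-step bound applies on each event that fixes their values. -/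
theorem setLIntegral_gapWeight_succ_le {e : ℕ} {y l : ℝ≥0∞}
    (h : ∀ r w g, g ≤ w →
      ∫⁻ x, gapWeight e y (nextGap e r w g x) ∂treeLaw α p ≤ l * gapWeight e y g) (r : ℕ) :
    ∫⁻ x in {x | 0 < width x.1 (r + 1)}, gapWeight e y (gap e x (r + 1)) ∂treeLaw α p ≤
      l * ∫⁻ x in {x | 0 < width x.1 r}, gapWeight e y (gap e x r) ∂treeLaw α p := by
  let A : ℕ × ℕ → Set TreeStates := fun s => {x | width x.1 r = s.1 + 1 ∧ gap e x r = s.2}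
  have hA : ∀ s, MeasurableSet (A s) := fun s =>
    (measurableSet_eq_fun ((measurable_width r).comp measurable_fst) measurable_const).inter
      (measurableSet_eq_fun (measurable_gap e r) measurable_const)
  have hdisj : Pairwise (Function.onFun Disjoint A) := fun s s' hs =>
    Set.disjoint_left.2 fun x hx hx' => hs (Prod.ext
      (by have := hx.1.symm.trans hx'.1; omega) (hx.2.symm.trans hx'.2))
  have hU : {x : TreeStates | 0 < width x.1 r} = ⋃ s, A s := by
    ext x
    simp only [Set.mem_ofPred_eq, Set.mem_iUnion, Prod.exists, A]
    exact ⟨fun hx => ⟨width x.1 r - 1, _, by omega, rfl⟩, fun ⟨_, _, h, _⟩ => by omega⟩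
  have hsub : {x : TreeStates | 0 < width x.1 (r + 1)} ⊆ {x | 0 < width x.1 r} := fun x hx =>
    width_pos_of_succ hx
  refine (lintegral_mono_set hsub).trans ?_
  rw [hU, lintegral_iUnion hA hdisj, lintegral_iUnion hA hdisj, ← ENNReal.tsum_mul_left]
  refine ENNReal.tsum_le_tsum fun s => ?_
  have h1 : ∫⁻ x in A s, gapWeight e y (gap e x (r + 1)) ∂treeLaw α p =
      ∫⁻ x in A s, gapWeight e y (nextGap e r (s.1 + 1) s.2 x) ∂treeLaw α p :=
    setLIntegral_congr_fun (hA s) fun x hx => by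
      change gapWeight e y (nextGap e r (width x.1 r) (gap e x r) x) = _
      rw [hx.1, hx.2]
  have h2 : ∫⁻ x in A s, gapWeight e y (gap e x r) ∂treeLaw α p =
      ∫⁻ _ in A s, gapWeight e y s.2 ∂treeLaw α p :=
    setLIntegral_congr_fun (hA s) fun x hx => by
      rw [hx.2]
  have h3 : ∫⁻ x in A s, gapWeight e y (nextGap e r (s.1 + 1) s.2 x) ∂treeLaw α p =
      treeLaw α p (A s) * ∫⁻ x, gapWeight e y (nextGap e r (s.1 + 1) s.2 x) ∂treeLaw α p := by
    refine setLIntegral_of_dependsOn (J := {e | e.1 < r}) (hA s)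
      ((measurable_of_countable (gapWeight e y)).comp (measurable_nextGap e r _ _)) ?_ ?_
    · intro x x' ht ho hx
      exact ⟨(width_congr fun e he => (ht e he).symm).trans hx.1,
        (gap_congr (fun e he => (ht e he).symm) fun e he => (ho e he).symm).trans hx.2⟩
    · intro x x' ht ho
      rw [nextGap_congr (fun i => ht (r, i) (by simp)) fun i j => ho ((r, i), j) (by simp)]
  rw [h1, h2, h3, setLIntegral_const]
  rcases (A s).eq_empty_or_nonempty with hemp | ⟨x, hx⟩
  · simp [hemp]
  · have hle : s.2 ≤ s.1 + 1 := by
      have := gap_le_width e x (r := r) (by rw [hx.1]; omega)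
      rwa [hx.1, hx.2] at this
    calc _ ≤ treeLaw α p (A s) * (l * gapWeight e y s.2) := by
          gcongr
          exact h r (s.1 + 1) s.2 hle
      _ = _ := by ring

theorem treeLaw_wraps_le {e : ℕ} {y l : ℝ≥0∞} (hy : y ≤ 1)
    (h : ∀ r w g, g ≤ w →
      ∫⁻ x, gapWeight e y (nextGap e r w g x) ∂treeLaw α p ≤ l * gapWeight e y g) (r : ℕ) :
    treeLaw α p {x | Wraps x.1 x.2 r ∧ 0 < width x.1 r} ≤ l ^ r := by
  have h1 : ∫⁻ x in {x | 0 < width x.1 r}, gapWeight e y (gap e x r) ∂treeLaw α p ≤ l ^ r := by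
    induction r with
    | zero =>
      rw [pow_zero]
      calc _ ≤ ∫⁻ x in {x | 0 < width x.1 0}, 1 ∂treeLaw α p :=
            lintegral_mono fun x => gapWeight_le_one hy _
        _ ≤ 1 := by
            rw [setLIntegral_const, one_mul]
            exact prob_le_one
    | succ r ih =>
      refine (setLIntegral_gapWeight_succ_le h r).trans ?_
      rw [pow_succ']
      gcongr
  refine le_trans ?_ h1
  have hm : MeasurableSet {x : TreeStates | Wraps x.1 x.2 r ∧ 0 < width x.1 r} :=
    (measurableSet_wraps r).inter
      (measurableSet_lt measurable_const ((measurable_width r).comp measurable_fst))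
  rw [← setLIntegral_one]
  calc ∫⁻ x in {x | Wraps x.1 x.2 r ∧ 0 < width x.1 r}, 1 ∂treeLaw α p =
      ∫⁻ x in {x | Wraps x.1 x.2 r ∧ 0 < width x.1 r}, gapWeight e y (gap e x r) ∂treeLaw α p :=
        setLIntegral_congr_fun hm fun x hx => by
          rw [gap_eq_zero_of_wraps (t := x.1) (ω := x.2) e hx.1 hx.2, gapWeight,
            if_pos (Nat.zero_le _)]
    _ ≤ _ := lintegral_mono_set fun x hx => hx.2

/-- The generating function of the offspring distribution is below the diagonal close to `1`. -/
theorem exists_offspringGen_lt (hα : 1 / 2 < (α : ℝ)) (hα' : (α : ℝ) < 1) :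
    ∃ y q : ℝ, 0 < y ∧ y < 1 ∧ 0 < q ∧ q < 1 ∧
      offspringGen α (ENNReal.ofReal y) = ENNReal.ofReal (q * y) := by
  -- The generating function lies below the diagonal strictly between its fixed points, the
  -- extinction probability `(1 - α) / α` and `1`; `y` is their midpoint.
  set y : ℝ := (1 + (1 - α) / α) / 2 with hy
  have hα0 : (0 : ℝ) < α := by linarith
  have h1 : (1 - (α : ℝ)) / α < 1 := (div_lt_one hα0).2 (by linarith)
  have h0 : 0 < (1 - (α : ℝ)) / α := div_pos (by linarith) hα0
  have hy0 : 0 < y := by positivity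
  have hy1 : y < 1 := by linarith
  have hαy : 1 - (α : ℝ) < α * y := by
    rw [← div_lt_iff₀' hα0]
    linarith
  have hden : 0 < 1 - (α : ℝ) * y := by nlinarith
  refine ⟨y, (1 - α) / (1 - α * y) / y, hy0, hy1, by have : 0 < 1 - (α : ℝ) := by linarith
                                                     positivity, ?_, ?_⟩
  · rw [div_lt_one hy0, div_lt_iff₀ hden]
    nlinarith [mul_pos (sub_pos.2 hy1) (sub_pos.2 hαy)]
  · rw [offspringGen_ofReal hα' hy0.le hy1.le, div_mul_cancel₀ _ hy0.ne']

/-- The cluster is not likely to wind around the triangulation at a large height. -/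
theorem exists_treeLaw_wraps_le (hα : 1 / 2 < (α : ℝ)) (hα' : (α : ℝ) < 1) {p₀ : ℝ} (hp₀ : p₀ < 1) :
    ∃ l : ℝ, 0 < l ∧ l < 1 ∧ ∀ p : I, (p : ℝ) ≤ p₀ → ∀ r,
      (treeLaw α p).real {x | Wraps x.1 x.2 r ∧ 0 < width x.1 r} ≤ l ^ r := by
  obtain ⟨y, q, hy0, hy1, hq0, hq1, hF⟩ := exists_offspringGen_lt hα hα'
  -- For gaps `g > e` the factor `q ^ g` then pays for the lost child and for a contraction by `1 /
  -- 2`. Smaller gaps contract through the special case, whose probability is at least `d` for all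
  -- `p ≤ p₀`.
  obtain ⟨e, he⟩ : ∃ e : ℕ, q ^ e < 1 / 2 * y :=
    exists_pow_lt_of_lt_one (by positivity) hq1
  have hα0 : (0 : ℝ) < α := by linarith
  set d := (α : ℝ) ^ (e + 2) * (1 - α) * (1 - p₀) ^ (e + 3) with hd
  have hd0 : 0 < d := by
    have h1 : 0 < 1 - (α : ℝ) := by linarith
    have h2 : 0 < 1 - p₀ := by linarith
    positivity
  set l := max (1 / 2) (1 - d * (1 - y)) with hl
  have hl0 : 0 < l := lt_of_lt_of_le (by norm_num) (le_max_left _ _)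
  refine ⟨l, hl0, max_lt (by norm_num) (by nlinarith), fun p hp r => ?_⟩
  refine ENNReal.toReal_le_of_le_ofReal (by positivity) ?_
  rw [ENNReal.ofReal_pow hl0.le]
  refine treeLaw_wraps_le (e := e) (y := ENNReal.ofReal y) (by simpa using hy1.le)
    (fun r w g hgw => ?_) r
  rcases le_or_gt g e with hg | hg
  · refine (lintegral_gapWeight_of_le hα' hy0.le hy1.le hg).trans ?_
    rw [gapWeight, if_pos hg, mul_one]
    refine ENNReal.ofReal_le_ofReal (le_trans ?_ (le_max_right _ _))
    have h1 : d ≤ (α : ℝ) ^ (e + 2) * (1 - α) * (1 - p) ^ (e + 3) := by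
      rw [hd]
      have h1 : 0 < 1 - (α : ℝ) := by linarith
      have h2 : 0 < 1 - p₀ := by linarith
      gcongr
    have h2 : 0 < 1 - y := by linarith
    nlinarith
  · refine lintegral_gapWeight_of_gt (by simpa using hy1.le) (by simpa using hy0) hg hgw ?_
    rw [hF, ← ENNReal.ofReal_pow (by positivity), ← ENNReal.ofReal_pow hy0.le,
      ← ENNReal.ofReal_mul hl0.le]
    refine ENNReal.ofReal_le_ofReal ?_
    rw [mul_pow, pow_succ, mul_comm (y ^ g), ← mul_assoc]
    have h1 : q ^ g ≤ q ^ e := pow_le_pow_of_le_one hq0.le hq1.le hg.le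
    have h2 : 1 / 2 ≤ l := le_max_left _ _
    have h3 : q ^ g ≤ l * y := by nlinarith
    gcongr

end Measure

/-! ### Upper bounds for the cluster in the triangulation -/

section Deterministic

/-- Pigeonhole: if the pieces that cover a set had at most `b r` elements each, the set would have
at most `∑ b r < n`. -/
theorem exists_lt_encard_of_subset_iUnion {V : Type*} [MeasurableSpace V]
    [DiscreteMeasurableSpace V] {C : Set V} {R : Set ℕ} {D : ℕ → Set V}
    (hC : ∀ v ∈ C, ∃ r ∈ R, v ∈ D r) {n : ℕ} (hn : (n : ℕ∞) ≤ C.encard) {b : ℕ → ℝ}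
    (hb : ∀ r, 0 ≤ b r) {s : ℝ} (hbs : HasSum b s) (hsn : s < n) :
    ∃ r ∈ R, ((⌊b r⌋₊ + 1 : ℕ) : ℕ∞) ≤ (D r).encard := by
  classical
  by_contra! h
  have h1 : C ⊆ ⋃ r, if r ∈ R then D r else ∅ := fun v hv => by
    obtain ⟨r, hr, hvr⟩ := hC v hv
    exact Set.mem_iUnion.2 ⟨r, by rwa [if_pos hr]⟩
  have h2 : ∀ r, Measure.count (if r ∈ R then D r else ∅) ≤ ENNReal.ofReal (b r) := fun r => by
    split_ifs with hr
    · have h3 := h r hr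
      rw [Measure.count_apply (MeasurableSet.of_discrete)]
      obtain ⟨k, hk⟩ := ENat.ne_top_iff_exists.1 (ne_top_of_lt h3)
      rw [← hk] at h3 ⊢
      rw [ENat.toENNReal_coe, ← ENNReal.ofReal_natCast]
      refine ENNReal.ofReal_le_ofReal ?_
      have h4 : k < ⌊b r⌋₊ + 1 := by exact_mod_cast h3
      exact (Nat.le_floor_iff (hb r)).1 (Nat.lt_succ_iff.1 h4)
    · simp
  have h3 : (n : ℝ≥0∞) ≤ ENNReal.ofReal s := by
    calc (n : ℝ≥0∞) ≤ Measure.count C := by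
          rw [Measure.count_apply (MeasurableSet.of_discrete), ← ENat.toENNReal_coe]
          exact ENat.toENNReal_le.2 hn
      _ ≤ _ := measure_mono h1
      _ ≤ _ := measure_iUnion_le _
      _ ≤ ∑' r, ENNReal.ofReal (b r) := ENNReal.tsum_le_tsum h2
      _ = _ := by rw [← ENNReal.ofReal_tsum_of_nonneg hb hbs.summable, hbs.tsum_eq]
  rw [← ENNReal.ofReal_natCast, ENNReal.ofReal_le_ofReal_iff (hbs.nonneg hb)] at h3
  linarith

theorem exists_infinite_linCluster {t : PlaneTree} {ω : (ℕ × ℕ) × ℕ → Bool} (ht : Survives t)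
    (hw : {r | Wraps t ω r}.Finite) (hC : (cluster t ω).Infinite) :
    ∃ r, Wraps t ω r ∧ (linCluster t ω (r, 0)).Infinite := by
  by_contra! h
  refine hC ((hw.biUnion (t := fun r => linCluster t ω (r, 0)) fun r hr => by
    simpa using h r hr).subset fun v hv => ?_)
  obtain ⟨r, hr, hv⟩ := exists_wraps_of_mem_cluster ht hv
  exact Set.mem_biUnion (show r ∈ {r | Wraps t ω r} from hr) hv

end Deterministic

section Measure

variable {α p : I}

theorem shift_congr {r : ℕ} {x x' : TreeStates} (ht : ∀ e : ℕ × ℕ, r ≤ e.1 → x.1 e = x'.1 e)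
    (ho : ∀ e : (ℕ × ℕ) × ℕ, r ≤ e.1.1 → x.2 e = x'.2 e) :
    (linCluster x.1 x.2 (r, 0)).encard = (linCluster x'.1 x'.2 (r, 0)).encard := by
  have h1 : shiftTree r x.1 = shiftTree r x'.1 := funext fun e => ht _ (Nat.le_add_right _ _)
  have h2 : shiftStates r x.2 = shiftStates r x'.2 := funext fun e => ho _ (Nat.le_add_right _ _)
  rw [encard_linCluster_shift r x.1, encard_linCluster_shift r x'.1, h1, h2]

/-- The cluster winds around a tree that reaches generation `r`, at this generation. -/
def wrapSet (r : ℕ) : Set TreeStates := {x | Wraps x.1 x.2 r ∧ 0 < width x.1 r}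

theorem measurableSet_wrapSet (r : ℕ) : MeasurableSet (wrapSet r) :=
  (measurableSet_wraps r).inter
    (measurableSet_lt measurable_const ((measurable_width r).comp measurable_fst))

theorem treeLaw_wrapSet_inter (r : ℕ) {S : Set ℕ∞}
    (hS : MeasurableSet {x : TreeStates | (linCluster x.1 x.2 (r, 0)).encard ∈ S}) :
    (treeLaw α p).real (wrapSet r ∩ {x | (linCluster x.1 x.2 (r, 0)).encard ∈ S}) =
      (treeLaw α p).real (wrapSet r) *
        (treeLaw α p).real {x | (linCluster x.1 x.2 (r, 0)).encard ∈ S} := by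
  rw [measureReal_def, measureReal_def, measureReal_def, ← ENNReal.toReal_mul]
  congr 1
  refine treeLaw_inter (J := {e | e.1 < r}) (measurableSet_wrapSet r) hS ?_ ?_
  · intro x x' ht ho hx
    refine ⟨wraps_congr (fun e he => ht e he) (fun e he => ho e he) hx.1, ?_⟩
    rw [← width_congr fun e he => ht e he]
    exact hx.2
  · intro x x' ht ho hx
    rw [Set.mem_ofPred_eq] at hx ⊢
    rwa [← shift_congr (fun e he => ht e (by simpa using he)) fun e he => ho e (by simpa using he)]

theorem treeLaw_real_iUnion_le {E : Set TreeStates} {F : ℕ → Set TreeStates} (hE : E ⊆ ⋃ r, F r)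
    {b : ℕ → ℝ} {s : ℝ} (hb : HasSum b s) (hF : ∀ r, (treeLaw α p).real (F r) ≤ b r) :
    (treeLaw α p).real E ≤ s := by
  have hb0 : ∀ r, 0 ≤ b r := fun r => measureReal_nonneg.trans (hF r)
  refine ENNReal.toReal_le_of_le_ofReal (hb.nonneg hb0) ?_
  calc treeLaw α p E ≤ ∑' r, treeLaw α p (F r) := (measure_mono hE).trans (measure_iUnion_le _)
    _ ≤ ∑' r, ENNReal.ofReal (b r) := ENNReal.tsum_le_tsum fun r =>
        (ENNReal.le_ofReal_iff_toReal_le (measure_ne_top _ _) (hb0 r)).2 (hF r)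
    _ = _ := by rw [← ENNReal.ofReal_tsum_of_nonneg hb0 hb.summable, hb.tsum_eq]

theorem exists_treeLaw_cluster_le (hα : 1 / 2 < (α : ℝ)) (hα' : (α : ℝ) < 1) :
    ∃ K : ℝ, 0 < K ∧ ∀ n : ℕ, 1 ≤ n →
      (treeLaw α (criticalParam α)).real
        ({x | (n : ℕ∞) ≤ (cluster x.1 x.2).encard} ∩ {x | Survives x.1}) ≤ K / √n := by
  obtain ⟨l, hl0, hl1, hl⟩ := exists_treeLaw_wraps_le hα hα' (criticalParam_lt_one α)
  obtain ⟨K, hK, hbit⟩ := exists_bitTail_le hα hα'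
  -- The piece at height `r` is allowed the size `a * n * l ^ r`, and these sizes sum to `n / 2`.
  -- The tail bound at this size loses a factor `l ^ (-r / 2)`, which the winding probability `l ^
  -- r` compensates.
  set a : ℝ := (1 - l) / 2 with ha
  have ha0 : 0 < a := by rw [ha]; linarith
  have hsl : √l < 1 := by rw [Real.sqrt_lt' one_pos]; simpa
  have hsl' : 0 < 1 - √l := by linarith
  refine ⟨K / √a * (1 - √l)⁻¹, by positivity, fun n hn => ?_⟩
  have hn0 : (0 : ℝ) < n := by exact_mod_cast hn
  let N : ℕ → ℕ := fun r => ⌊a * n * l ^ r⌋₊ + 1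
  have hsub : {x : TreeStates | (n : ℕ∞) ≤ (cluster x.1 x.2).encard} ∩ {x | Survives x.1} ⊆
      ⋃ r, wrapSet r ∩ {x | (linCluster x.1 x.2 (r, 0)).encard ∈ Set.Ici ((N r : ℕ) : ℕ∞)} := by
    rintro x ⟨hx, hs⟩
    obtain ⟨r, hr, hr'⟩ := exists_lt_encard_of_subset_iUnion
      (fun v hv => exists_wraps_of_mem_cluster hs hv) hx (b := fun r => a * n * l ^ r)
      (fun r => by positivity) ((hasSum_geometric_of_lt_one hl0.le hl1).mul_left (a * n)) (by
        have : 0 < 1 - l := by linarith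
        rw [ha]
        field_simp
        linarith)
    exact Set.mem_iUnion.2 ⟨r, ⟨hr, hs r⟩, hr'⟩
  refine treeLaw_real_iUnion_le hsub (b := fun r => K / √a / √n * √l ^ r) ?_ fun r => ?_
  · have := (hasSum_geometric_of_lt_one (Real.sqrt_nonneg l) hsl).mul_left (K / √a / √n)
    convert! this using 1
    ring
  · have hmeas : MeasurableSet {x : TreeStates |
        (linCluster x.1 x.2 (r, 0)).encard ∈ Set.Ici ((N r : ℕ) : ℕ∞)} :=
      measurableSet_le_encard_linCluster (N r) (r, 0)
    have h1 : (treeLaw α (criticalParam α)).real {x : TreeStates |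
        (linCluster x.1 x.2 (r, 0)).encard ∈ Set.Ici ((N r : ℕ) : ℕ∞)} =
        bitTail α (criticalParam α) (N r) := treeLaw_large_linCluster hα' _ r (N r)
    rw [treeLaw_wrapSet_inter r hmeas, h1]
    have h2 : bitTail α (criticalParam α) (N r) ≤ K / √(a * n * l ^ r) := by
      refine (hbit (N r) (Nat.succ_le_succ (Nat.zero_le _))).trans ?_
      have : a * n * l ^ r ≤ (N r : ℕ) := by
        simpa [N] using (Nat.lt_floor_add_one (a * n * l ^ r)).le
      gcongr
    calc _ ≤ l ^ r * (K / √(a * n * l ^ r)) := by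
          refine mul_le_mul (hl _ le_rfl r) h2 ?_ (by positivity)
          rw [← h1]
          exact measureReal_nonneg
      _ = _ := by
          have h3 : √(l ^ r) = √l ^ r := by
            rw [← Real.sqrt_sq (pow_nonneg (Real.sqrt_nonneg l) r), ← pow_mul, mul_comm, pow_mul,
              Real.sq_sqrt hl0.le]
          have h4 : l ^ r = √l ^ r * √l ^ r := by
            rw [← mul_pow, Real.mul_self_sqrt hl0.le]
          have h5 : 0 < √l := Real.sqrt_pos.2 hl0
          have h6 : 0 < √a := Real.sqrt_pos.2 ha0
          have h7 : 0 < √(n : ℝ) := Real.sqrt_pos.2 hn0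
          rw [Real.sqrt_mul (by positivity), Real.sqrt_mul ha0.le, h3, h4]
          field_simp

theorem treeLaw_infinite_cluster_le (hα' : (α : ℝ) < 1) {l : ℝ} (hl0 : 0 < l) (hl1 : l < 1)
    (hl : ∀ r, (treeLaw α p).real (wrapSet r) ≤ l ^ r) :
    (treeLaw α p).real ({x | (cluster x.1 x.2).Infinite} ∩ {x | Survives x.1}) ≤
      (1 - l)⁻¹ * (bits α p).real {x | (bitCluster x.1 x.2).Infinite} := by
  set L := (bits α p).real {x | (bitCluster x.1 x.2).Infinite}
  -- Borel–Cantelli: almost surely the cluster winds at finitely many heights only, so that an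
  -- infinite cluster has an infinite piece.
  have hsum : ∑' r, treeLaw α p (wrapSet r) ≠ ⊤ := by
    refine ne_top_of_le_ne_top ?_ (ENNReal.tsum_le_tsum fun r =>
      (ENNReal.le_ofReal_iff_toReal_le (measure_ne_top _ _) (pow_nonneg hl0.le r)).2 (hl r))
    rw [← ENNReal.ofReal_tsum_of_nonneg (fun r => pow_nonneg hl0.le r)
      (summable_geometric_of_lt_one hl0.le hl1)]
    exact ENNReal.ofReal_ne_top
  have hfin : ∀ᵐ x ∂treeLaw α p, {r | x ∈ wrapSet r}.Finite := ae_finite_setOfPred_mem hsum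
  set Z : Set TreeStates := {x | {r | x ∈ wrapSet r}.Finite} with hZ
  have h1 : (treeLaw α p).real ({x | (cluster x.1 x.2).Infinite} ∩ {x | Survives x.1}) =
      (treeLaw α p).real (({x | (cluster x.1 x.2).Infinite} ∩ {x | Survives x.1}) ∩ Z) := by
    exact (measureReal_congr (Filter.inter_eventuallyEq_left.2 (hfin.mono fun _ h _ => h))).symm
  rw [h1]
  refine treeLaw_real_iUnion_le (F := fun r => wrapSet r ∩
      {x | (linCluster x.1 x.2 (r, 0)).encard ∈ ({⊤} : Set ℕ∞)}) (b := fun r => l ^ r * L) ?_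
      ((hasSum_geometric_of_lt_one hl0.le hl1).mul_right L) fun r => ?_
  · rintro x ⟨⟨hx, hs⟩, hz⟩
    have hw : {r | Wraps x.1 x.2 r} = {r | x ∈ wrapSet r} := by
      ext r
      exact ⟨fun h => ⟨h, hs r⟩, fun h => h.1⟩
    obtain ⟨r, hr, hi⟩ := exists_infinite_linCluster hs (by rw [hw]; exact hz) hx
    exact Set.mem_iUnion.2 ⟨r, ⟨hr, hs r⟩, Set.encard_eq_top_iff.2 hi⟩
  · have hset : {x : TreeStates | (linCluster x.1 x.2 (r, 0)).encard ∈ ({⊤} : Set ℕ∞)} =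
        {x | (linCluster x.1 x.2 (r, 0)).Infinite} := by
      ext x
      exact Set.encard_eq_top_iff
    rw [treeLaw_wrapSet_inter r (by
      rw [hset]
      exact measurableSet_infinite fun w => measurableSet_mem_linCluster (r, 0) w), hset,
      treeLaw_infinite_linCluster hα' p r]
    exact mul_le_mul_of_nonneg_right (hl r) measureReal_nonneg

theorem clusterTail_eq (α p : I) (n : ℕ) :
    clusterTail α p n = ((galtonWatson α).real {t | Survives t})⁻¹ * (treeLaw α p).real
      ({x | (n : ℕ∞) ≤ (cluster x.1 x.2).encard} ∩ {x | Survives x.1}) := by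
  rw [clusterTail, measureReal_def, annealed_apply, ENNReal.toReal_mul, ENNReal.toReal_inv]
  rfl

theorem percolationProb_eq (α p : I) :
    percolationProb α p = ((galtonWatson α).real {t | Survives t})⁻¹ * (treeLaw α p).real
      ({x | (cluster x.1 x.2).Infinite} ∩ {x | Survives x.1}) := by
  rw [percolationProb, measureReal_def, annealed_apply, ENNReal.toReal_mul, ENNReal.toReal_inv]
  rfl

theorem exists_clusterTail_le (hα : 1 / 2 < (α : ℝ)) (hα' : (α : ℝ) < 1) :
    ∃ K : ℝ, 0 < K ∧ ∀ n : ℕ, 1 ≤ n → clusterTail α (criticalParam α) n ≤ K / √n := by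
  obtain ⟨K, hK, h⟩ := exists_treeLaw_cluster_le hα hα'
  have h0 : 0 ≤ ((galtonWatson α).real {t | Survives t})⁻¹ := inv_nonneg.2 measureReal_nonneg
  refine ⟨(((galtonWatson α).real {t | Survives t})⁻¹ + 1) * K, by positivity, fun n hn => ?_⟩
  rw [clusterTail_eq, mul_div_assoc]
  have h1 := h n hn
  have h2 : 0 ≤ K / √n := by positivity
  calc _ ≤ ((galtonWatson α).real {t | Survives t})⁻¹ * (K / √n) := by gcongr
    _ ≤ _ := by gcongr; linarith

theorem exists_percolationProb_le (hα : 1 / 2 < (α : ℝ)) (hα' : (α : ℝ) < 1) :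
    ∃ K : ℝ, 0 < K ∧ ∀ p : I, (criticalParam α : ℝ) < p →
      percolationProb α p ≤ K * (p - criticalParam α) := by
  have hc1 := criticalParam_lt_one α
  have hc0 := criticalParam_pos hα hα'
  have ho := criticalOdds_nonneg α
  set pc : ℝ := (criticalParam α : ℝ) with hpc
  -- Winding is controlled uniformly only for `p` away from `1`. Above the midpoint of `pc` and `1`
  -- the trivial bound suffices, as `p - pc` is bounded below there.
  obtain ⟨l, hl0, hl1, hl⟩ := exists_treeLaw_wraps_le hα hα' (p₀ := (1 + pc) / 2) (by linarith)
  set g := ((galtonWatson α).real {t | Survives t})⁻¹ with hg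
  have h0 : 0 ≤ g := inv_nonneg.2 measureReal_nonneg
  have hl1' : 0 < 1 - l := by linarith
  have hpc1 : 0 < 1 - pc := by linarith
  set K₁ := g * ((1 - l)⁻¹ * (2 * (1 + criticalOdds α) / pc)) with hK₁
  set K₂ := g * (2 / (1 - pc)) with hK₂
  have hK₁0 : 0 ≤ K₁ := by positivity
  have hK₂0 : 0 ≤ K₂ := by positivity
  refine ⟨K₁ + K₂ + 1, by positivity, fun p hp => ?_⟩
  have hp' : 0 < (p : ℝ) - pc := by linarith
  rw [percolationProb_eq, ← hg]
  rcases le_or_gt (p : ℝ) ((1 + pc) / 2) with h | h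
  · calc _ ≤ g * ((1 - l)⁻¹ * (2 * (1 + criticalOdds α) / pc * (p - pc))) := by
          refine mul_le_mul_of_nonneg_left ((treeLaw_infinite_cluster_le hα' hl0 hl1
            (hl p h)).trans ?_) h0
          exact mul_le_mul_of_nonneg_left (bits_infinite_le_of_gt hα hα' hp.le)
            (inv_nonneg.2 hl1'.le)
      _ = K₁ * (p - pc) := by rw [hK₁]; ring
      _ ≤ _ := by gcongr; linarith
  · calc _ ≤ g * 1 := mul_le_mul_of_nonneg_left measureReal_le_one h0
      _ ≤ g * (2 / (1 - pc) * (p - pc)) := by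
          refine mul_le_mul_of_nonneg_left ?_ h0
          rw [div_mul_eq_mul_div, le_div_iff₀ hpc1]
          linarith
      _ = K₂ * (p - pc) := by rw [hK₂]; ring
      _ ≤ _ := by gcongr; linarith

end Measure

/-! ### Lower bounds: a half-plane cluster that never winds around -/

/-- A bound for the positions in generation `k + 1` of the vertices that are reachable from the
leftmost vertex of the first generation without winding around the triangulation. -/
def reach (t : PlaneTree) : ℕ → ℕ
  | 0 => 0
  | k + 1 => firstChild t (k + 1) (reach t k + 1)

/-- For `a = reach t`, the number of vertices of generation `k + 1` from position `a k` on. -/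
def slack (t : PlaneTree) (a : ℕ → ℕ) : ℕ → ℕ
  | 0 => t (0, 0)
  | k + 1 => ∑ i ∈ Finset.Ico (a k + 1) (a k + slack t a k), t (k + 1, i)

section Deterministic

variable {t t' : PlaneTree} {ω ω' : (ℕ × ℕ) × ℕ → Bool} {a a' : ℕ → ℕ}

theorem slack_pos_of_succ {k : ℕ} (h : 0 < slack t a (k + 1)) : 0 < slack t a k := by
  by_contra! h0
  rw [slack, Nat.le_zero.1 h0, Finset.Ico_eq_empty (by omega)] at h
  simp at h

theorem slack_pos_of_le {k l : ℕ} (hkl : k ≤ l) (h : 0 < slack t a l) : 0 < slack t a k := by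
  induction hkl with
  | refl => exact h
  | step _ ih => exact ih (slack_pos_of_succ h)

theorem slack_congr {M k : ℕ} (h : ∀ k ≤ M, a k = a' k) (hk : k ≤ M) :
    slack t a k = slack t a' k := by
  induction k with
  | zero => rfl
  | succ k ih => rw [slack, slack, h k (by omega), ih (by omega)]

/-- The vertices on the right of position `reach t k` have their children exactly from position
`reach t (k + 1)` on, so `slack` counts the rest of the generation. -/
theorem width_eq_reach_add_slack {k : ℕ} (h : 0 < slack t (reach t) k) :
    width t (k + 1) = reach t k + slack t (reach t) k := by
  induction k with
  | zero => simp [width, reach, slack]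
  | succ k ih =>
    have h1 := slack_pos_of_succ h
    rw [← firstChild_width, ih h1, ← firstChild_add_sum_Ico t (k + 1)
      (show reach t k + 1 ≤ reach t k + slack t (reach t) k by omega)]
    rfl

theorem le_reach {v : ℕ × ℕ} (hv : v ∈ linCluster t ω (1, 0)) :
    1 ≤ v.1 ∧ v.2 ≤ reach t (v.1 - 1) := by
  induction hv with
  | refl => simp
  | @tail u w _ he ih =>
    obtain ⟨j, hj, -, rfl⟩ := he
    obtain ⟨r, i⟩ := u
    obtain ⟨k, rfl⟩ : ∃ k, r = k + 1 := ⟨r - 1, by simp only at ih; omega⟩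
    simp only [Nat.add_sub_cancel] at ih ⊢
    refine ⟨by omega, ?_⟩
    have h1 := firstChild_succ t (k + 1) i
    have h2 := firstChild_mono t (k + 1) (show i + 1 ≤ reach t k + 1 by omega)
    rw [reach]
    omega

/-- Positive slack keeps all targets below the width, so reduction modulo the width changes nothing.
The half-plane cluster starts in generation `1` because the root lacks the additional edge of the
half-plane. -/
theorem mem_cluster_of_slack_pos {M : ℕ} (hd : 0 < slack t (reach t) M)
    (ho : ω ((0, 0), 0) = true) {v : ℕ × ℕ} (hv : v ∈ linCluster t ω (1, 0)) (hM : v.1 ≤ M + 1) :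
    v ∈ cluster t ω := by
  induction hv with
  | refl =>
    have h0 : 0 < t (0, 0) := slack_pos_of_le (Nat.zero_le M) hd
    refine Relation.ReflTransGen.single ⟨0, by simpa [upDegree] using h0, ho, ?_⟩
    simp [upNeighbour, firstChild]
  | @tail u w hu he ih =>
    have hw := le_reach (hu.tail he)
    obtain ⟨j, hj, hoj, rfl⟩ := he
    have h1 := le_reach hu
    simp only at hM hw
    refine (ih (by omega)).tail ⟨j, ?_, hoj, ?_⟩
    · rw [upDegree, if_neg (by omega)]
      omega
    · have h2 := slack_pos_of_le (show u.1 ≤ M by omega) hd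
      have h3 := width_eq_reach_add_slack h2
      rw [Nat.add_sub_cancel] at hw
      rw [upNeighbour, Nat.mod_eq_of_lt (by omega)]

theorem survives_of_slack_pos (h : ∀ k, 0 < slack t (reach t) k) : Survives t := fun r => by
  cases r with
  | zero => exact one_pos
  | succ k =>
    rw [width_eq_reach_add_slack (h k)]
    exact Nat.add_pos_right _ (h k)

/-- The vertices in generations at most `M + 1` that are reachable from the leftmost vertex of the
first generation without winding around the triangulation. -/
def lowCluster (M : ℕ) (x : TreeStates) : Set (ℕ × ℕ) := linCluster x.1 x.2 (1, 0) ∩ {v | v.1 ≤ M + 1}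

/-- The vertices above generation `0` that are at most at position `a k` of generation `k + 1`. -/
def leftOf (a : ℕ → ℕ) : Set (ℕ × ℕ) := {e | 1 ≤ e.1 ∧ e.2 ≤ a (e.1 - 1)}

theorem reach_congr_of_leftOf {M : ℕ} (h : ∀ e ∈ leftOf a, t e = t' e)
    (ha : ∀ k ≤ M, reach t k = a k) {k : ℕ} (hk : k ≤ M) : reach t' k = a k := by
  induction k with
  | zero => exact ha 0 hk
  | succ k ih =>
    rw [← ha (k + 1) hk, reach, reach, ih (by omega), ha k (by omega)]
    exact Finset.sum_congr rfl fun i hi =>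
      (h (k + 1, i) ⟨by simp, by simpa [Nat.lt_succ_iff] using hi⟩).symm

theorem lowCluster_subset {M : ℕ} {x x' : TreeStates} (h : ∀ e ∈ leftOf a, x.1 e = x'.1 e)
    (h' : ∀ e : (ℕ × ℕ) × ℕ, e.1 ∈ leftOf a → x.2 e = x'.2 e)
    (ha : ∀ k ≤ M, reach x.1 k = a k) : lowCluster M x ⊆ lowCluster M x' := by
  rintro v ⟨hv, hM⟩
  refine ⟨?_, hM⟩
  rw [Set.mem_ofPred_eq] at hM
  induction hv with
  | refl => exact .refl
  | @tail u w hu he ih =>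
    obtain ⟨j, hj, hoj, rfl⟩ := he
    simp only at hM
    have h1 := le_reach hu
    have hua : u.2 ≤ a (u.1 - 1) := by
      rw [← ha _ (by omega)]
      exact h1.2
    have hul : u ∈ leftOf a := ⟨h1.1, hua⟩
    refine (ih (by omega)).tail ⟨j, ?_, ?_, ?_⟩
    · rwa [← h u hul]
    · rw [← h' _ hul, hoj]
    · have : firstChild x.1 u.1 u.2 = firstChild x'.1 u.1 u.2 :=
        Finset.sum_congr rfl fun i hi => h (u.1, i) ⟨h1.1, by
          have := Finset.mem_range.1 hi
          simp only
          omega⟩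
      rw [this]

/-- For a fixed sequence `a` the slack ignores the vertices of `leftOf a`, whereas `reach` and the
half-plane cluster use only these. The decoupling of cluster and slack rests on this. -/
theorem slack_congr_of_leftOf (h : ∀ e ∉ leftOf a, t e = t' e) (k : ℕ) :
    slack t a k = slack t' a k := by
  induction k with
  | zero => exact h (0, 0) (by simp [leftOf])
  | succ k ih =>
    rw [slack, slack, ih]
    refine Finset.sum_congr rfl fun i hi => h (k + 1, i) fun hl => ?_
    have h1 := (Finset.mem_Ico.1 hi).1
    have h2 : i ≤ a k := hl.2
    omega

theorem slack_congr_of_lt {k : ℕ} (h : ∀ e : ℕ × ℕ, e.1 < k + 1 → t e = t' e) :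
    slack t a k = slack t' a k := by
  induction k with
  | zero => exact h (0, 0) (by simp)
  | succ k ih =>
    rw [slack, slack, ih fun e he => h e (by omega)]
    exact Finset.sum_congr rfl fun i _ => h (k + 1, i) (by simp)

end Deterministic

section Measurability

theorem measurable_reach (k : ℕ) : Measurable fun t : PlaneTree => reach t k := by
  induction k with
  | zero => exact measurable_const
  | succ k ih =>
    have h : Measurable fun q : PlaneTree × ℕ => firstChild q.1 (k + 1) (q.2 + 1) :=
      measurable_from_prod_countable_left fun i => measurable_firstChild (k + 1) (i + 1)
    exact h.comp (measurable_id.prodMk ih)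

theorem measurable_slack (a : ℕ → ℕ) (k : ℕ) : Measurable fun t : PlaneTree => slack t a k := by
  induction k with
  | zero => exact measurable_pi_apply _
  | succ k ih =>
    have h : Measurable fun q : PlaneTree × ℕ =>
        ∑ i ∈ Finset.Ico (a k + 1) (a k + q.2), q.1 (k + 1, i) :=
      measurable_from_prod_countable_left fun d =>
        Finset.measurable_fun_sum (Finset.Ico (a k + 1) (a k + d)) fun i _ =>
          measurable_pi_apply (k + 1, i)
    exact h.comp (measurable_id.prodMk ih)

theorem measurableSet_lowCluster (M n : ℕ) :
    MeasurableSet {x : TreeStates | (n : ℕ∞) ≤ (lowCluster M x).encard} :=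
  measurableSet_le_encard (fun w => (measurableSet_mem_linCluster (1, 0) w).inter (.const _)) n

end Measurability

section Measure

variable {α p : I}

/-- Of the `d` vertices counted, the first one is given up, so the generating function appears with
exponent `d - 1`; for `d > e` the factor `q ^ (d - 1) ≤ y` makes up for it. -/
theorem lintegral_gapWeight_sum_le {e : ℕ} {y q : ℝ} (hy : 0 < y) (hy1 : y < 1) (hq : 0 < q)
    (hF : offspringGen α (ENNReal.ofReal y) = ENNReal.ofReal (q * y)) (hqe : q ^ e ≤ y) (k b : ℕ)
    (hq1 : q < 1) (d : ℕ) :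
    ∫⁻ x, gapWeight e (ENNReal.ofReal y) (∑ i ∈ Finset.Ico (b + 1) (b + d), x.1 (k, i))
      ∂treeLaw α p ≤ gapWeight e (ENNReal.ofReal y) d := by
  have hy1' : ENNReal.ofReal y ≤ 1 := by simpa using hy1.le
  rcases le_or_gt d e with hd | hd
  · rw [gapWeight, if_pos hd]
    calc _ ≤ ∫⁻ _, 1 ∂treeLaw α p := lintegral_mono fun x => gapWeight_le_one hy1' _
      _ = 1 := by simp
  · have hm : Measurable fun x : TreeStates => gapWeight e (ENNReal.ofReal y)
        (∑ i ∈ Finset.Ico (b + 1) (b + d), x.1 (k, i)) :=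
      (measurable_of_countable (gapWeight e (ENNReal.ofReal y))).comp
        (Finset.measurable_fun_sum _ fun i _ => (measurable_pi_apply (k, i)).comp measurable_fst)
    have hy0 : ENNReal.ofReal y ≠ 0 := by simpa using hy
    refine (ENNReal.mul_le_mul_iff_right (pow_ne_zero e hy0)
      (ENNReal.pow_ne_top ENNReal.ofReal_ne_top)).1 ?_
    rw [← lintegral_const_mul _ hm]
    have hc : ((Finset.Ico (b + 1) (b + d)).image fun i => (k, i)).card = d - 1 := by
      rw [Finset.card_image_of_injective _ fun i j h => by simpa using h, Nat.card_Ico]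
      omega
    calc _ ≤ ∫⁻ x, ENNReal.ofReal y ^
          (∑ e ∈ (Finset.Ico (b + 1) (b + d)).image fun i => (k, i), x.1 e) ∂treeLaw α p := by
          refine lintegral_mono fun x => ?_
          rw [Finset.sum_image fun i _ j _ h => by simpa using h, gapWeight]
          split_ifs with h
          · rw [mul_one]
            exact pow_le_pow_right_of_le_one' hy1' h
          · rw [← pow_add, Nat.add_sub_cancel' (by omega)]
      _ = ENNReal.ofReal (q * y) ^ (d - 1) := by rw [lintegral_pow_sum_treeLaw, hc, hF]
      _ ≤ ENNReal.ofReal y ^ d := by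
          rw [← ENNReal.ofReal_pow (by positivity), ← ENNReal.ofReal_pow hy.le]
          refine ENNReal.ofReal_le_ofReal ?_
          obtain ⟨c, rfl⟩ : ∃ c, d = c + 1 := ⟨d - 1, by omega⟩
          rw [Nat.add_sub_cancel, mul_pow, pow_succ, mul_comm (y ^ c)]
          have := pow_le_pow_of_le_one hq.le hq1.le (show e ≤ c by omega)
          gcongr
          exact this.trans hqe
      _ = _ := by rw [gapWeight, if_neg (by omega), ← pow_add, Nat.add_sub_cancel' hd.le]

theorem lintegral_gapWeight_slack_succ_le {e : ℕ} {y : ℝ≥0∞}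
    (h : ∀ k b d, ∫⁻ x, gapWeight e y (∑ i ∈ Finset.Ico (b + 1) (b + d), x.1 (k, i))
      ∂treeLaw α p ≤ gapWeight e y d) (a : ℕ → ℕ) (k : ℕ) :
    ∫⁻ x, gapWeight e y (slack x.1 a (k + 1)) ∂treeLaw α p ≤
      ∫⁻ x, gapWeight e y (slack x.1 a k) ∂treeLaw α p := by
  let A : ℕ → Set TreeStates := fun d => {x | slack x.1 a k = d}
  have hA : ∀ d, MeasurableSet (A d) := fun d =>
    measurableSet_eq_fun ((measurable_slack a k).comp measurable_fst) measurable_const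
  have hdisj : Pairwise (Function.onFun Disjoint A) := fun d d' hd =>
    Set.disjoint_left.2 fun x hx hx' => hd (hx.symm.trans hx')
  have hU : (Set.univ : Set TreeStates) = ⋃ d, A d := by
    ext x
    simp [A]
  rw [← setLIntegral_univ, ← setLIntegral_univ (fun x : TreeStates => gapWeight e y (slack x.1 a k)), hU,
    lintegral_iUnion hA hdisj, lintegral_iUnion hA hdisj]
  refine ENNReal.tsum_le_tsum fun d => ?_
  have h1 : ∫⁻ x in A d, gapWeight e y (slack x.1 a (k + 1)) ∂treeLaw α p =
      ∫⁻ x in A d, gapWeight e y (∑ i ∈ Finset.Ico (a k + 1) (a k + d), x.1 (k + 1, i))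
        ∂treeLaw α p :=
    setLIntegral_congr_fun (hA d) fun x hx => by
      have hx : slack x.1 a k = d := hx
      simp only [slack, hx]
  have h2 : ∫⁻ x in A d, gapWeight e y (slack x.1 a k) ∂treeLaw α p =
      ∫⁻ _ in A d, gapWeight e y d ∂treeLaw α p :=
    setLIntegral_congr_fun (hA d) fun x hx => by
      have hx : slack x.1 a k = d := hx
      simp only [hx]
  have h3 : ∫⁻ x in A d, gapWeight e y (∑ i ∈ Finset.Ico (a k + 1) (a k + d), x.1 (k + 1, i))
      ∂treeLaw α p = treeLaw α p (A d) *
        ∫⁻ x, gapWeight e y (∑ i ∈ Finset.Ico (a k + 1) (a k + d), x.1 (k + 1, i))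
          ∂treeLaw α p := by
    refine setLIntegral_of_dependsOn (J := {e | e.1 < k + 1}) (hA d)
      ((measurable_of_countable (gapWeight e y)).comp
        (Finset.measurable_fun_sum _ fun i _ => (measurable_pi_apply (k + 1, i)).comp
          measurable_fst)) ?_ ?_
    · intro x x' ht _ hx
      exact (slack_congr_of_lt fun e he => (ht e he).symm).trans hx
    · intro x x' ht _
      rw [Finset.sum_congr rfl fun i _ => ht (k + 1, i) (by simp)]
  rw [h1, h2, h3, setLIntegral_const, mul_comm]
  gcongr
  exact h _ _ _

theorem percolation_state (p : I) (e : (ℕ × ℕ) × ℕ) :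
    percolation p {ω | ω e = true} = ENNReal.ofReal p :=
  (coins_eval p e true).trans (coin_true p)

theorem treeLaw_fst (S : Set PlaneTree) (p : I) :
    treeLaw α p {x | x.1 ∈ S} = galtonWatson α S := by
  have h : {x : TreeStates | x.1 ∈ S} = S ×ˢ Set.univ := by
    ext x
    simp
  rw [h, treeLaw, Measure.prod_prod, measure_univ, mul_one]

theorem exists_le_slack_pos (hα : 1 / 2 < (α : ℝ)) (hα' : (α : ℝ) < 1) :
    ∃ c : ℝ, 0 < c ∧ ∀ (a : ℕ → ℕ) (M : ℕ), c ≤ (galtonWatson α).real {t | 0 < slack t a M} := by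
  obtain ⟨y, q, hy0, hy1, hq0, hq1, hF⟩ := exists_offspringGen_lt hα hα'
  obtain ⟨e, he⟩ : ∃ e : ℕ, q ^ e < y := exists_pow_lt_of_lt_one hy0 hq1
  set Y := ENNReal.ofReal y with hY
  have hY1 : Y ≤ 1 := by simpa [hY] using hy1.le
  have hα0 : (0 : ℝ) < α := by linarith
  set d := (α : ℝ) ^ (e + 1) * (1 - α) with hd
  have hα1 : 0 < 1 - (α : ℝ) := by linarith
  have hd0 : 0 < d := by positivity
  refine ⟨d * (1 - y), mul_pos hd0 (by linarith), fun a M => ?_⟩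
  -- The slack does not involve the states of edges, so the parameter is immaterial.
  let p : I := 0
  have hw : ∫⁻ x, gapWeight e Y (slack x.1 a M) ∂treeLaw α p ≤
      -- The mean weight decreases along the generations, and a vanishing slack has weight `1`. It
      -- is therefore enough that the initial mean weight is below `1`, which holds because the root
      -- can have `e + 1` children.
      ∫⁻ x, gapWeight e Y (slack x.1 a 0) ∂treeLaw α p := by
    induction M with
    | zero => exact le_rfl
    | succ M ih =>
      exact (lintegral_gapWeight_slack_succ_le (fun k b d =>
        lintegral_gapWeight_sum_le hy0 hy1 hq0 hF he.le k b hq1 d) a M).trans ih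
  set B : Set TreeStates := {x | x.1 ∈ {t : PlaneTree | t (0, 0) = e + 1}} with hB
  have hmB : MeasurableSet B :=
    measurableSet_eq_fun ((measurable_pi_apply (0, 0)).comp measurable_fst) measurable_const
  have hBd : treeLaw α p B = ENNReal.ofReal d := by
    rw [hB, treeLaw_fst, hd, ← geometric_singleton hα']
    exact (measurePreserving_eval_infinitePi (fun _ : ℕ × ℕ => geometricMeasure (σ α))
      (0, 0)).measure_preimage (MeasurableSet.singleton (e + 1)).nullMeasurableSet
  have hd1 : d ≤ 1 := by
    have : ENNReal.ofReal d ≤ 1 := hBd ▸ prob_le_one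
    rwa [ENNReal.ofReal_le_one] at this
  have h0 : ∫⁻ x, gapWeight e Y (slack x.1 a 0) ∂treeLaw α p ≤
      ENNReal.ofReal (1 - d * (1 - y)) := by
    have h1 : ∀ x : TreeStates, gapWeight e Y (slack x.1 a 0) ≤
        B.indicator (fun _ => Y) x + Bᶜ.indicator 1 x := fun x => by
      by_cases hx : x ∈ B
      · have hx' : x.1 (0, 0) = e + 1 := hx
        rw [Set.indicator_of_mem hx, Set.indicator_of_notMem (by simpa using hx), add_zero, slack,
          hx', gapWeight, if_neg (by omega), Nat.add_sub_cancel_left, pow_one]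
      · rw [Set.indicator_of_notMem hx, Set.indicator_of_mem (by simpa using hx), zero_add]
        exact gapWeight_le_one hY1 _
    refine (lintegral_mono h1).trans ?_
    rw [lintegral_add_left (measurable_const.indicator hmB), lintegral_indicator_const hmB,
      lintegral_indicator_one hmB.compl, prob_compl_eq_one_sub hmB, hBd, hY,
      ← ENNReal.ofReal_mul hy0.le, ← ENNReal.ofReal_one, ← ENNReal.ofReal_sub _ hd0.le,
      ← ENNReal.ofReal_add (mul_nonneg hy0.le hd0.le) (sub_nonneg.2 hd1)]
    refine le_of_eq ?_
    congr 1
    ring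
  have hms : MeasurableSet {t : PlaneTree | 0 < slack t a M} :=
    measurableSet_lt measurable_const (measurable_slack a M)
  have h2 : galtonWatson α {t | 0 < slack t a M}ᶜ ≤ ENNReal.ofReal (1 - d * (1 - y)) := by
    refine le_trans ?_ (hw.trans h0)
    rw [← treeLaw_fst _ p, ← lintegral_indicator_one (show MeasurableSet
      {x : TreeStates | x.1 ∈ {t | 0 < slack t a M}ᶜ} from measurable_fst hms.compl)]
    refine lintegral_mono fun x => ?_
    refine Set.indicator_apply_le' (fun hx => ?_) fun _ => zero_le
    have hx : slack x.1 a M = 0 := by simpa using hx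
    rw [hx, gapWeight, if_pos (Nat.zero_le _), Pi.one_apply]
  have h3 : (galtonWatson α).real {t | 0 < slack t a M}ᶜ ≤ 1 - d * (1 - y) :=
    ENNReal.toReal_le_of_le_ofReal (by nlinarith) h2
  rw [probReal_compl_eq_one_sub hms] at h3
  linarith

end Measure

/-- Up to generation `M + 1`, the vertices that are reachable from the leftmost vertex of the first
generation without winding around the triangulation do not cover a whole generation, and the
leftmost edge of the root is open. -/
def slackSet (M : ℕ) : Set TreeStates :=
  {x | 0 < slack x.1 (reach x.1) M ∧ x.2 ((0, 0), 0) = true}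

/-- The extension of a finite sequence by `0`. -/
def extendZero {M : ℕ} (a : Fin (M + 1) → ℕ) (k : ℕ) : ℕ := if h : k < M + 1 then a ⟨k, h⟩ else 0

/-- The first values of `reach`. -/
def reachFin (M : ℕ) (x : TreeStates) (k : Fin (M + 1)) : ℕ := reach x.1 k

theorem measurable_reachFin (M : ℕ) : Measurable (reachFin M) :=
  measurable_pi_lambda _ fun k => (measurable_reach k).comp measurable_fst

theorem reachFin_eq_iff {M : ℕ} {a : Fin (M + 1) → ℕ} {x : TreeStates} :
    reachFin M x = a ↔ ∀ k ≤ M, reach x.1 k = extendZero a k := by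
  constructor
  · rintro rfl k hk
    rw [extendZero, dif_pos (by omega), reachFin]
  · intro h
    ext k
    rw [reachFin, h k (by omega), extendZero, dif_pos k.2]

theorem reachFin_inter_slackSet {M : ℕ} (a : Fin (M + 1) → ℕ) :
    reachFin M ⁻¹' {a} ∩ slackSet M = reachFin M ⁻¹' {a} ∩
      {x | 0 < slack x.1 (extendZero a) M ∧ x.2 ((0, 0), 0) = true} := by
  ext x
  refine and_congr_right fun hx => ?_
  rw [slackSet, Set.mem_ofPred_eq, Set.mem_ofPred_eq, slack_congr (reachFin_eq_iff.1 hx) le_rfl]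

theorem measurableSet_slack_open (a : ℕ → ℕ) (M : ℕ) :
    MeasurableSet {x : TreeStates | 0 < slack x.1 a M ∧ x.2 ((0, 0), 0) = true} :=
  (measurableSet_lt measurable_const ((measurable_slack a M).comp measurable_fst)).inter
    (measurableSet_state _)

theorem measurableSet_slackSet (M : ℕ) : MeasurableSet (slackSet M) := by
  have h : slackSet M = ⋃ a, reachFin M ⁻¹' {a} ∩ slackSet M := by
    ext x
    simp
  rw [h]
  refine .iUnion fun a => ?_
  rw [reachFin_inter_slackSet]
  exact (measurable_reachFin M (.singleton a)).inter (measurableSet_slack_open _ M)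

theorem antitone_slackSet : Antitone slackSet := fun _ _ h _ hx => ⟨slack_pos_of_le h hx.1, hx.2⟩

section Measure

variable {α p : I} {c : ℝ≥0∞}

theorem treeLaw_slack_open (a : ℕ → ℕ) (M : ℕ) :
    treeLaw α p {x | 0 < slack x.1 a M ∧ x.2 ((0, 0), 0) = true} =
      galtonWatson α {t | 0 < slack t a M} * ENNReal.ofReal p := by
  rw [← percolation_state p ((0, 0), 0), ← Measure.prod_prod]
  rfl

/-- Split according to the values of `reach`. For each of them, cluster and slack live on
complementary sets of vertices, so positive slack costs a factor `c` and the open edge at the root a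
factor `p`. -/
theorem mul_treeLaw_lowCluster_le (hc : ∀ a M, c ≤ galtonWatson α {t | 0 < slack t a M})
    {N M : ℕ} (hNM : N ≤ M) (n : ℕ) :
    c * ENNReal.ofReal p * treeLaw α p {x | (n : ℕ∞) ≤ (lowCluster N x).encard} ≤
      treeLaw α p ({x | (n : ℕ∞) ≤ (lowCluster N x).encard} ∩ slackSet M) := by
  set L : Set TreeStates := {x | (n : ℕ∞) ≤ (lowCluster N x).encard} with hL
  have hmf : ∀ a, MeasurableSet (reachFin M ⁻¹' {a}) := fun a =>
    measurable_reachFin M (.singleton a)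
  have hmL : MeasurableSet L := measurableSet_lowCluster N n
  have hdec : ∀ E : Set TreeStates, treeLaw α p E =
      ∑' a : (Set.univ : Set (Fin (M + 1) → ℕ)), treeLaw α p (reachFin M ⁻¹' {a.1} ∩ E) :=
    fun E => by
      have := tsum_measure_preimage_singleton (μ := (treeLaw α p).restrict E)
        (s := Set.univ) Set.countable_univ fun a _ => hmf a
      rw [Set.preimage_univ, Measure.restrict_apply_univ] at this
      rw [← this]
      exact tsum_congr fun a => Measure.restrict_apply (hmf a.1)
  rw [hdec L, hdec (L ∩ slackSet M), ← ENNReal.tsum_mul_left]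
  refine ENNReal.tsum_le_tsum fun ⟨a, _⟩ => ?_
  simp only
  have h1 : reachFin M ⁻¹' {a} ∩ (L ∩ slackSet M) = (reachFin M ⁻¹' {a} ∩ L) ∩
      {x | 0 < slack x.1 (extendZero a) M ∧ x.2 ((0, 0), 0) = true} := by
    rw [Set.inter_comm L, ← Set.inter_assoc, reachFin_inter_slackSet, Set.inter_right_comm]
  rw [h1, treeLaw_inter (J := leftOf (extendZero a)) ((hmf a).inter hmL)
    (measurableSet_slack_open _ M), treeLaw_slack_open, mul_comm]
  · gcongr
    exact hc _ _
  · rintro x x' ht ho ⟨hx, hxL⟩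
    have hx1 := reachFin_eq_iff.1 hx
    refine ⟨reachFin_eq_iff.2 fun k hk => reach_congr_of_leftOf ht hx1 hk, ?_⟩
    exact le_trans (show (n : ℕ∞) ≤ (lowCluster N x).encard from hxL)
      (Set.encard_le_encard (lowCluster_subset ht ho fun k hk => hx1 k (hk.trans hNM)))
  · rintro x x' ht ho ⟨hx, hxo⟩
    refine ⟨?_, ?_⟩
    · rwa [← slack_congr_of_leftOf fun e he => ht e he]
    · rw [← ho ((0, 0), 0) (by simp [leftOf]), hxo]

/-- Letting `M → ∞` makes the slack positive in all generations, which also ensures that the tree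
survives. -/
theorem mul_treeLaw_lowCluster_le_cluster
    (hc : ∀ a M, c ≤ galtonWatson α {t | 0 < slack t a M}) (N n : ℕ) :
    c * ENNReal.ofReal p * treeLaw α p {x | (n : ℕ∞) ≤ (lowCluster N x).encard} ≤
      treeLaw α p ({x | (n : ℕ∞) ≤ (cluster x.1 x.2).encard} ∩ {x | Survives x.1}) := by
  set L : Set TreeStates := {x | (n : ℕ∞) ≤ (lowCluster N x).encard} with hL
  have h1 : Filter.Tendsto (fun M => treeLaw α p (L ∩ slackSet M)) Filter.atTop
      (nhds (treeLaw α p (⋂ M, L ∩ slackSet M))) :=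
    tendsto_measure_iInter_atTop
      (fun M => ((measurableSet_lowCluster N n).inter (measurableSet_slackSet M)).nullMeasurableSet)
      (fun _ _ h => Set.inter_subset_inter_right _ (antitone_slackSet h)) ⟨0, measure_ne_top _ _⟩
  refine (ge_of_tendsto h1 ?_).trans (measure_mono fun x hx => ?_)
  · filter_upwards [Filter.eventually_ge_atTop N] with M hM using mul_treeLaw_lowCluster_le hc hM n
  · have hx' : ∀ M, x ∈ L ∩ slackSet M := Set.mem_iInter.1 hx
    refine ⟨?_, survives_of_slack_pos fun k => (hx' k).2.1⟩
    refine le_trans (show (n : ℕ∞) ≤ (lowCluster N x).encard from (hx' 0).1)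
      (Set.encard_le_encard ?_)
    exact fun v hv => mem_cluster_of_slack_pos (hx' N).2.1 (hx' N).2.2 hv.1 hv.2

theorem iUnion_lowCluster (n : ℕ) :
    ⋃ N, {x : TreeStates | (n : ℕ∞) ≤ (lowCluster N x).encard} =
      {x | (n : ℕ∞) ≤ (linCluster x.1 x.2 (1, 0)).encard} := by
  ext x
  simp only [Set.mem_iUnion, Set.mem_ofPred_eq]
  constructor
  · rintro ⟨N, hN⟩
    exact hN.trans (Set.encard_le_encard Set.inter_subset_left)
  · intro hx
    obtain ⟨s, hs, hn⟩ := Set.exists_subset_encard_eq hx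
    have hf : s.Finite := Set.finite_of_encard_eq_coe hn
    obtain ⟨N, hN⟩ := (hf.image Prod.fst).bddAbove
    refine ⟨N, hn.ge.trans (Set.encard_le_encard fun v hv => ⟨hs hv, ?_⟩)⟩
    exact (hN (Set.mem_image_of_mem _ hv)).trans (Nat.le_succ N)

theorem mul_bitTail_le (hα' : (α : ℝ) < 1) {c : ℝ} (hc0 : 0 ≤ c)
    (hc : ∀ a M, c ≤ (galtonWatson α).real {t | 0 < slack t a M}) (n : ℕ) :
    c * p * bitTail α p n ≤
      (treeLaw α p).real ({x | (n : ℕ∞) ≤ (cluster x.1 x.2).encard} ∩ {x | Survives x.1}) := by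
  have hc' : ∀ a M, ENNReal.ofReal c ≤ galtonWatson α {t | 0 < slack t a M} := fun a M =>
    ENNReal.ofReal_le_of_le_toReal (hc a M)
  have hmono : Monotone fun N => {x : TreeStates | (n : ℕ∞) ≤ (lowCluster N x).encard} :=
    fun N N' h x hx => le_trans (show (n : ℕ∞) ≤ (lowCluster N x).encard from hx)
      (Set.encard_le_encard (Set.inter_subset_inter_right _ fun v hv =>
        le_trans (show v.1 ≤ N + 1 from hv) (Nat.succ_le_succ h)))
  have h1 := ENNReal.Tendsto.const_mul (a := ENNReal.ofReal c * ENNReal.ofReal p)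
    (tendsto_measure_iUnion_atTop (μ := treeLaw α p) hmono)
    (.inr (ENNReal.mul_ne_top ENNReal.ofReal_ne_top ENNReal.ofReal_ne_top))
  have h2 := le_of_tendsto' h1 fun N => mul_treeLaw_lowCluster_le_cluster hc' N n
  rw [iUnion_lowCluster] at h2
  have h3 := ENNReal.toReal_mono (measure_ne_top _ _) h2
  rw [ENNReal.toReal_mul, ENNReal.toReal_mul, ENNReal.toReal_ofReal hc0,
    ENNReal.toReal_ofReal p.2.1] at h3
  rw [← treeLaw_large_linCluster hα' p 1 n]
  exact h3

theorem exists_le_clusterTail (hα : 1 / 2 < (α : ℝ)) (hα' : (α : ℝ) < 1) :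
    ∃ c : ℝ, 0 < c ∧ ∀ p : I, (criticalParam α : ℝ) ≤ p → ∀ n,
      c * bitTail α p n ≤ clusterTail α p n := by
  obtain ⟨c, hc0, hc⟩ := exists_le_slack_pos hα hα'
  have hpc := criticalParam_pos hα hα'
  -- The case `n = 0`, where the tail is `1`, bounds the survival probability from below.
  have hS : 0 < (galtonWatson α).real {t | Survives t} := by
    have h1 := mul_bitTail_le (p := criticalParam α) hα' hc0.le hc 0
    have h2 : bitTail α (criticalParam α) 0 = 1 := by
      rw [← treeLaw_large_linCluster hα' _ 0 0]
      simp
    rw [h2, mul_one] at h1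
    refine (mul_pos hc0 hpc).trans_le (h1.trans ?_)
    rw [measureReal_def, measureReal_def, ← treeLaw_fst _ (criticalParam α)]
    exact ENNReal.toReal_mono (measure_ne_top _ _) (measure_mono Set.inter_subset_right)
  refine ⟨c * criticalParam α, mul_pos hc0 hpc, fun p hp n => ?_⟩
  rw [clusterTail_eq]
  have h1 := mul_bitTail_le (p := p) hα' hc0.le hc n
  have h2 : 0 ≤ bitTail α p n := measureReal_nonneg
  calc c * criticalParam α * bitTail α p n ≤ c * p * bitTail α p n := by gcongr
    _ ≤ _ := h1
    _ ≤ _ := le_mul_of_one_le_left measureReal_nonneg (one_le_inv₀ hS |>.2 measureReal_le_one)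

/-- The events of having at least `n` vertices decrease to the event of an infinite cluster. -/
theorem percolationProb_ge {b : ℝ} (h : ∀ n, b ≤ clusterTail α p n) : b ≤ percolationProb α p := by
  have hf : IsFiniteMeasure (annealed α p) := by
    unfold annealed survivingTree
    infer_instance
  have h1 : Filter.Tendsto (fun n : ℕ => annealed α p {x | (n : ℕ∞) ≤ (cluster x.1 x.2).encard})
      Filter.atTop (nhds (annealed α p (⋂ n : ℕ, {x | (n : ℕ∞) ≤ (cluster x.1 x.2).encard}))) :=
    tendsto_measure_iInter_atTop
      (fun n => (measurableSet_le_encard measurableSet_mem_cluster n).nullMeasurableSet)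
      (fun m n hmn x hx => le_trans (Nat.cast_le.2 hmn) (show (n : ℕ∞) ≤ _ from hx))
      ⟨0, measure_ne_top _ _⟩
  rw [← infinite_eq_iInter] at h1
  exact ge_of_tendsto' ((ENNReal.tendsto_toReal (measure_ne_top _ _)).comp h1) h

end Measure

end SCT

theorem theorem2 (α : unitInterval) (hα : 1 / 2 < (α : ℝ)) (hα' : (α : ℝ) < 1) :
    (∃ c : ℝ, 0 < c ∧ ∀ n : ℕ, 1 ≤ n →
      c * (n : ℝ) ^ (-(1 / 2) : ℝ) ≤ SCT.clusterTail α (SCT.criticalParam α) n) ∧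
    (∃ c : ℝ, 0 < c ∧ ∀ n : ℕ, 2 ≤ n →
      SCT.clusterTail α (SCT.criticalParam α) n ≤
        c * (Real.log n * (n : ℝ) ^ (-(1 / 2) : ℝ))) ∧
    (∃ C : ℝ, 0 < C ∧ ∀ p : unitInterval, (SCT.criticalParam α : ℝ) < p →
      C⁻¹ * ((p : ℝ) - SCT.criticalParam α) ≤ SCT.percolationProb α p ∧
        SCT.percolationProb α p ≤ C * ((p : ℝ) - SCT.criticalParam α)) := by
  obtain ⟨c, hc0, hc⟩ := SCT.exists_le_clusterTail hα hα'
  have hsqrt : ∀ n : ℕ, (n : ℝ) ^ (-(1 / 2) : ℝ) = 1 / √n := fun n => by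
    rw [Real.rpow_neg (Nat.cast_nonneg n), Real.sqrt_eq_rpow, one_div (_ ^ _)]
  refine ⟨?_, ?_, ?_⟩
  · obtain ⟨d, hd0, hd⟩ := SCT.exists_le_bitTail hα hα'
    refine ⟨c * d, mul_pos hc0 hd0, fun n hn => ?_⟩
    calc _ = c * (d / √n) := by rw [hsqrt]; ring
      _ ≤ c * SCT.bitTail α (SCT.criticalParam α) n := mul_le_mul_of_nonneg_left (hd n hn) hc0.le
      _ ≤ _ := hc _ le_rfl n
  · obtain ⟨K, hK0, hK⟩ := SCT.exists_clusterTail_le hα hα'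
    -- The tail bound holds without logarithm; `log n ≥ log 2` inserts it.
    have hlog : 0 < Real.log 2 := Real.log_pos (by norm_num)
    refine ⟨K / Real.log 2, by positivity, fun n hn => (hK n (by omega)).trans ?_⟩
    have h1 : Real.log 2 ≤ Real.log n := Real.log_le_log (by norm_num) (by exact_mod_cast hn)
    rw [hsqrt]
    calc K / √n = K / Real.log 2 * (Real.log 2 * (1 / √n)) := by field_simp
      _ ≤ _ := by gcongr
  · obtain ⟨K, hK0, hK⟩ := SCT.exists_percolationProb_le hα hα'
    have ho := SCT.criticalOdds_nonneg α
    have hb : 0 < c * (1 + SCT.criticalOdds α) := by positivity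
    refine ⟨max K (c * (1 + SCT.criticalOdds α))⁻¹, lt_max_of_lt_left hK0, fun p hp => ⟨?_, ?_⟩⟩
    · have hp' : 0 ≤ (p : ℝ) - SCT.criticalParam α := by linarith
      refine SCT.percolationProb_ge fun n => ?_
      calc _ ≤ c * (1 + SCT.criticalOdds α) * ((p : ℝ) - SCT.criticalParam α) := by
            gcongr
            exact inv_le_of_inv_le₀ hb (le_max_right _ _)
        _ = c * ((1 + SCT.criticalOdds α) * ((p : ℝ) - SCT.criticalParam α)) := by ring
        _ ≤ c * SCT.bitTail α p n :=
            mul_le_mul_of_nonneg_left (SCT.drift_le_bitTail hα hα' hp.le n) hc0.le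
        _ ≤ _ := hc p hp.le n
    · have hp' : 0 ≤ (p : ℝ) - SCT.criticalParam α := by linarith
      exact (hK p hp).trans (mul_le_mul_of_nonneg_right (le_max_left _ _) hp')
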